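/- **Setting.** Let $\mathbb k\in\{\mathbb R,\mathbb C\}$, let $(V,\omega)$ be a symplectic vector space over $\mathbb k$ of dimension $2r$, and fix an inner product on $V$ (Hermitian if $\mathbb k=\mathbb C$). Let $\mathcal P=\mathbb P(V)$ with its Borel sets. For $k\ge 0$ let $X_k\subset\mathcal P^{k+1}$ be the set of tuples $(p_0,\dots,p_k)$ whose span is isotropic of dimension $k+1$, and let $\delta_i\colon X_{k+1}\to X_k$ delete the $i$-th entry. For a subspace $0\ne W\subset V$, let $\lambda_W$ be the probability measure on $\mathcal P$ supported on $\mathbb P(W)$ obtained by pushing forward, along $W\setminus\{0\}\to\mathbb P(W)$, the restriction to the unit ball of $W$ of the Lebesgue measure on $W$ normalized to give this ball mass $1$. For a set $S\subset\mathcal P$ with $\operatorname{span}(S)^\omega\neq 0$ put $\nu_S=\lambda_{\operatorname{span}(S)^{\omega}}$, where $(\cdot)^\omega$ is the $\omega$-complement. Define probability measures by $\mu_0=\lambda_V$ and $d\mu_{k+1}(p,x)=d\nu_{\{p_0,\dots,p_k\}}(x)\,d\mu_k(p)$; for $k\le r-1$ the measure $\mu_k$ restricts to a probability measure on $X_k$.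 $\mathscr L^\infty(X_k)$ denotes the space of bounded Borel functions $X_k\to\mathbb R$, and $L^\infty(X_k)=L^\infty(X_k,\mu_k)$ the space of function classes. Put $d^kf=\sum_{i=0}^{k+1}(-1)^i f\circ\delta_i$ for $k\ge 0$; let $d^{-1}$ be the inclusion of $\mathscr L^\infty(X_{-1}):=\mathbb R$ as constants, and let $d^{-2}h^{-2}:=0$. **The operators.** Let $q\in\mathbb N$ with $2^q+\lceil (q+1)/2\rceil\le r$. For $0\le k\le q$ and $p\in X_k$, let $(t_J)_{J\subset\{0,\dots,k\}}$ be random points of $\mathcal P$ with joint law $$\Big(\prod_{\emptyset\ne J\subset \{0,\dots,k\}} d\nu_{\{p_j : j\in J\}\cup\{t_{J'}\,:\,J'\subsetneq J\}}(t_J)\Big)\,d\mu_0(t_\emptyset),$$ the factors being arranged by the cardinality of $J$ from largest to smallest (so that $t_\emptyset$ is chosen first). For $0\le n\le k+1$, a descending $k$-chain of length $n$ is a sequence $C=(C_0\supset C_1\supset\dots\supset C_n)$ of subsets of $\{0,\dots,k\}$ with $|C_m|=k+1-m$. Let $C_n=\{i_0<\dots<i_{k-n}\}$, let $j_m$ be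 the position, counted from $0$, in the increasingly ordered set $C_m$ of the element removed in passing to $C_{m+1}$, and put $$\operatorname{sgn}(C)=(-1)^{n+j_0+\dots+j_{n-1}},\qquad t(p,C)=(t_{C_0},\dots,t_{C_n},p_{i_0},\dots,p_{i_{k-n}}).$$ Put $h^{-1}f=\mathbb E[f(t_\emptyset)]=\int_{X_0} f\,d\mu_0$ for $f\in\mathscr L^\infty(X_0)$ and, for $0\le k\le q$ and $f\in\mathscr L^\infty(X_{k+1})$, $$h^kf(p)=\sum_{C}\operatorname{sgn}(C)\,\mathbb E\big[f(t(p,C))\big]\qquad(p\in X_k),$$ the sum being over all descending $k$-chains $C$. **Theorem 4.1.** Suppose $2^q+\lceil (q+1)/2\rceil\le r$. Then the joint laws above are probability measures, $t(p,C)\in X_{k+1}$ almost surely for all $0\le k\le q$, $p\in X_k$ and all descending $k$-chains $C$, and the formulas above define linear maps $h^k\colon\mathscr L^\infty(X_{k+1})\to\mathscr L^\infty(X_k)$ for $-1\le k\le q$. Moreover: (i) For all $k\in\{-1,\dots,q\}$ one has $h^kd^k+d^{k-1}h^{k-1}=\mathrm{id}$ on $\mathscr L^\infty(X_k)$. In particular,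 the complex $$0\to\mathbb R\xrightarrow{d^{-1}}\mathscr L^\infty(X_0)\xrightarrow{d^0}\mathscr L^\infty(X_1)\to\dots\to\mathscr L^\infty(X_q)\xrightarrow{d^q}\mathscr L^\infty(X_{q+1})$$ is exact at $\mathbb R$ and at $\mathscr L^\infty(X_k)$ for all $0\le k\le q$. (ii) For all $k\in\{-1,\dots,q\}$, $h^k$ descends to a linear map $L^\infty(X_{k+1})\to L^\infty(X_k)$ (with $L^\infty(X_{-1}):=\mathbb R$). The maps $d^k$, $0\le k\le q$, descend to function classes as well, and the complex $$0\to\mathbb R\to L^\infty(X_0)\to L^\infty(X_1)\to\dots\to L^\infty(X_q)\to L^\infty(X_{q+1})$$ is exact at $\mathbb R$ and at $L^\infty(X_k)$ for all $0\le k\le q$. -/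

import Mathlib

open MeasureTheory Module
open scoped LinearAlgebra.Projectivization ENNReal

namespace SympStiefel

noncomputable section

/-- The quotient topology on a projective space. -/
instance projTopology {𝕜 V : Type*} [DivisionRing 𝕜] [AddCommGroup V] [Module 𝕜 V]
    [TopologicalSpace V] : TopologicalSpace (ℙ 𝕜 V) :=
  TopologicalSpace.coinduced (Projectivization.mk' 𝕜) inferInstance

/-- Projective spaces carry their Borel sets. -/
instance projMeasurableSpace {𝕜 V : Type*} [DivisionRing 𝕜] [AddCommGroup V] [Module 𝕜 V]
    [TopologicalSpace V] : MeasurableSpace (ℙ 𝕜 V) :=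
  borel _

instance projBorelSpace {𝕜 V : Type*} [DivisionRing 𝕜] [AddCommGroup V] [Module 𝕜 V]
    [TopologicalSpace V] : BorelSpace (ℙ 𝕜 V) :=
  ⟨rfl⟩

/-- The space of bounded (everywhere defined, Borel) measurable real functions. -/
def BddMeas (X : Type*) [MeasurableSpace X] : Submodule ℝ (X → ℝ) where
  carrier := {f | Measurable f ∧ ∃ c : ℝ, ∀ x, |f x| ≤ c}
  zero_mem' := ⟨measurable_zero, 0, fun x => by simp⟩
  add_mem' := by
    rintro f g ⟨hf, c, hc⟩ ⟨hg, d, hd⟩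
    exact ⟨hf.add hg, c + d, fun x => (abs_add_le _ _).trans (add_le_add (hc x) (hd x))⟩
  smul_mem' := by
    rintro a f ⟨hf, c, hc⟩
    refine ⟨hf.const_smul a, |a| * c, fun x => ?_⟩
    simp only [Pi.smul_apply, smul_eq_mul, abs_mul]
    exact mul_le_mul_of_nonneg_left (hc x) (abs_nonneg a)

/-- The class in `L^∞` of a bounded measurable function. -/
def toLinf {X : Type*} [MeasurableSpace X] (μ : Measure X) : BddMeas X →ₗ[ℝ] Lp ℝ ∞ μ where
  toFun f := MemLp.toLp f.1 (by
    obtain ⟨hf, c, hc⟩ := f.2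
    exact memLp_top_of_bound hf.aestronglyMeasurable c (Filter.Eventually.of_forall hc))
  map_add' _ _ := rfl
  map_smul' _ _ := rfl

/-! ### Combinatorics of descending chains -/

/-- Descending `k`-chains of length `n`: sequences `C_0 ⊃ C_1 ⊃ … ⊃ C_n` of subsets of
`{0, …, k}` with `|C_i| = k + 1 - i`. -/
def DescChain (k n : ℕ) : Type :=
  {C : Fin (n + 1) → Finset (Fin (k + 1)) // Antitone C ∧ ∀ i, (C i).card + (i : ℕ) = k + 1}

instance (k n : ℕ) : Finite (DescChain k n) :=
  inferInstanceAs (Finite {C : Fin (n + 1) → Finset (Fin (k + 1)) //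
    Antitone C ∧ ∀ i, (C i).card + (i : ℕ) = k + 1})

instance (k n : ℕ) : Fintype (DescChain k n) := Fintype.ofFinite _

/-- The position (counted from `0`, in increasing order) inside `C_m` of the element which is
removed when passing from `C_m` to `C_{m+1}`. -/
def DescChain.removedPos {k n : ℕ} (C : DescChain k n) (m : Fin n) : ℕ :=
  open Classical in
  ((C.1 m.castSucc).filter fun a => ∃ b ∈ C.1 m.castSucc \ C.1 m.succ, a < b).card

/-- The sign `(-1)^(n + j_0 + ⋯ + j_{n-1})`, where `j_m` is the position in `C_m` of the element
removed in the `m`-th step. (In the last step of a chain ending in `∅` the position is `0`, so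
such a chain has the opposite sign of the chain obtained by deleting its component `∅`.) -/
def DescChain.sgn {k n : ℕ} (C : DescChain k n) : ℝ :=
  (-1) ^ (n + ∑ m : Fin n, C.removedPos m)

/-- For `C = (C_0 ⊃ ⋯ ⊃ C_n)` with `C_n = {i_0 < ⋯ < i_{k-n}}`, points `p_0, …, p_k` and
a family `t` of points indexed by the subsets of `{0, …, k}`, the tuple
`(t_{C_0}, …, t_{C_n}, p_{i_0}, …, p_{i_{k-n}})`. -/
def DescChain.tuple {k n : ℕ} (C : DescChain k n) {P : Type*} (p : Fin (k + 1) → P)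
    (t : Finset (Fin (k + 1)) → P) : Fin (k + 2) → P := fun j =>
  if hj : (j : ℕ) ≤ n then t (C.1 ⟨j, Nat.lt_succ_of_le hj⟩)
  else p ((C.1 (Fin.last n)).orderEmbOfFin rfl ⟨j - (n + 1), by
    have h1 := C.2.2 (Fin.last n)
    have h2 := j.2
    rw [Fin.val_last] at h1
    omega⟩)

section

variable {𝕜 V : Type*} [RCLike 𝕜] [NormedAddCommGroup V] [InnerProductSpace 𝕜 V]

/-! ### Stiefel varieties -/

/-- The linear span of a set of points of the projective space. -/
def lineSpan (S : Set (ℙ 𝕜 V)) : Submodule 𝕜 V := ⨆ p ∈ S, p.submodule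

/-- The `k`-Stiefel variety `X_k`: tuples `(p_0, …, p_k)` of points of `ℙ(V)` whose span is
isotropic of dimension `k + 1`. -/
def stiefel (ω : V →ₗ[𝕜] V →ₗ[𝕜] 𝕜) (k : ℕ) : Set (Fin (k + 1) → ℙ 𝕜 V) :=
  {p | lineSpan (Set.range p) ≤ (lineSpan (Set.range p)).orthogonalBilin ω ∧
    finrank 𝕜 (lineSpan (Set.range p)) = k + 1}

theorem lineSpan_mono {S T : Set (ℙ 𝕜 V)} (h : S ⊆ T) : lineSpan S ≤ lineSpan T :=
  biSup_mono h

theorem lineSpan_range {k : ℕ} (p : Fin k → ℙ 𝕜 V) :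
    lineSpan (Set.range p) = Submodule.span 𝕜 (Set.range fun i => (p i).rep) := by
  rw [lineSpan, iSup_range, Submodule.span_range_eq_iSup]
  exact iSup_congr fun i => Projectivization.submodule_eq (p i)

theorem face_mem (ω : V →ₗ[𝕜] V →ₗ[𝕜] 𝕜) {k : ℕ} (i : Fin (k + 2))
    {p : Fin (k + 2) → ℙ 𝕜 V} (hp : p ∈ stiefel ω (k + 1)) :
    (fun j => p (i.succAbove j)) ∈ stiefel ω k := by
  obtain ⟨h1, h2⟩ := hp
  have hsub : lineSpan (Set.range fun j => p (i.succAbove j)) ≤ lineSpan (Set.range p) := by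
    apply lineSpan_mono
    rintro _ ⟨j, rfl⟩
    exact ⟨_, rfl⟩
  refine ⟨fun x hx y hy => h1 (hsub hx) y (hsub hy), ?_⟩
  have hli : LinearIndependent 𝕜 (fun j => (p j).rep) := by
    rw [linearIndependent_iff_card_eq_finrank_span, Set.finrank, ← lineSpan_range, h2]
    simp
  have hli' := hli.comp i.succAbove Fin.succAbove_right_injective
  rw [linearIndependent_iff_card_eq_finrank_span, Set.finrank] at hli'
  rw [lineSpan_range]
  exact hli'.symm.trans (Fintype.card_fin _)

/-- The face map `X_{k+1} → X_k` deleting the `i`-th entry. -/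
def face (ω : V →ₗ[𝕜] V →ₗ[𝕜] 𝕜) {k : ℕ} (i : Fin (k + 2)) (p : stiefel ω (k + 1)) :
    stiefel ω k :=
  ⟨fun j => p.1 (i.succAbove j), face_mem ω i p.2⟩

theorem measurable_face (ω : V →ₗ[𝕜] V →ₗ[𝕜] 𝕜) {k : ℕ} (i : Fin (k + 2)) :
    Measurable (face ω i) := by
  refine Measurable.subtype_mk (measurable_pi_lambda _ fun j => ?_)
  exact (measurable_pi_apply (i.succAbove j)).comp measurable_subtype_coe

/-- The coboundary operator `d^k f = ∑_i (-1)^i f ∘ δ_i` on bounded measurable functions. -/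
def dMeas (ω : V →ₗ[𝕜] V →ₗ[𝕜] 𝕜) (k : ℕ) :
    BddMeas (stiefel ω k) →ₗ[ℝ] BddMeas (stiefel ω (k + 1)) where
  toFun f := ⟨fun p => ∑ i : Fin (k + 2), (-1) ^ (i : ℕ) * f.1 (face ω i p), by
    obtain ⟨hf, c, hc⟩ := f.2
    refine ⟨?_, ∑ _i : Fin (k + 2), c, fun p => ?_⟩
    · exact Finset.measurable_fun_sum _ fun i _ =>
        (hf.comp (measurable_face ω i)).const_mul _
    · refine (Finset.abs_sum_le_sum_abs _ _).trans (Finset.sum_le_sum fun i _ => ?_)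
      rw [abs_mul, abs_pow, abs_neg, abs_one, one_pow, one_mul]
      exact hc _⟩
  map_add' f g := by
    ext p
    simp [mul_add, Finset.sum_add_distrib]
  map_smul' a f := by
    ext p
    simp [Finset.mul_sum, mul_left_comm]

/-- The coaugmentation `d^{-1}`: the inclusion of the constant functions. -/
def dNegOne (ω : V →ₗ[𝕜] V →ₗ[𝕜] 𝕜) : ℝ →ₗ[ℝ] BddMeas (stiefel ω 0) where
  toFun c := ⟨fun _ => c, measurable_const, |c|, fun _ => le_rfl⟩
  map_add' _ _ := rfl
  map_smul' _ _ := rfl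

/-! ### Measures -/

variable [FiniteDimensional 𝕜 V] [MeasurableSpace V] [BorelSpace V]

/-- The closed unit ball of a linear subspace. -/
def unitBall (W : Submodule 𝕜 V) : TopologicalSpace.PositiveCompacts W where
  carrier := Metric.closedBall 0 1
  isCompact' := isCompact_closedBall 0 1
  interior_nonempty' :=
    ⟨0, Metric.ball_subset_interior_closedBall (Metric.mem_ball_self one_pos)⟩

/-- The measure `λ_W` on `ℙ(V)`, supported on `ℙ(W)`: the push-forward under the projection
`W ∖ {0} → ℙ(W)` of the Lebesgue measure of `W`, normalized to give mass one to the unit ball,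
and restricted to the unit ball. -/
def projMeasure (W : Submodule 𝕜 V) : Measure (ℙ 𝕜 V) :=
  (((Measure.addHaarMeasure (unitBall W)).restrict (unitBall W)).comap
    (Subtype.val : {w : W // (w : V) ≠ 0} → W)).map
      (fun w : {w : W // (w : V) ≠ 0} => Projectivization.mk 𝕜 (w.1 : V) w.2)

/-- The perpendicular measure `ν_S = λ_{span(S)^ω}` of a set `S` of points. -/
def perpMeasure (ω : V →ₗ[𝕜] V →ₗ[𝕜] 𝕜) (S : Set (ℙ 𝕜 V)) : Measure (ℙ 𝕜 V) :=
  projMeasure ((lineSpan S).orthogonalBilin ω)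

/-- The measures `μ_k`, as measures on `ℙ(V)^(k+1)`: `μ_0 = λ_V` and
`dμ_{k+1}(p, x) = dν_p(x) dμ_k(p)`. -/
def tupleMeasure (ω : V →ₗ[𝕜] V →ₗ[𝕜] 𝕜) : (k : ℕ) → Measure (Fin (k + 1) → ℙ 𝕜 V)
  | 0 => (projMeasure (⊤ : Submodule 𝕜 V)).map fun x _ => x
  | k + 1 => (tupleMeasure ω k).bind fun p =>
      (perpMeasure ω (Set.range p)).map fun x => Fin.snoc (α := fun _ => ℙ 𝕜 V) p x

/-- The measure `μ_k` on the Stiefel variety `X_k`. -/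
def stiefelMeasure (ω : V →ₗ[𝕜] V →ₗ[𝕜] 𝕜) (k : ℕ) : Measure (stiefel ω k) :=
  (tupleMeasure ω k).comap Subtype.val

/-! ### The random chaining and the homotopy -/

/-- One sampling step of the random chaining. Given points `p_0, …, p_k` and the current values
`t_J`, the values `t_J` with `|J| = m` are sampled anew, independently of each other, according
to `ν_{p_J ∪ {t_{J'} | J' ⊊ J}}`; all other values are kept. -/
def chainingStep (ω : V →ₗ[𝕜] V →ₗ[𝕜] 𝕜) {k : ℕ} (p : Fin (k + 1) → ℙ 𝕜 V) (m : ℕ)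
    (t : Finset (Fin (k + 1)) → ℙ 𝕜 V) : Measure (Finset (Fin (k + 1)) → ℙ 𝕜 V) :=
  Measure.pi fun J =>
    if J.card = m then perpMeasure ω (p '' (J : Set (Fin (k + 1))) ∪ t '' {J' | J' ⊂ J})
    else Measure.dirac (t J)

/-- The joint law of the family after the values `t_J` with `|J| ≤ m` have been sampled. In the
beginning `t_∅` has law `μ_0 = λ_V`, and the values `t_J` for `J ≠ ∅` are placeholders, which are
overwritten in step `|J|` and not used before. -/
def chainingLawUpTo (ω : V →ₗ[𝕜] V →ₗ[𝕜] 𝕜) {k : ℕ} (p : Fin (k + 1) → ℙ 𝕜 V) :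
    ℕ → Measure (Finset (Fin (k + 1)) → ℙ 𝕜 V)
  | 0 => Measure.pi fun _ => projMeasure (⊤ : Submodule 𝕜 V)
  | m + 1 => (chainingLawUpTo ω p m).bind (chainingStep ω p (m + 1))

/-- The joint law of the random points `t_J = t_{p_J}`, `J ⊆ {0, …, k}`, of the random chaining,
where `p_J = {p_j | j ∈ J}`, for pairwise distinct points `p_0, …, p_k`: the iterated integral
`(∏_{∅ ≠ J} dν_{p_J ∪ {t_{J'} | J' ⊊ J}}(t_J)) dμ_0(t_∅)`, ordered by cardinality. -/
def chainingLaw (ω : V →ₗ[𝕜] V →ₗ[𝕜] 𝕜) {k : ℕ} (p : Fin (k + 1) → ℙ 𝕜 V) :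
    Measure (Finset (Fin (k + 1)) → ℙ 𝕜 V) :=
  chainingLawUpTo ω p (k + 1)

/-- The value of a function on `X_k` at a tuple of points (zero if the tuple is not in `X_k`). -/
def evalTuple (ω : V →ₗ[𝕜] V →ₗ[𝕜] 𝕜) {k : ℕ} (f : stiefel ω k → ℝ)
    (y : Fin (k + 1) → ℙ 𝕜 V) : ℝ :=
  open Classical in if h : y ∈ stiefel ω k then f ⟨y, h⟩ else 0

/-- The partial homotopy `h_C f(p) = 𝔼[f(t(p, C))]`. -/
def partialHomotopy (ω : V →ₗ[𝕜] V →ₗ[𝕜] 𝕜) {k n : ℕ} (C : DescChain k n)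
    (f : stiefel ω (k + 1) → ℝ) (p : stiefel ω k) : ℝ :=
  ∫ t, evalTuple ω f (C.tuple p.1 t) ∂(chainingLaw ω p.1)

/-- The formula `h^k f = ∑_C sgn(C) h_C f`, the sum being over all descending `k`-chains, of all
lengths `n = 0, …, k + 1`. -/
def homotopyFormula (ω : V →ₗ[𝕜] V →ₗ[𝕜] 𝕜) (k : ℕ) (f : stiefel ω (k + 1) → ℝ)
    (p : stiefel ω k) : ℝ :=
  ∑ n ∈ Finset.range (k + 2), ∑ C : DescChain k n, C.sgn * partialHomotopy ω C f p

/-- The formula `h^{-1} f = 𝔼[f(t_∅)] = ∫ f dμ_0`. -/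
def homotopyNegOne (ω : V →ₗ[𝕜] V →ₗ[𝕜] 𝕜) (f : stiefel ω 0 → ℝ) : ℝ :=
  ∫ x, f x ∂(stiefelMeasure ω 0)

/-- The space `L^∞(X_k, μ_k)` of function classes. -/
abbrev Linf (ω : V →ₗ[𝕜] V →ₗ[𝕜] 𝕜) (k : ℕ) : Type _ := Lp ℝ ∞ (stiefelMeasure ω k)

/-- The class in `L^∞(X_k, μ_k)` of a bounded measurable function on `X_k`. -/
abbrev cls (ω : V →ₗ[𝕜] V →ₗ[𝕜] 𝕜) (k : ℕ) : BddMeas (stiefel ω k) →ₗ[ℝ] Linf ω k :=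
  toLinf (stiefelMeasure ω k)

end

end

end SympStiefel

open SympStiefel

set_option linter.unusedSectionVars false

namespace SympStiefel

/-! ### The acyclic carrier recursion -/

/-! For a tuple p and a family t of points indexed by the subsets of {0, …, k}, let s(p) be the
chain obtained recursively by coning p − s(∂p) off with t_univ, where each face uses the points
indexed by the subsets avoiding the deleted index. Then ∂s(p) = p − s(∂p) for every single t,
without any geometry. Unrolling the recursion gives exactly the signed sum over descending chains
(`DescChain.sum_sgn_mul_tuple`), so h^k f(p) is the mean of f over s(p), and the homotopy identity
is the integral of `coneSum_tupleCoboundary`. Two facts justify the integration: the law of the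
points over a face is a marginal of the law over p (`map_chainingLaw`), and almost surely all
simplices of s(p) lie in X_{k+1} (`ae_tuple_mem_stiefel`), so f may be extended by zero.

In that membership perpendicularity is built into the law, and linear independence is the issue. The
numerical hypothesis gives 2^(k+1) + (k+1) ≤ dim V for k ≤ q. By a dimension count the points t_J
with J ⊊ I are then independent modulo the span of p, for each proper subset I (`ae_not_le_rivals`).
So p_i with i ∉ I is outside the span of the points used to sample t_I, and passing to ω-complements
shows that t_I is not perpendicular to p_i (`ae_not_perp`). This makes the pairing between the p_i
and the t_J triangular along a descending chain. It follows that the nonzero complement from which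
t_{C_m} is drawn meets the span of the later entries of the tuple only in 0
(`eq_zero_of_mem_followers`), and a random point of it avoids that span.

For function classes, the symplectic group acts transitively on X_k by Witt's theorem, and linear
automorphisms map λ_W to a measure with the null sets of λ_{gW}. Hence μ_k and the law of t(p, C)
for μ_k-random p are quasi-invariant. A Fubini argument with Haar measure shows that a
quasi-invariant measure on a transitive space is absolutely continuous with respect to any nonzero
one (`QuasiInvariant.absolutelyContinuous`). So h^k and d^k preserve vanishing almost everywhere,
and exactness follows formally from the homotopy. -/

theorem sum_double_face_eq_zero {n : ℕ} (A : (Fin n → Fin (n + 2)) → ℝ) :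
    ∑ j : Fin (n + 2), ∑ i : Fin (n + 1),
      (-1) ^ (j : ℕ) * ((-1) ^ (i : ℕ) * A (j.succAbove ∘ i.succAbove)) = 0 := by
  rw [← Fintype.sum_prod_type' (f := fun (j : Fin (n + 2)) (i : Fin (n + 1)) =>
      (-1 : ℝ) ^ (j : ℕ) * ((-1) ^ (i : ℕ) * A (j.succAbove ∘ i.succAbove)))]
  -- Deleting entry `j` and then entry `i` of the rest is the same as deleting these two entries in
  -- the other order. The swapped pair of indices has the opposite parity, so the terms cancel in
  -- pairs.
  refine Finset.sum_involution
    (fun x _ => (x.1.succAbove x.2, x.2.predAbove x.1)) ?_ ?_ ?_ ?_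
  · rintro ⟨j, i⟩ -
    have h : (j.succAbove i).succAbove ∘ (i.predAbove j).succAbove
        = j.succAbove ∘ i.succAbove := by
      funext x
      exact Fin.succAbove_succAbove_succAbove_predAbove j i x
    simp only [h]
    rw [← mul_assoc, ← mul_assoc, ← pow_add, ← pow_add,
      Fin.neg_one_pow_succAbove_add_predAbove]
    ring
  · rintro ⟨j, i⟩ - - h
    exact Fin.succAbove_ne j i (congrArg Prod.fst h)
  · simp
  · rintro ⟨j, i⟩ -
    simp [Fin.succAbove_succAbove_predAbove, Fin.predAbove_predAbove_succAbove]

/-- The value of a cochain `F` on the chain `s(p)` defined recursively by coning the cycle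
`p - s(∂p)` off with the point `t_univ`; for the empty tuple `s` is the point `t_∅`. -/
noncomputable def coneSum {P : Type*} : (k : ℕ) → (Fin k → P) → (Finset (Fin k) → P) →
    ((Fin (k + 1) → P) → ℝ) → ℝ
  | 0, _, t, F => F fun _ => t ∅
  | k + 1, p, t, F => F (Fin.cons (t Finset.univ) p) -
      ∑ j : Fin (k + 1), (-1) ^ (j : ℕ) * coneSum k (p ∘ j.succAbove)
        (fun J => t (J.image j.succAbove)) fun y => F (Fin.cons (t Finset.univ) y)

theorem coneSum_sub {P : Type*} (k : ℕ) (p : Fin k → P) (t : Finset (Fin k) → P)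
    (F G : (Fin (k + 1) → P) → ℝ) :
    coneSum k p t (fun y => F y - G y) = coneSum k p t F - coneSum k p t G := by
  induction k with
  | zero => rfl
  | succ k ih =>
    simp only [coneSum, ih, mul_sub, Finset.sum_sub_distrib]
    ring

/-- The coboundary of a cochain on all tuples. -/
noncomputable def tupleCoboundary {P : Type*} {k : ℕ} (φ : (Fin k → P) → ℝ)
    (y : Fin (k + 1) → P) : ℝ :=
  ∑ i : Fin (k + 1), (-1) ^ (i : ℕ) * φ (y ∘ i.succAbove)

/-- Dual to the boundary formula ∂(x * c) = c − x * ∂c for a cone. -/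
theorem tupleCoboundary_cons {P : Type*} {k : ℕ} (φ : (Fin (k + 1) → P) → ℝ) (x : P)
    (y : Fin (k + 1) → P) :
    tupleCoboundary φ (Fin.cons x y) =
      φ y - tupleCoboundary (fun z => φ (Fin.cons x z)) y := by
  have h (i : Fin (k + 1)) : (Fin.cons x y : Fin (k + 2) → P) ∘ i.succ.succAbove =
      Fin.cons x (y ∘ i.succAbove) := by
    funext l
    induction l using Fin.cases <;> simp
  have h0 : (Fin.cons x y : Fin (k + 2) → P) ∘ (0 : Fin (k + 2)).succAbove = y := by
    funext l
    simp
  rw [tupleCoboundary, Fin.sum_univ_succ, tupleCoboundary]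
  simp only [h, h0, Fin.val_zero, Fin.val_succ, pow_succ]
  simp [Finset.sum_neg_distrib, sub_eq_add_neg]

/-- Dual to ∂s(p) = p − s(∂p): by induction p − s(∂p) is a cycle, and the boundary of a cone over a
cycle is that cycle. The points `t` are arbitrary here, so the identity can be integrated over them.
-/
theorem coneSum_tupleCoboundary {P : Type*} (k : ℕ) (p : Fin (k + 1) → P)
    (t : Finset (Fin (k + 1)) → P) (φ : (Fin (k + 1) → P) → ℝ) :
    coneSum (k + 1) p t (tupleCoboundary φ) + ∑ j : Fin (k + 1), (-1) ^ (j : ℕ) *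
      coneSum k (p ∘ j.succAbove) (fun J => t (J.image j.succAbove)) φ = φ p := by
  induction k with
  | zero =>
    simp only [coneSum, tupleCoboundary_cons]
    -- For 1-tuples the remaining terms are values at the empty tuple and cancel: a difference of
    -- two points is a cycle for the augmented boundary.
    have h (x : P) (y z : Fin 1 → P) : tupleCoboundary (fun z => φ (Fin.cons x z)) y =
        tupleCoboundary (fun z => φ (Fin.cons x z)) z := by
      simp only [tupleCoboundary]
      refine Finset.sum_congr rfl fun i _ => ?_
      rw [Subsingleton.elim (y ∘ i.succAbove) (z ∘ i.succAbove)]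
    simp [h _ p fun _ => t ∅]
  | succ k ih =>
    rw [coneSum]
    simp only [tupleCoboundary_cons, coneSum_sub]
    have key (j : Fin (k + 2)) := eq_sub_of_add_eq (ih (p ∘ j.succAbove)
      (fun J => t (J.image j.succAbove)) fun z => φ (Fin.cons (t Finset.univ) z))
    simp only [key]
    -- The second faces contribute the cone over the chain attached to ∂∂p, which is zero.
    have hzero := sum_double_face_eq_zero (n := k) fun f =>
      coneSum k (p ∘ f) (fun J => t (J.image f)) fun z => φ (Fin.cons (t Finset.univ) z)
    simp only [mul_sub, Finset.sum_sub_distrib, Finset.mul_sum, Function.comp_assoc,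
      Finset.image_image]
    rw [hzero, tupleCoboundary]
    ring

theorem tupleCoboundary_tupleCoboundary {P : Type*} {k : ℕ} (φ : (Fin k → P) → ℝ)
    (y : Fin (k + 2) → P) : tupleCoboundary (tupleCoboundary φ) y = 0 := by
  rw [← sum_double_face_eq_zero fun f => φ (y ∘ f)]
  simp only [tupleCoboundary, Finset.mul_sum, Function.comp_assoc]

/-! ### Descending chains and the cone recursion -/

/-- `j.succAbove` is strictly monotone, so it carries the increasing enumeration of a set to that of
its image. The two indices are compared as numbers because they live in different `Fin` types. -/
theorem orderEmbOfFin_image_succAbove {k : ℕ} (j : Fin (k + 1)) {s : Finset (Fin k)}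
    {s' : Finset (Fin (k + 1))} (hs : s' = s.image j.succAbove)
    (a : Fin s'.card) (b : Fin s.card) (hab : (a : ℕ) = b) :
    s'.orderEmbOfFin rfl a = j.succAbove (s.orderEmbOfFin rfl b) := by
  have hc : s'.card = s.card := by
    rw [hs, Finset.card_image_of_injective _ Fin.succAbove_right_injective]
  have hb : b = Fin.cast hc a := Fin.ext hab.symm
  have := Finset.orderEmbOfFin_unique (s := s') rfl
    (f := fun a => j.succAbove (s.orderEmbOfFin rfl (Fin.cast hc a)))
    (fun x => (congrArg (j.succAbove (s.orderEmbOfFin rfl (Fin.cast hc x)) ∈ ·) hs).mpr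
      (Finset.mem_image_of_mem _ (Finset.orderEmbOfFin_mem _ _ _)))
    (fun x y hxy => (Fin.strictMono_succAbove j) ((s.orderEmbOfFin rfl).strictMono
      (by simpa using hxy)))
  rw [hb, ← congrFun this a]

theorem orderEmbOfFin_univ' {k : ℕ} {s : Finset (Fin k)} (hs : s = Finset.univ)
    (a : Fin s.card) (b : Fin k) (hab : (a : ℕ) = b) : s.orderEmbOfFin rfl a = b := by
  have hc : s.card = k := by rw [hs, Finset.card_univ, Fintype.card_fin]
  have hb : b = Fin.cast hc a := Fin.ext hab.symm
  have := Finset.orderEmbOfFin_unique (s := s) rfl (f := Fin.cast hc)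
    (fun x => by simp [hs]) (fun x y hxy => by simpa using hxy)
  rw [hb, ← congrFun this a]

namespace DescChain

theorem zero_eq_univ {k n : ℕ} (C : DescChain k n) : C.1 0 = Finset.univ := by
  have := C.2.2 0
  exact Finset.card_eq_iff_eq_univ _ |>.1 (by simpa using this)

/-- Prolong a descending chain of subsets of `{0, …, k + 1} ∖ {j}` by the full set. -/
def cons {k n : ℕ} (j : Fin (k + 2)) (C : DescChain k n) : DescChain (k + 1) (n + 1) :=
  ⟨Fin.cons Finset.univ fun i => (C.1 i).image j.succAbove, by
    constructor
    · intro a b hab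
      induction a using Fin.cases with
      | zero => simp
      | succ a =>
        induction b using Fin.cases with
        | zero => simp at hab
        | succ b =>
          simp only [Fin.cons_succ]
          exact Finset.image_subset_image (C.2.1 (by simpa using hab))
    · intro i
      induction i using Fin.cases with
      | zero => simp
      | succ i =>
        simp only [Fin.cons_succ, Fin.val_succ]
        rw [Finset.card_image_of_injective _ Fin.succAbove_right_injective]
        have := C.2.2 i
        omega⟩

theorem removedPos_cons_zero {k n : ℕ} (j : Fin (k + 2)) (C : DescChain k n) :
    (cons j C).removedPos 0 = j := by
  classical
  have h0 : (cons j C).1 (0 : Fin (n + 1)).castSucc = Finset.univ := rfl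
  have h1 : (cons j C).1 (0 : Fin (n + 1)).succ = {j}ᶜ := by
    change (C.1 0).image j.succAbove = _
    rw [C.zero_eq_univ]
    ext x
    simp
  rw [removedPos, h0, h1]
  have : (Finset.univ.filter fun a => ∃ b ∈ Finset.univ \ ({j} : Finset (Fin (k + 2)))ᶜ, a < b)
      = Finset.Iio j := by
    ext x
    simp
  rw [this, Fin.card_Iio]

theorem removedPos_cons_succ {k n : ℕ} (j : Fin (k + 2)) (C : DescChain k n) (m : Fin n) :
    (cons j C).removedPos m.succ = C.removedPos m := by
  classical
  have h0 : (cons j C).1 m.succ.castSucc = (C.1 m.castSucc).image j.succAbove := rfl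
  have h1 : (cons j C).1 m.succ.succ = (C.1 m.succ).image j.succAbove := rfl
  rw [removedPos, h0, h1, removedPos,
    ← Finset.card_image_of_injective _ (Fin.succAbove_right_injective (p := j))]
  congr 1
  ext x
  simp only [Finset.mem_filter, Finset.mem_image, Finset.mem_sdiff]
  constructor
  · rintro ⟨⟨a, ha, rfl⟩, b, ⟨⟨b, hb, rfl⟩, hb'⟩, hlt⟩
    refine ⟨a, ⟨ha, b, ⟨hb, fun h => hb' ⟨b, h, rfl⟩⟩, ?_⟩, rfl⟩
    exact (Fin.strictMono_succAbove j).lt_iff_lt.1 hlt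
  · rintro ⟨a, ⟨ha, b, ⟨hb, hb'⟩, hlt⟩, rfl⟩
    refine ⟨⟨a, ha, rfl⟩, j.succAbove b, ⟨⟨b, hb, rfl⟩, ?_⟩, Fin.strictMono_succAbove j hlt⟩
    rintro ⟨c, hc, hcb⟩
    exact hb' (Fin.succAbove_right_injective hcb ▸ hc)

theorem sgn_cons {k n : ℕ} (j : Fin (k + 2)) (C : DescChain k n) :
    (cons j C).sgn = -((-1) ^ (j : ℕ) * C.sgn) := by
  rw [sgn, sgn, Fin.sum_univ_succ, removedPos_cons_zero]
  simp only [removedPos_cons_succ, pow_add, pow_one]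
  ring

theorem tuple_cons {k n : ℕ} (j : Fin (k + 2)) (C : DescChain k n) {P : Type*}
    (p : Fin (k + 2) → P) (t : Finset (Fin (k + 2)) → P) :
    (cons j C).tuple p t = Fin.cons (t Finset.univ)
      (C.tuple (p ∘ j.succAbove) fun J => t (J.image j.succAbove)) := by
  funext x
  induction x using Fin.cases with
  | zero => rfl
  | succ x =>
    rw [Fin.cons_succ]
    by_cases hx : (x : ℕ) ≤ n
    · have hx' : ((x.succ : Fin (k + 3)) : ℕ) ≤ n + 1 := by simpa using hx
      simp only [tuple, dif_pos hx, dif_pos hx']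
      rfl
    · have hx' : ¬ ((x.succ : Fin (k + 3)) : ℕ) ≤ n + 1 := by simpa using hx
      simp only [tuple, dif_neg hx, dif_neg hx', Function.comp]
      congr 1
      apply orderEmbOfFin_image_succAbove
      · rfl
      · simp

/-- A chain of positive length is its first removed element together with a chain of subsets of the
complement of that element. -/
theorem cons_bijective (k n : ℕ) :
    Function.Bijective fun x : Fin (k + 2) × DescChain k n => cons x.1 x.2 := by
  constructor
  · rintro ⟨j, C⟩ ⟨j', C'⟩ h
    have h' : ∀ i, (C.1 i).image j.succAbove = (C'.1 i).image j'.succAbove := fun i =>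
      congrFun (congrArg Subtype.val h) i.succ
    have hj : j = j' := by
      have := h' 0
      rw [C.zero_eq_univ, C'.zero_eq_univ] at this
      by_contra hne
      have hmem : j ∈ Finset.univ.image j'.succAbove := by
        simpa [Fin.exists_succAbove_eq_iff] using hne
      rw [← this] at hmem
      simp at hmem
    subst hj
    refine Prod.ext rfl (Subtype.ext (funext fun i => ?_))
    exact Finset.image_injective Fin.succAbove_right_injective (h' i)
  · intro C
    have hcard : ((C.1 1)ᶜ).card = 1 := by
      have h1 := C.2.2 1
      rw [Finset.card_compl, Fintype.card_fin]
      simp at h1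
      omega
    obtain ⟨j, hj⟩ := Finset.card_eq_one.1 hcard
    have hnot (i : Fin (n + 1)) : j ∉ C.1 i.succ := fun hmem => by
      have h1 : j ∈ C.1 1 := C.2.1 (by rw [Fin.le_def]; simp) hmem
      have : j ∈ (C.1 1)ᶜ := by simp [hj]
      exact (Finset.mem_compl.1 this) h1
    have himg (i : Fin (n + 1)) : ((C.1 i.succ).preimage j.succAbove
        Fin.succAbove_right_injective.injOn).image j.succAbove = C.1 i.succ := by
      ext x
      simp only [Finset.mem_image, Finset.mem_preimage]
      constructor
      · rintro ⟨y, hy, rfl⟩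
        exact hy
      · intro hx
        obtain ⟨y, rfl⟩ := Fin.exists_succAbove_eq (x := x) (y := j)
          (fun h => hnot i (h ▸ hx))
        exact ⟨y, hx, rfl⟩
    refine ⟨⟨j, ⟨fun i => (C.1 i.succ).preimage j.succAbove
      Fin.succAbove_right_injective.injOn, ?_, ?_⟩⟩, ?_⟩
    · intro a b hab x hx
      simp only [Finset.mem_preimage] at hx ⊢
      exact C.2.1 (by simpa using hab) hx
    · intro i
      rw [← Finset.card_image_of_injective _ (Fin.succAbove_right_injective (p := j)), himg]
      have := C.2.2 i.succ
      simp only [Fin.val_succ] at this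
      omega
    · refine Subtype.ext (funext fun i => ?_)
      induction i using Fin.cases with
      | zero => exact C.zero_eq_univ.symm
      | succ i => exact himg i

/-- The chain of length `0`. -/
def single (k : ℕ) : DescChain k 0 :=
  ⟨fun _ => Finset.univ, fun _ _ _ => le_rfl, fun i => by simp⟩

theorem eq_single {k : ℕ} (C : DescChain k 0) : C = single k := by
  refine Subtype.ext (funext fun i => ?_)
  obtain rfl : i = 0 := Fin.fin_one_eq_zero i
  exact C.zero_eq_univ

theorem sum_length_zero {k : ℕ} (F : DescChain k 0 → ℝ) : ∑ C, F C = F (single k) :=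
  Fintype.sum_eq_single _ fun C hC => absurd C.eq_single hC

theorem sgn_single (k : ℕ) : (single k).sgn = 1 := by
  simp [sgn]

theorem tuple_single {k : ℕ} {P : Type*} (p : Fin (k + 1) → P) (t : Finset (Fin (k + 1)) → P) :
    (single k).tuple p t = Fin.cons (t Finset.univ) p := by
  funext x
  induction x using Fin.cases with
  | zero => rfl
  | succ x =>
    rw [Fin.cons_succ, tuple, dif_neg (by simp)]
    congr 1
    exact orderEmbOfFin_univ' rfl _ _ (by simp)

/-- The chain `{0} ⊃ ∅`. -/
def point : DescChain 0 1 :=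
  ⟨![Finset.univ, ∅], by
    intro a b hab
    fin_cases a <;> fin_cases b <;> simp_all, by
    intro i
    fin_cases i <;> simp⟩

theorem sum_point (F : DescChain 0 1 → ℝ) : ∑ C, F C = F point := by
  refine Fintype.sum_eq_single _ fun C hC => absurd ?_ hC
  refine Subtype.ext (funext fun i => ?_)
  induction i using Fin.cases with
  | zero => exact C.zero_eq_univ
  | succ i =>
    rw [Subsingleton.elim i 0]
    have := C.2.2 1
    exact Finset.card_eq_zero.1 (by simpa using this)

theorem sgn_point : point.sgn = -1 := by
  classical
  have : point.removedPos 0 = 0 := by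
    rw [removedPos, Finset.card_eq_zero, Finset.filter_eq_empty_iff]
    rintro x - ⟨b, -, hb⟩
    omega
  simp [sgn, this]

theorem tuple_point {P : Type*} (p : Fin 1 → P) (t : Finset (Fin 1) → P) :
    point.tuple p t = Fin.cons (t Finset.univ) fun _ => t ∅ := by
  funext x
  induction x using Fin.cases with
  | zero => rfl
  | succ x =>
    obtain rfl : x = 0 := Fin.fin_one_eq_zero x
    rfl

/-- The signed sum over all descending chains satisfies the cone recursion. -/
theorem sum_sgn_mul_tuple {P : Type*} (k : ℕ) (p : Fin (k + 1) → P)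
    (t : Finset (Fin (k + 1)) → P) (F : (Fin (k + 2) → P) → ℝ) :
    ∑ n ∈ Finset.range (k + 2), ∑ C : DescChain k n, C.sgn * F (C.tuple p t) =
      coneSum (k + 1) p t F := by
  induction k with
  | zero =>
    -- For `k = 0` the only chains are `{0}` and `{0} ⊃ ∅`.
    rw [Finset.sum_range_succ, Finset.sum_range_one, sum_length_zero, sum_point, sgn_single,
      sgn_point, tuple_single, tuple_point]
    simp only [coneSum]
    simp
    ring
  | succ k ih =>
    rw [Finset.sum_range_succ', sum_length_zero, sgn_single, tuple_single, coneSum]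
    -- Chains of positive length are sorted by the first removed element `j`, which contributes the
    -- factor `-(-1)^j` of the cone recursion.
    have h (n : ℕ) : ∑ C : DescChain (k + 1) (n + 1), C.sgn * F (C.tuple p t) =
        -∑ j : Fin (k + 2), (-1) ^ (j : ℕ) * ∑ C : DescChain k n, C.sgn *
          F (Fin.cons (t Finset.univ) (C.tuple (p ∘ j.succAbove)
            fun J => t (J.image j.succAbove))) := by
      rw [← Function.Bijective.sum_comp (cons_bijective k n), Fintype.sum_prod_type,
        ← Finset.sum_neg_distrib]
      refine Finset.sum_congr rfl fun j _ => ?_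
      rw [Finset.mul_sum, ← Finset.sum_neg_distrib]
      refine Finset.sum_congr rfl fun C _ => ?_
      rw [sgn_cons, tuple_cons]
      ring
    simp only [h]
    rw [Finset.sum_neg_distrib, Finset.sum_comm]
    simp only [← Finset.mul_sum]
    have ih' (j : Fin (k + 2)) := ih (p ∘ j.succAbove) (fun J => t (J.image j.succAbove))
      fun y => F (Fin.cons (t Finset.univ) y)
    simp only [ih']
    ring

end DescChain

end SympStiefel

namespace SympStiefel

/-! ### Topology and Borel structure of projective space -/

section ProjTopology

variable {𝕜 V : Type*} [RCLike 𝕜] [NormedAddCommGroup V] [InnerProductSpace 𝕜 V]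

theorem continuous_projMk : Continuous (Projectivization.mk' 𝕜 : {v : V // v ≠ 0} → ℙ 𝕜 V) :=
  continuous_coinduced_rng

theorem projMk_surjective :
    Function.Surjective (Projectivization.mk' 𝕜 : {v : V // v ≠ 0} → ℙ 𝕜 V) :=
  fun p => ⟨⟨p.rep, p.rep_nonzero⟩, p.mk_rep⟩

variable [FiniteDimensional 𝕜 V]

/-- The compact unit sphere maps continuously onto the projective space. -/
instance : CompactSpace (ℙ 𝕜 V) := by
  have : ProperSpace V := FiniteDimensional.proper_rclike 𝕜 V
  let f : Metric.sphere (0 : V) 1 → ℙ 𝕜 V := fun x =>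
    Projectivization.mk' 𝕜 ⟨x.1, ne_zero_of_mem_unit_sphere x⟩
  have hf : Continuous f := continuous_projMk.comp (by fun_prop)
  have hs : Function.Surjective f := by
    intro p
    have hp : ‖p.rep‖ ≠ 0 := norm_ne_zero_iff.2 p.rep_nonzero
    refine ⟨⟨((‖p.rep‖⁻¹ : ℝ) : 𝕜) • p.rep, ?_⟩, ?_⟩
    · simp [norm_smul, hp]
    · conv_rhs => rw [← p.mk_rep]
      refine (Projectivization.mk_eq_mk_iff' 𝕜 _ _ _ _).2 ⟨((‖p.rep‖⁻¹ : ℝ) : 𝕜), rfl⟩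
  exact hs.compactSpace hf

/-- A point of projective space as an orthogonal projection. -/
noncomputable def projToEnd : ℙ 𝕜 V → V →L[𝕜] V :=
  fun p => p.submodule.starProjection

theorem projToEnd_mk (v : {v : V // v ≠ 0}) : projToEnd (Projectivization.mk' 𝕜 v) =
    ((‖(v : V)‖ : 𝕜) ^ 2)⁻¹ • (InnerProductSpace.rankOne 𝕜 (v : V) (v : V)) := by
  ext w
  have : (Projectivization.mk' 𝕜 v).submodule = 𝕜 ∙ (v : V) := Projectivization.submodule_mk _ _
  simp only [projToEnd, this]
  rw [Submodule.starProjection_singleton]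
  simp [smul_smul, div_eq_inv_mul]

/-- A continuous injection of a compact space into a Hausdorff space is a closed embedding. The
Hausdorff property and second countability are then inherited from the space of operators. -/
theorem isClosedEmbedding_projToEnd :
    Topology.IsClosedEmbedding (projToEnd : ℙ 𝕜 V → V →L[𝕜] V) := by
  refine Continuous.isClosedEmbedding ?_ ?_
  · refine continuous_coinduced_dom.2 ?_
    have : (projToEnd ∘ Projectivization.mk' 𝕜 : {v : V // v ≠ 0} → V →L[𝕜] V) =
      fun v : {v : V // v ≠ 0} => ((‖(v : V)‖ : 𝕜) ^ 2)⁻¹ • (InnerProductSpace.rankOne 𝕜 (v : V) (v : V)) :=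
      funext projToEnd_mk
    rw [this]
    have hnorm : Continuous fun v : {v : V // v ≠ 0} => ((‖(v : V)‖ : 𝕜) ^ 2) :=
      (RCLike.continuous_ofReal.comp (continuous_norm.comp continuous_subtype_val)).pow 2
    refine Continuous.smul (hnorm.inv₀ fun v => ?_) ?_
    · simpa using v.2
    · refine continuous_clm_apply.2 fun y => ?_
      simp only [InnerProductSpace.rankOne_apply]
      fun_prop
  · intro p q h
    apply Projectivization.submodule_injective
    exact Submodule.starProjection_inj.1 h

instance : T2Space (ℙ 𝕜 V) := isClosedEmbedding_projToEnd.isEmbedding.t2Space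

instance : SecondCountableTopology (ℙ 𝕜 V) := by
  have : ProperSpace (V →L[𝕜] V) := FiniteDimensional.proper_rclike 𝕜 _
  exact isClosedEmbedding_projToEnd.isEmbedding.secondCountableTopology

variable {ι : Type*}

/-- The lines spanned by a family of nonzero vectors. -/
def lines (v : ι → {v : V // v ≠ 0}) : ι → ℙ 𝕜 V := fun i => Projectivization.mk' 𝕜 (v i)

theorem continuous_lines :
    Continuous (lines : (ι → {v : V // v ≠ 0}) → ι → ℙ 𝕜 V) :=
  continuous_pi fun i => continuous_projMk.comp (continuous_apply i)

theorem lines_surjective : Function.Surjective (lines : (ι → {v : V // v ≠ 0}) → ι → ℙ 𝕜 V) :=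
  fun p => ⟨fun i => ⟨(p i).rep, (p i).rep_nonzero⟩, funext fun i => (p i).mk_rep⟩

theorem lineSpan_range_lines (v : ι → {v : V // v ≠ 0}) :
    lineSpan (Set.range (lines v : ι → ℙ 𝕜 V)) = Submodule.span 𝕜 (Set.range fun i => (v i : V)) := by
  rw [lineSpan, iSup_range, Submodule.span_range_eq_iSup]
  exact iSup_congr fun i => Projectivization.submodule_mk _ _

variable [MeasurableSpace V] [BorelSpace V]

instance : PolishSpace {v : V // v ≠ 0} :=
  have : ProperSpace V := FiniteDimensional.proper_rclike 𝕜 V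
  isOpen_ne.polishSpace

theorem measurable_lines [Countable ι] :
    Measurable (lines : (ι → {v : V // v ≠ 0}) → ι → ℙ 𝕜 V) :=
  continuous_lines.measurable

/-- A measurable surjection from a Polish space onto a second countable Hausdorff space detects
Borel sets. Measurability on tuples of points can thus be tested on representing vectors, and no
measurable choice of representatives is needed. -/
theorem measurableSet_lines_preimage [Countable ι] {s : Set (ι → ℙ 𝕜 V)} :
    MeasurableSet (lines (𝕜 := 𝕜) (V := V) ⁻¹' s) ↔ MeasurableSet s :=
  measurable_lines.measurableSet_preimage_iff_of_surjective lines_surjective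

theorem measurable_comp_lines [Countable ι] {β : Type*} [MeasurableSpace β]
    {g : (ι → ℙ 𝕜 V) → β} : Measurable (g ∘ lines (𝕜 := 𝕜) (V := V)) ↔ Measurable g :=
  measurable_lines.measurable_comp_iff_of_surjective lines_surjective

end ProjTopology

end SympStiefel

namespace SympStiefel

/-! ### The measures `λ_W` -/

section ProjMeasure

variable {𝕜 V : Type*} [RCLike 𝕜] [NormedAddCommGroup V] [InnerProductSpace 𝕜 V]

theorem submodule_mk_le {v : V} (hv : v ≠ 0) {U : Submodule 𝕜 V} :
    (Projectivization.mk 𝕜 v hv).submodule ≤ U ↔ v ∈ U := by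
  rw [Projectivization.submodule_mk, Submodule.span_singleton_le_iff_mem]

theorem submodule_le_iff {x : ℙ 𝕜 V} {U : Submodule 𝕜 V} : x.submodule ≤ U ↔ x.rep ∈ U := by
  rw [Projectivization.submodule_eq, Submodule.span_singleton_le_iff_mem]

variable [FiniteDimensional 𝕜 V]

theorem isClosed_setOf_submodule_le (U : Submodule 𝕜 V) : IsClosed {x : ℙ 𝕜 V | x.submodule ≤ U} := by
  refine isClosed_coinduced.2 ?_
  have : Projectivization.mk' 𝕜 ⁻¹' {x : ℙ 𝕜 V | x.submodule ≤ U} =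
      {v : {v : V // v ≠ 0} | (v : V) ∈ U} := by
    ext v
    exact submodule_mk_le v.2
  rw [this]
  exact U.closed_of_finiteDimensional.preimage continuous_subtype_val

variable [MeasurableSpace V] [BorelSpace V]

/-- The cone of nonzero vectors over a set of points of projective space. -/
def coneOver (B : Set (ℙ 𝕜 V)) : Set V := {v | ∃ h : v ≠ 0, Projectivization.mk 𝕜 v h ∈ B}

theorem measurableSet_coneOver {B : Set (ℙ 𝕜 V)} (hB : MeasurableSet B) :
    MeasurableSet (coneOver B) := by
  have : coneOver B = Subtype.val '' (Projectivization.mk' 𝕜 ⁻¹' B : Set {v : V // v ≠ 0}) := by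
    ext v
    constructor
    · rintro ⟨h, hv⟩
      exact ⟨⟨v, h⟩, hv, rfl⟩
    · rintro ⟨w, hw, rfl⟩
      exact ⟨w.2, hw⟩
  rw [this]
  exact MeasurableSet.subtype_image (measurableSet_singleton _).compl
    (continuous_projMk.measurable hB)

theorem smul_mem_coneOver {B : Set (ℙ 𝕜 V)} {c : 𝕜} (hc : c ≠ 0) {v : V} (hv : v ∈ coneOver B) :
    c • v ∈ coneOver B := by
  obtain ⟨h, hv⟩ := hv
  refine ⟨smul_ne_zero hc h, ?_⟩
  convert hv using 1
  exact (Projectivization.mk_eq_mk_iff' 𝕜 _ _ _ _).2 ⟨c, rfl⟩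

theorem projMeasure_apply (W : Submodule 𝕜 V) {B : Set (ℙ 𝕜 V)} (hB : MeasurableSet B) :
    projMeasure W B =
      Measure.addHaarMeasure (unitBall W) {w : W | ‖w‖ ≤ 1 ∧ (w : V) ∈ coneOver B} := by
  have hm : Measurable fun w : {w : W // (w : V) ≠ 0} => Projectivization.mk 𝕜 (w.1 : V) w.2 := by
    have : Continuous fun w : {w : W // (w : V) ≠ 0} =>
        Projectivization.mk' 𝕜 (⟨(w.1 : V), w.2⟩ : {v : V // v ≠ 0}) :=
      continuous_projMk.comp (by fun_prop)
    exact this.measurable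
  have hne : MeasurableSet {w : W | (w : V) ≠ 0} :=
    measurable_subtype_coe (measurableSet_singleton (0 : V)).compl
  have hemb : MeasurableEmbedding (Subtype.val : {w : W // (w : V) ≠ 0} → W) :=
    MeasurableEmbedding.subtype_coe hne
  rw [projMeasure, Measure.map_apply hm hB, hemb.comap_apply,
    Measure.restrict_apply (hemb.measurableSet_image.2 (hm hB))]
  congr 1
  ext w
  simp only [Set.mem_inter_iff, Set.mem_image, Set.mem_preimage, Set.mem_ofPred_eq, coneOver]
  constructor
  · rintro ⟨⟨w, hw, rfl⟩, hb⟩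
    exact ⟨mem_closedBall_zero_iff.1 hb, w.2, hw⟩
  · rintro ⟨hb, h, hw⟩
    exact ⟨⟨⟨w, h⟩, hw, rfl⟩, mem_closedBall_zero_iff.2 hb⟩

/-- A cone is invariant under scaling and `W` is a countable union of dilates of the unit ball, so
the cone is null once its part in the ball is. All Haar measures share their null sets, hence `μ` is
arbitrary. -/
theorem ae_projMeasure_iff (W : Submodule 𝕜 V) (μ : Measure W) [μ.IsAddHaarMeasure]
    {B : Set (ℙ 𝕜 V)} (hB : MeasurableSet B) :
    (∀ᵐ x ∂projMeasure W, x ∉ B) ↔ ∀ᵐ w : W ∂μ, (w : V) ∉ coneOver B := by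
  have : ProperSpace W := FiniteDimensional.proper_rclike 𝕜 W
  have hms : MeasurableSet {w : W | ‖w‖ ≤ 1 ∧ (w : V) ∈ coneOver B} :=
    (measurableSet_le measurable_norm measurable_const).inter
      (measurable_subtype_coe (measurableSet_coneOver hB))
  have h1 : (∀ᵐ x ∂projMeasure W, x ∉ B) ↔ ∀ᵐ w : W ∂μ, ¬ (‖w‖ ≤ 1 ∧ (w : V) ∈ coneOver B) := by
    have h2 : (∀ᵐ x ∂projMeasure W, x ∉ B) ↔ projMeasure W B = 0 := by
      rw [ae_iff]
      simp
    rw [h2, projMeasure_apply W hB]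
    have h3 : (∀ᵐ w : W ∂μ, ¬ (‖w‖ ≤ 1 ∧ (w : V) ∈ coneOver B)) ↔
        μ {w : W | ‖w‖ ≤ 1 ∧ (w : V) ∈ coneOver B} = 0 := by
      rw [ae_iff]
      simp only [not_not]
    rw [h3]
    exact ⟨fun h => (Measure.absolutelyContinuous_isAddHaarMeasure μ _) h,
      fun h => (Measure.absolutelyContinuous_isAddHaarMeasure _ μ) h⟩
  rw [h1]
  constructor
  · intro h
    have hn (n : ℕ) : ∀ᵐ w : W ∂μ, ¬ (‖((n : 𝕜) + 1)⁻¹ • w‖ ≤ 1 ∧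
        ((((n : 𝕜) + 1)⁻¹ • w : W) : V) ∈ coneOver B) := by
      have hne : ((n : 𝕜) + 1)⁻¹ ≠ 0 := inv_ne_zero (Nat.cast_add_one_ne_zero n)
      refine (ae_comp_linearMap_mem_iff (((n : 𝕜) + 1)⁻¹ • (LinearMap.id : W →ₗ[𝕜] W)) μ μ
        ?_ hms.compl).2 h
      intro w
      refine ⟨((n : 𝕜) + 1) • w, ?_⟩
      rw [LinearMap.smul_apply, LinearMap.id_apply, smul_smul,
        inv_mul_cancel₀ (Nat.cast_add_one_ne_zero n), one_smul]
    filter_upwards [ae_all_iff.2 hn] with w hw hwB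
    obtain ⟨n, hn⟩ := exists_nat_ge ‖w‖
    refine hw n ⟨?_, smul_mem_coneOver (inv_ne_zero (Nat.cast_add_one_ne_zero n)) hwB⟩
    have hc : ‖((n : 𝕜) + 1)‖ = n + 1 := by
      rw [← Nat.cast_add_one, RCLike.norm_natCast]
      push_cast
      rfl
    rw [norm_smul, norm_inv, hc, inv_mul_le_iff₀ (by positivity)]
    linarith
  · intro h
    filter_upwards [h] with w hw hw'
    exact hw hw'.2

theorem ae_projMeasure_le (W : Submodule 𝕜 V) : ∀ᵐ x ∂projMeasure W, x.submodule ≤ W := by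
  have : ProperSpace W := FiniteDimensional.proper_rclike 𝕜 W
  have h := (ae_projMeasure_iff W (Measure.addHaarMeasure (unitBall W))
    (isClosed_setOf_submodule_le W).measurableSet.compl).2 (by
      refine Filter.Eventually.of_forall fun w => ?_
      rintro ⟨h, hw⟩
      exact hw ((submodule_mk_le h).2 w.2))
  filter_upwards [h] with x hx
  simpa using hx

/-- A proper subspace lies in the kernel of a nonzero functional, and the preimage of the null set
{0} under a surjective linear map is null. -/
theorem ae_notMem_submodule {E : Type*} [NormedAddCommGroup E] [NormedSpace 𝕜 E]
    [FiniteDimensional 𝕜 E] [MeasurableSpace E] [BorelSpace E] (μ : Measure E)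
    [μ.IsAddHaarMeasure] {U : Submodule 𝕜 E} (hU : U ≠ ⊤) : ∀ᵐ w ∂μ, w ∉ U := by
  have : ProperSpace E := FiniteDimensional.proper_rclike 𝕜 E
  obtain ⟨f, hf, hUf⟩ := U.exists_le_ker_of_lt_top (lt_top_iff_ne_top.2 hU)
  have hsurj : Function.Surjective f := LinearMap.surjective hf
  have := (ae_comp_linearMap_mem_iff f μ (Measure.addHaar : Measure 𝕜) hsurj
    (measurableSet_singleton 0).compl).2 (by
      rw [ae_iff]
      simp)
  filter_upwards [this] with w hw hwU
  exact hw (hUf hwU)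

/-- U ∩ W is a proper subspace of W, hence null. The general position statements below all reduce to
this one by dimension counts and linear algebra. -/
theorem ae_projMeasure_not_le {W U : Submodule 𝕜 V} (h : ¬ W ≤ U) :
    ∀ᵐ x ∂projMeasure W, ¬ x.submodule ≤ U := by
  have : ProperSpace W := FiniteDimensional.proper_rclike 𝕜 W
  refine (ae_projMeasure_iff W (Measure.addHaarMeasure (unitBall W))
    (isClosed_setOf_submodule_le U).measurableSet).2 ?_
  have hU : U.comap W.subtype ≠ ⊤ := fun htop => h (Submodule.comap_subtype_eq_top.1 htop)
  filter_upwards [ae_notMem_submodule (Measure.addHaarMeasure (unitBall W)) hU] with w hw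
  rintro ⟨hne, hle⟩
  exact hw ((submodule_mk_le hne).1 hle)

theorem isProbabilityMeasure_projMeasure {W : Submodule 𝕜 V} (h : W ≠ ⊥) :
    IsProbabilityMeasure (projMeasure W) := by
  have : ProperSpace W := FiniteDimensional.proper_rclike 𝕜 W
  refine ⟨?_⟩
  rw [projMeasure_apply W MeasurableSet.univ,
    ← Measure.addHaarMeasure_self (K₀ := unitBall W)]
  refine measure_congr ?_
  have hW : (⊥ : Submodule 𝕜 W) ≠ ⊤ := fun hbt => h <| by
    have := congrArg (Submodule.map W.subtype) hbt
    simpa using this.symm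
  filter_upwards [ae_notMem_submodule (Measure.addHaarMeasure (unitBall W)) hW] with w hw
  have hw0 : (w : V) ≠ 0 := by simpa using hw
  refine propext ⟨fun h => ?_, fun h => ?_⟩
  · have : ‖w‖ ≤ 1 := h.1
    exact mem_closedBall_zero_iff.2 this
  · have h' : ‖w‖ ≤ 1 := mem_closedBall_zero_iff.1 h
    exact ⟨h', hw0, trivial⟩

/-- A linear automorphism maps `λ_W` to a measure equivalent to `λ_{g W}`. -/
theorem map_projMeasure_absolutelyContinuous (g : V ≃ₗ[𝕜] V) (W : Submodule 𝕜 V)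
    {B : Set (ℙ 𝕜 V)} (hB : MeasurableSet B)
    (hgB : MeasurableSet (Projectivization.map g.toLinearMap g.injective ⁻¹' B))
    (h : ∀ᵐ x ∂projMeasure (W.map g.toLinearMap), x ∉ B) :
    ∀ᵐ x ∂projMeasure W, Projectivization.map g.toLinearMap g.injective x ∉ B := by
  have : ProperSpace W := FiniteDimensional.proper_rclike 𝕜 W
  have : ProperSpace (W.map g.toLinearMap) := FiniteDimensional.proper_rclike 𝕜 _
  refine (ae_projMeasure_iff W (Measure.addHaarMeasure (unitBall W)) hgB).2 ?_
  have h' := (ae_projMeasure_iff _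
    (Measure.addHaarMeasure (unitBall (W.map g.toLinearMap))) hB).1 h
  have := (ae_comp_linearMap_mem_iff (g.submoduleMap W).toLinearMap
    (Measure.addHaarMeasure (unitBall W))
    (Measure.addHaarMeasure (unitBall (W.map g.toLinearMap)))
    (g.submoduleMap W).surjective
    (s := {w : W.map g.toLinearMap | (w : V) ∉ coneOver B})
    (measurable_subtype_coe (measurableSet_coneOver hB)).compl).2 h'
  filter_upwards [this] with w hw
  rintro ⟨hne, hmem⟩
  exact hw ⟨(map_ne_zero_iff g g.injective).2 hne, hmem⟩

/-! ### Measurable dependence on the points -/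

/-- The closed unit ball of the standard Euclidean space. -/
noncomputable def stdBall (𝕜 I : Type*) [RCLike 𝕜] [Fintype I] :
    TopologicalSpace.PositiveCompacts (EuclideanSpace 𝕜 I) :=
  have : ProperSpace (EuclideanSpace 𝕜 I) := FiniteDimensional.proper_rclike 𝕜 _
  { carrier := Metric.closedBall 0 1
    isCompact' := isCompact_closedBall 0 1
    interior_nonempty' :=
      ⟨0, Metric.ball_subset_interior_closedBall (Metric.mem_ball_self one_pos)⟩ }

/-- An orthonormal basis identifies the unit ball of `W` isometrically with the standard one. The
reference measure on the right no longer depends on `W`, which enters through the vectors `b i`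
only. -/
theorem projMeasure_apply_of_orthonormal {I : Type*} [Fintype I] {b : I → V}
    (hb : Orthonormal 𝕜 b) {W : Submodule 𝕜 V} (hW : W = Submodule.span 𝕜 (Set.range b))
    {B : Set (ℙ 𝕜 V)} (hB : MeasurableSet B) :
    projMeasure W B = Measure.addHaarMeasure (stdBall 𝕜 I)
      {x | ‖x‖ ≤ 1 ∧ ∑ i, x i • b i ∈ coneOver B} := by
  classical
  subst hW
  have : ProperSpace (EuclideanSpace 𝕜 I) := FiniteDimensional.proper_rclike 𝕜 _
  have : ProperSpace (Submodule.span 𝕜 (Set.range b)) := FiniteDimensional.proper_rclike 𝕜 _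
  let b' : I → Submodule.span 𝕜 (Set.range b) := fun i =>
    ⟨b i, Submodule.subset_span ⟨i, rfl⟩⟩
  have hb' : Orthonormal 𝕜 b' := by
    rw [orthonormal_iff_ite] at hb ⊢
    exact hb
  let B' : OrthonormalBasis I 𝕜 (Submodule.span 𝕜 (Set.range b)) := OrthonormalBasis.mk hb' (by
    rintro ⟨x, hx⟩ -
    have hmap : (Submodule.span 𝕜 (Set.range b')).map (Submodule.subtype _) =
        Submodule.span 𝕜 (Set.range b) := by
      rw [Submodule.map_span, ← Set.range_comp]
      rfl
    rw [← hmap] at hx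
    obtain ⟨y, hy, hyx⟩ := hx
    have hyx' : y = ⟨x, hx⟩ := Subtype.ext hyx
    exact hyx' ▸ hy)
  let e := B'.repr.symm
  have hee : ((Measure.addHaarMeasure (stdBall 𝕜 I)).map e) =
      Measure.addHaarMeasure (unitBall (Submodule.span 𝕜 (Set.range b))) := by
    have : ((Measure.addHaarMeasure (stdBall 𝕜 I)).map e).IsAddHaarMeasure :=
      e.toContinuousLinearEquiv.isAddHaarMeasure_map _
    rw [Measure.addHaarMeasure_unique ((Measure.addHaarMeasure (stdBall 𝕜 I)).map e)
      (unitBall (Submodule.span 𝕜 (Set.range b)))]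
    have h1 : ((Measure.addHaarMeasure (stdBall 𝕜 I)).map e)
        (unitBall (Submodule.span 𝕜 (Set.range b))) = 1 := by
      rw [Measure.map_apply e.continuous.measurable
        (unitBall _).isCompact.measurableSet, ← Measure.addHaarMeasure_self (K₀ := stdBall 𝕜 I)]
      congr 1
      ext x
      simp only [unitBall, stdBall, Set.mem_preimage]
      change e x ∈ Metric.closedBall 0 1 ↔ x ∈ Metric.closedBall 0 1
      rw [mem_closedBall_zero_iff, mem_closedBall_zero_iff, e.norm_map]
    rw [h1, one_smul]
  rw [projMeasure_apply _ hB, ← hee, Measure.map_apply e.continuous.measurable]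
  · congr 1
    ext x
    have hx : ((e x : Submodule.span 𝕜 (Set.range b)) : V) = ∑ i, x i • b i := by
      have := B'.sum_repr_symm x
      rw [show e x = _ from this.symm]
      simp [B', b']
    simp only [Set.mem_preimage, Set.mem_ofPred_eq, e.norm_map, hx]
  · exact (measurableSet_le measurable_norm measurable_const).inter
      (measurable_subtype_coe (measurableSet_coneOver hB))

theorem measurable_gramSchmidt {ι : Type*} [LinearOrder ι] [LocallyFiniteOrderBot ι]
    [WellFoundedLT ι] [Finite ι] (n : ι) :
    Measurable fun f : ι → V => InnerProductSpace.gramSchmidt 𝕜 f n := by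
  have : ProperSpace V := FiniteDimensional.proper_rclike 𝕜 V
  induction n using WellFoundedLT.induction with
  | _ n ih =>
    simp only [InnerProductSpace.gramSchmidt_def 𝕜 _ n, Submodule.starProjection_singleton]
    refine (measurable_pi_apply n).sub (Finset.measurable_fun_sum _ fun i hi => ?_)
    have := ih i (Finset.mem_Iio.1 hi)
    exact Measurable.smul (Measurable.div (this.inner (measurable_pi_apply n))
      (RCLike.measurable_ofReal.comp (this.norm.pow_const 2))) this

theorem measurable_gramSchmidtNormed {ι : Type*} [LinearOrder ι] [LocallyFiniteOrderBot ι]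
    [WellFoundedLT ι] [Finite ι] (n : ι) :
    Measurable fun f : ι → V => InnerProductSpace.gramSchmidtNormed 𝕜 f n := by
  have : ProperSpace V := FiniteDimensional.proper_rclike 𝕜 V
  have := measurable_gramSchmidt (𝕜 := 𝕜) (V := V) n
  exact Measurable.smul (RCLike.measurable_ofReal.comp this.norm).inv this

/-- The vector representing the functional `ω x` with respect to the inner product. -/
noncomputable def formDual (ω : V →ₗ[𝕜] V →ₗ[𝕜] 𝕜) (x : V) : V :=
  have : CompleteSpace V := FiniteDimensional.complete 𝕜 V
  (InnerProductSpace.toDual 𝕜 V).symm (LinearMap.toContinuousLinearMap (ω x))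

theorem inner_formDual (ω : V →ₗ[𝕜] V →ₗ[𝕜] 𝕜) (x y : V) :
    inner 𝕜 (formDual ω x) y = ω x y := by
  have : CompleteSpace V := FiniteDimensional.complete 𝕜 V
  simp [formDual, InnerProductSpace.toDual_symm_apply]

theorem continuous_formDual (ω : V →ₗ[𝕜] V →ₗ[𝕜] 𝕜) : Continuous (formDual ω) := by
  have : CompleteSpace V := FiniteDimensional.complete 𝕜 V
  exact (InnerProductSpace.toDual 𝕜 V).symm.continuous.comp
    (LinearMap.continuous_of_finiteDimensional
      ((LinearMap.toContinuousLinearMap : (V →ₗ[𝕜] 𝕜) ≃ₗ[𝕜] V →L[𝕜] 𝕜).toLinearMap ∘ₗ ω))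

/-- A family of vectors whose Gram-Schmidt orthonormalization contains an orthonormal basis
of the `ω`-complement of the span of the `v i`. -/
noncomputable def perpFrame (ω : V →ₗ[𝕜] V →ₗ[𝕜] 𝕜) {n : ℕ} (v : Fin n → V) :
    Fin (n + finrank 𝕜 V) → V :=
  InnerProductSpace.gramSchmidtNormed 𝕜
    (Fin.append (fun i => formDual ω (v i)) (stdOrthonormalBasis 𝕜 V))

theorem measurable_perpFrame (ω : V →ₗ[𝕜] V →ₗ[𝕜] 𝕜) {n : ℕ} (i : Fin (n + finrank 𝕜 V)) :
    Measurable fun v : Fin n → V => perpFrame ω v i := by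
  refine (measurable_gramSchmidtNormed i).comp (measurable_pi_lambda _ fun j => ?_)
  induction j using Fin.addCases with
  | left j =>
    simp only [Fin.append_left]
    exact (continuous_formDual ω).measurable.comp (measurable_pi_apply j)
  | right j =>
    simp only [Fin.append_right]
    exact measurable_const

theorem gramSchmidtNormed_mem_span {ι : Type*} [LinearOrder ι] [LocallyFiniteOrderBot ι]
    [WellFoundedLT ι] (f : ι → V) (n : ι) :
    InnerProductSpace.gramSchmidtNormed 𝕜 f n ∈ Submodule.span 𝕜 (f '' Set.Iic n) :=
  Submodule.smul_mem _ _ (InnerProductSpace.gramSchmidt_mem_span 𝕜 f le_rfl)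

/-- The ω-complement is the orthogonal complement of the vectors `formDual ω (v j)`. Gram-Schmidt
makes the second block of the frame orthogonal to them, and the whole frame spans `V` because a
basis was appended. -/
theorem orthogonalBilin_eq_span_perpFrame (ω : V →ₗ[𝕜] V →ₗ[𝕜] 𝕜) {n : ℕ} (v : Fin n → V)
    (I : Set (Fin (finrank 𝕜 V))) (hI : ∀ i, i ∈ I ↔ perpFrame ω v (Fin.natAdd n i) ≠ 0) :
    (Submodule.span 𝕜 (Set.range v)).orthogonalBilin ω =
      Submodule.span 𝕜 (Set.range fun i : I => perpFrame ω v (Fin.natAdd n i)) := by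
  set w : Fin (n + finrank 𝕜 V) → V :=
    Fin.append (fun i => formDual ω (v i)) (stdOrthonormalBasis 𝕜 V) with hw
  have hwl (j : Fin n) : w (Fin.castAdd _ j) = formDual ω (v j) := Fin.append_left _ _ j
  have hmem (y : V) : y ∈ (Submodule.span 𝕜 (Set.range v)).orthogonalBilin ω ↔
      ∀ j, inner 𝕜 (formDual ω (v j)) y = 0 := by
    simp only [inner_formDual]
    constructor
    · intro h j
      exact h _ (Submodule.subset_span ⟨j, rfl⟩)
    · intro h x hx
      have : Submodule.span 𝕜 (Set.range v) ≤ LinearMap.ker (ω.flip y) := by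
        rw [Submodule.span_le]
        rintro _ ⟨j, rfl⟩
        exact h j
      exact this hx
  have hright (i : Fin (finrank 𝕜 V)) : perpFrame ω v (Fin.natAdd n i) ∈
      (Submodule.span 𝕜 (Set.range v)).orthogonalBilin ω := by
    refine (hmem _).2 fun j => ?_
    have hlt : Fin.castAdd (finrank 𝕜 V) j < Fin.natAdd n i := by
      rw [Fin.lt_def, Fin.val_castAdd, Fin.val_natAdd]
      omega
    have := InnerProductSpace.gramSchmidt_inv_triangular 𝕜 w hlt
    rw [inner_eq_zero_symm, ← hwl]
    rw [perpFrame, InnerProductSpace.gramSchmidtNormed, inner_smul_left, this, mul_zero]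
  apply le_antisymm
  · intro y hy
    have htop : Submodule.span 𝕜 (Set.range (perpFrame ω v)) = ⊤ := by
      rw [perpFrame, InnerProductSpace.span_gramSchmidtNormed_range,
        InnerProductSpace.span_gramSchmidt, eq_top_iff,
        ← (stdOrthonormalBasis 𝕜 V).toBasis.span_eq, OrthonormalBasis.coe_toBasis]
      refine Submodule.span_mono ?_
      rintro _ ⟨i, rfl⟩
      exact ⟨Fin.natAdd n i, Fin.append_right _ _ i⟩
    have hsplit : Set.range (perpFrame ω v) =
        Set.range (fun j => perpFrame ω v (Fin.castAdd _ j)) ∪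
          Set.range (fun i => perpFrame ω v (Fin.natAdd n i)) := by
      ext x
      constructor
      · rintro ⟨j, rfl⟩
        induction j using Fin.addCases with
        | left j => exact Or.inl ⟨j, rfl⟩
        | right j => exact Or.inr ⟨j, rfl⟩
      · rintro (⟨j, rfl⟩ | ⟨j, rfl⟩) <;> exact ⟨_, rfl⟩
    have hy' : y ∈ Submodule.span 𝕜 (Set.range (perpFrame ω v)) := htop ▸ Submodule.mem_top
    rw [hsplit, Submodule.span_union, Submodule.mem_sup] at hy'
    obtain ⟨y1, h1, y2, h2, rfl⟩ := hy'
    have h2' : y2 ∈ (Submodule.span 𝕜 (Set.range v)).orthogonalBilin ω := by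
      refine (Submodule.span_le.2 ?_) h2
      rintro _ ⟨i, rfl⟩
      exact hright i
    have h1' : y1 ∈ (Submodule.span 𝕜 (Set.range v)).orthogonalBilin ω := by
      simpa using Submodule.sub_mem _ hy h2'
    have h1'' : y1 ∈ Submodule.span 𝕜 (Set.range fun j => formDual ω (v j)) := by
      refine (Submodule.span_le.2 ?_) h1
      rintro _ ⟨j, rfl⟩
      refine Submodule.span_mono ?_ (gramSchmidtNormed_mem_span w (Fin.castAdd _ j))
      rintro _ ⟨l, hl, rfl⟩
      have hln : (l : ℕ) < n := lt_of_le_of_lt (show (l : ℕ) ≤ j from hl) j.2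
      exact ⟨⟨l, hln⟩, (hwl ⟨l, hln⟩).symm⟩
    -- `y1` lies in the span of the dual vectors and is orthogonal to it.
    have hzero : y1 = 0 := by
      have hle : Submodule.span 𝕜 (Set.range fun j => formDual ω (v j)) ≤ (𝕜 ∙ y1)ᗮ := by
        rw [Submodule.span_le]
        rintro _ ⟨j, rfl⟩
        rw [SetLike.mem_coe, Submodule.mem_orthogonal_singleton_iff_inner_right,
          inner_eq_zero_symm]
        exact (hmem y1).1 h1' j
      have := hle h1''
      rw [Submodule.mem_orthogonal_singleton_iff_inner_right] at this
      exact inner_self_eq_zero.1 this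
    rw [hzero, zero_add]
    refine (Submodule.span_le.2 ?_) h2
    rintro _ ⟨i, rfl⟩
    by_cases hi : i ∈ I
    · exact Submodule.subset_span ⟨⟨i, hi⟩, rfl⟩
    · have : perpFrame ω v (Fin.natAdd n i) = 0 := by
        by_contra h
        exact hi ((hI i).2 h)
      simp [this]
  · rw [Submodule.span_le]
    rintro _ ⟨i, rfl⟩
    exact hright i

theorem orthonormal_perpFrame (ω : V →ₗ[𝕜] V →ₗ[𝕜] 𝕜) {n : ℕ} (v : Fin n → V)
    (I : Set (Fin (finrank 𝕜 V))) (hI : ∀ i, i ∈ I ↔ perpFrame ω v (Fin.natAdd n i) ≠ 0) :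
    Orthonormal 𝕜 fun i : I => perpFrame ω v (Fin.natAdd n i) :=
  (InnerProductSpace.gramSchmidtNormed_orthonormal' (𝕜 := 𝕜)
    (Fin.append (fun i => formDual ω (v i)) (stdOrthonormalBasis 𝕜 V))).comp
    (fun i : I => ⟨Fin.natAdd n i, (hI i).1 i.2⟩) fun i j hij => by
      have := Fin.natAdd_injective _ n (congrArg Subtype.val hij)
      exact Subtype.ext this

/-- The dimension of the complement jumps with `p`, so the parameters are cut into finitely many
measurable strata by the set `I` of nonvanishing Gram-Schmidt vectors. On a stratum these form an
orthonormal basis depending measurably on `p`, and the mass of `B` is the measure of a section of a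
measurable set in a product. -/
theorem measurable_perpMeasure_fin (ω : V →ₗ[𝕜] V →ₗ[𝕜] 𝕜) (n : ℕ) :
    Measurable fun p : Fin n → ℙ 𝕜 V => perpMeasure ω (Set.range p) := by
  classical
  rw [← measurable_comp_lines]
  refine Measure.measurable_of_measurable_coe _ fun B hB => ?_
  let S (I : Set (Fin (finrank 𝕜 V))) : Set (Fin n → {v : V // v ≠ 0}) :=
    {v | ∀ i, i ∈ I ↔ perpFrame ω (fun j => (v j : V)) (Fin.natAdd n i) ≠ 0}
  let F (I : Set (Fin (finrank 𝕜 V))) (v : Fin n → {v : V // v ≠ 0}) : ℝ≥0∞ :=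
    Measure.addHaarMeasure (stdBall 𝕜 I) {x : EuclideanSpace 𝕜 I | ‖x‖ ≤ 1 ∧
      ∑ i : I, x i • perpFrame ω (fun j => (v j : V)) (Fin.natAdd n i) ∈ coneOver B}
  have hfr (i : Fin (n + finrank 𝕜 V)) : Measurable fun v : Fin n → {v : V // v ≠ 0} =>
      perpFrame ω (fun j => (v j : V)) i :=
    (measurable_perpFrame ω i).comp
      (measurable_pi_lambda _ fun j => measurable_subtype_coe.comp (measurable_pi_apply j))
  have hS (I : Set (Fin (finrank 𝕜 V))) : MeasurableSet (S I) := by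
    have : S I = ⋂ i, {v | i ∈ I ↔ perpFrame ω (fun j => (v j : V)) (Fin.natAdd n i) ≠ 0} := by
      ext v
      simp [S]
    rw [this]
    refine MeasurableSet.iInter fun i => ?_
    have h0 : MeasurableSet {v : Fin n → {v : V // v ≠ 0} |
        perpFrame ω (fun j => (v j : V)) (Fin.natAdd n i) ≠ 0} :=
      hfr (Fin.natAdd n i) (measurableSet_singleton 0).compl
    by_cases hi : i ∈ I
    · simpa only [hi, true_iff] using h0
    · simp only [hi, false_iff]
      exact h0.compl
  have hF (I : Set (Fin (finrank 𝕜 V))) : Measurable (F I) := by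
    have : ProperSpace (EuclideanSpace 𝕜 I) := FiniteDimensional.proper_rclike 𝕜 _
    refine measurable_measure_prodMk_left (s := {y : (Fin n → {v : V // v ≠ 0}) ×
      EuclideanSpace 𝕜 I | ‖y.2‖ ≤ 1 ∧ ∑ i : I, y.2 i •
        perpFrame ω (fun j => (y.1 j : V)) (Fin.natAdd n i) ∈ coneOver B}) ?_
    refine MeasurableSet.inter (measurableSet_le measurable_snd.norm measurable_const) ?_
    have hsum : Measurable fun y : (Fin n → {v : V // v ≠ 0}) × EuclideanSpace 𝕜 I =>
        ∑ i : I, y.2 i • perpFrame ω (fun j => (y.1 j : V)) (Fin.natAdd n i) := by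
      have : ProperSpace V := FiniteDimensional.proper_rclike 𝕜 V
      refine Finset.measurable_fun_sum _ fun i _ => Measurable.smul ?_ ?_
      · exact (EuclideanSpace.proj i : EuclideanSpace 𝕜 I →L[𝕜] 𝕜).measurable.comp measurable_snd
      · exact (hfr _).comp measurable_fst
    exact hsum (measurableSet_coneOver hB)
  have heq : (fun v => ((fun p : Fin n → ℙ 𝕜 V => perpMeasure ω (Set.range p)) ∘ lines) v B) =
      fun v => ∑ I : Set (Fin (finrank 𝕜 V)), (S I).indicator (F I) v := by
    funext v
    obtain ⟨I, hI⟩ : ∃ I : Set (Fin (finrank 𝕜 V)),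
        ∀ i, i ∈ I ↔ perpFrame ω (fun j => (v j : V)) (Fin.natAdd n i) ≠ 0 :=
      ⟨{i | perpFrame ω (fun j => (v j : V)) (Fin.natAdd n i) ≠ 0}, fun i => Iff.rfl⟩
    rw [Finset.sum_eq_single I]
    · rw [Set.indicator_of_mem (show v ∈ S I from hI), Function.comp_apply, perpMeasure,
        lineSpan_range_lines]
      exact projMeasure_apply_of_orthonormal (orthonormal_perpFrame ω _ I hI)
        (orthogonalBilin_eq_span_perpFrame ω _ I hI) hB
    · intro I' _ hne
      refine Set.indicator_of_notMem (fun hv => hne ?_) _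
      ext i
      exact (hv i).trans (hI i).symm
    · simp
  rw [heq]
  exact Finset.measurable_fun_sum _ fun I _ => (hF I).indicator (hS I)

theorem measurable_perpMeasure (ω : V →ₗ[𝕜] V →ₗ[𝕜] 𝕜) (ι : Type*) [Finite ι] :
    Measurable fun p : ι → ℙ 𝕜 V => perpMeasure ω (Set.range p) := by
  obtain ⟨n, ⟨e⟩⟩ := Finite.exists_equiv_fin ι
  have h : (fun p : ι → ℙ 𝕜 V => perpMeasure ω (Set.range p)) =
      (fun p : Fin n → ℙ 𝕜 V => perpMeasure ω (Set.range p)) ∘ fun p => p ∘ e.symm := by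
    funext p
    simp only [Function.comp_apply, EquivLike.range_comp]
  rw [h]
  exact (measurable_perpMeasure_fin ω n).comp
    (measurable_pi_lambda _ fun i => measurable_pi_apply _)

end ProjMeasure

end SympStiefel

namespace SympStiefel

/-! ### Product measures and mixtures -/

section MeasureLemmas

theorem ae_bind_iff {α β : Type*} [MeasurableSpace α] [MeasurableSpace β] {m : Measure α}
    {f : α → Measure β} (hf : Measurable f) {P : β → Prop} (hP : MeasurableSet {b | P b}) :
    (∀ᵐ b ∂m.bind f, P b) ↔ ∀ᵐ a ∂m, ∀ᵐ b ∂f a, P b := by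
  have hm : Measurable fun a => f a {b | P b}ᶜ := (Measure.measurable_coe hP.compl).comp hf
  have h1 : (∀ᵐ b ∂m.bind f, P b) ↔ m.bind f {b | P b}ᶜ = 0 := by
    rw [ae_iff]
    rfl
  rw [h1, Measure.bind_apply hP.compl hf.aemeasurable, lintegral_eq_zero_iff hm]
  rfl

variable {ι : Type*} [Fintype ι] {X : Type*} [MeasurableSpace X]

theorem measurable_measure_pi {α : Type*} [MeasurableSpace α] {μ : ι → α → Measure X}
    [∀ i a, IsProbabilityMeasure (μ i a)] (hμ : ∀ i, Measurable (μ i)) :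
    Measurable fun a => Measure.pi fun i => μ i a := by
  refine Measurable.measure_of_isPiSystem_of_isProbabilityMeasure generateFrom_pi.symm
    isPiSystem_pi ?_
  rintro _ ⟨s, hs, rfl⟩
  simp only [Measure.pi_pi]
  exact Finset.measurable_fun_prod _ fun i _ =>
    (Measure.measurable_coe (hs i (Set.mem_univ i))).comp (hμ i)

theorem map_comp_measure_pi {κ : Type*} [Fintype κ] {e : κ → ι} (he : Function.Injective e)
    (μ : ι → Measure X) [∀ i, IsProbabilityMeasure (μ i)] :
    (Measure.pi μ).map (fun x k => x (e k)) = Measure.pi fun k => μ (e k) := by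
  classical
  refine (Measure.pi_eq fun s hs => ?_).symm
  have hm : Measurable fun (x : ι → X) k => x (e k) :=
    measurable_pi_lambda _ fun k => measurable_pi_apply _
  rw [Measure.map_apply hm (MeasurableSet.univ_pi hs)]
  have : (fun (x : ι → X) k => x (e k)) ⁻¹' Set.univ.pi s =
      Set.univ.pi fun i => {y | ∀ k, e k = i → y ∈ s k} := by
    ext x
    simp only [Set.mem_preimage, Set.mem_univ_pi]
    constructor
    · rintro h _ k rfl
      exact h k
    · exact fun h k => h (e k) k rfl
  rw [this, Measure.pi_pi]
  symm
  refine Fintype.prod_of_injective e he _ _ (fun i hi => ?_) fun k => ?_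
  · have : {y : X | ∀ k, e k = i → y ∈ s k} = Set.univ := by
      ext y
      simp only [Set.mem_univ, iff_true]
      exact fun k hk => absurd ⟨k, hk⟩ hi
    exact this ▸ measure_univ
  · congr 1
    ext y
    constructor
    · rintro hy k' hk'
      exact he hk' ▸ hy
    · exact fun hy => hy k rfl

variable [DecidableEq ι]

theorem measurable_update_prod (j : ι) :
    Measurable fun z : (ι → X) × X => Function.update z.1 j z.2 := by
  refine measurable_pi_lambda _ fun i => ?_
  by_cases h : i = j
  · subst h
    simpa using measurable_snd
  · simp only [ne_eq, h, not_false_eq_true, Function.update_of_ne]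
    exact (measurable_pi_apply i).comp measurable_fst

theorem map_update_measure_pi (μ : ι → Measure X) [∀ i, IsProbabilityMeasure (μ i)] (j : ι)
    (ρ : Measure X) [IsProbabilityMeasure ρ] :
    ((Measure.pi μ).prod ρ).map (fun z => Function.update z.1 j z.2) =
      Measure.pi (Function.update μ j ρ) := by
  have (i : ι) : IsProbabilityMeasure (Function.update μ j ρ i) := by
    by_cases h : i = j
    · subst h
      simpa
    · simp only [ne_eq, h, not_false_eq_true, Function.update_of_ne]
      infer_instance
  refine (Measure.pi_eq fun s hs => ?_).symm
  rw [Measure.map_apply (measurable_update_prod j) (MeasurableSet.univ_pi hs)]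
  have hset : (fun z : (ι → X) × X => Function.update z.1 j z.2) ⁻¹' Set.univ.pi s =
      (Set.univ.pi (Function.update s j Set.univ)) ×ˢ s j := by
    ext ⟨x, y⟩
    simp only [Set.mem_preimage, Set.mem_univ_pi, Set.mem_prod]
    constructor
    · intro h
      refine ⟨fun i => ?_, by simpa using h j⟩
      by_cases hi : i = j
      · subst hi
        simp
      · simpa [hi] using h i
    · rintro ⟨h1, h2⟩ i
      by_cases hi : i = j
      · subst hi
        simpa using h2
      · simpa [hi] using h1 i
  rw [hset, Measure.prod_prod, Measure.pi_pi, ← Finset.mul_prod_erase _ _ (Finset.mem_univ j),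
    ← Finset.mul_prod_erase Finset.univ _ (Finset.mem_univ j)]
  simp only [Function.update_self, measure_univ, one_mul]
  rw [mul_comm]
  congr 1
  refine Finset.prod_congr rfl fun i hi => ?_
  simp [Finset.ne_of_mem_erase hi]

/-- Resampling one coordinate from its own factor leaves a product measure unchanged, so it suffices
to let that coordinate alone be random. -/
theorem ae_pi_of_ae_update (μ : ι → Measure X) [∀ i, IsProbabilityMeasure (μ i)] (j : ι)
    {P : (ι → X) → Prop} (hP : MeasurableSet {x | P x})
    (h : ∀ x, ∀ᵐ y ∂μ j, P (Function.update x j y)) : ∀ᵐ x ∂Measure.pi μ, P x := by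
  have h1 := map_update_measure_pi μ j (μ j)
  rw [Function.update_eq_self] at h1
  rw [← h1, ae_map_iff (measurable_update_prod j).aemeasurable hP]
  exact (Measure.ae_prod_iff_ae_ae (measurable_update_prod j hP)).2
    (Filter.Eventually.of_forall h)

theorem pi_absolutelyContinuous {μ ν : ι → Measure X} [∀ i, IsProbabilityMeasure (μ i)]
    [∀ i, IsProbabilityMeasure (ν i)] (h : ∀ i, μ i ≪ ν i) : Measure.pi μ ≪ Measure.pi ν := by
  -- The factors are exchanged one at a time.
  have key (S : Finset ι) : Measure.pi (S.piecewise μ ν) ≪ Measure.pi ν := by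
    induction S using Finset.induction_on with
    | empty => simpa using Measure.AbsolutelyContinuous.rfl
    | insert j S hj ih =>
      refine Measure.AbsolutelyContinuous.trans ?_ ih
      have (i : ι) : IsProbabilityMeasure (S.piecewise μ ν i) := by
        by_cases hi : i ∈ S
        · rw [Finset.piecewise_eq_of_mem _ _ _ hi]
          infer_instance
        · rw [Finset.piecewise_eq_of_notMem _ _ _ hi]
          infer_instance
      have hν : S.piecewise μ ν = Function.update (S.piecewise μ ν) j (ν j) := by
        rw [eq_comm, Function.update_eq_self_iff, Finset.piecewise_eq_of_notMem _ _ _ hj]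
      rw [Finset.piecewise_insert]
      conv_rhs => rw [hν]
      rw [← map_update_measure_pi (S.piecewise μ ν) j (μ j),
        ← map_update_measure_pi (S.piecewise μ ν) j (ν j)]
      exact (Measure.AbsolutelyContinuous.prod Measure.AbsolutelyContinuous.rfl (h j)).map
        (measurable_update_prod j)
  simpa using key Finset.univ

theorem pi_dirac (x : ι → X) : (Measure.pi fun i => Measure.dirac (x i)) = Measure.dirac x := by
  refine Measure.pi_eq fun s hs => ?_
  rw [Measure.dirac_apply' _ (MeasurableSet.univ_pi hs)]
  simp only [Measure.dirac_apply' _ (hs _)]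
  by_cases h : x ∈ Set.univ.pi s
  · rw [Set.indicator_of_mem h]
    refine (Finset.prod_eq_one fun i _ => ?_).symm
    rw [Set.indicator_of_mem (h i trivial)]
    rfl
  · rw [Set.indicator_of_notMem h]
    rw [Set.mem_univ_pi, not_forall] at h
    obtain ⟨i, hi⟩ := h
    exact (Finset.prod_eq_zero (Finset.mem_univ i) (Set.indicator_of_notMem hi _)).symm

end MeasureLemmas

/-! ### Linear algebra -/

section LinAlg

/-- In a nontrivial relation, a vector of maximal rank among those with nonzero coefficient would be
a combination of other vectors of at most its rank. -/
theorem linearIndependent_of_rank {K E ι : Type*} [Field K] [AddCommGroup E] [Module K E]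
    [Fintype ι] (v : ι → E) (r : ι → ℕ)
    (h : ∀ i, v i ∉ Submodule.span K (v '' {j | j ≠ i ∧ r j ≤ r i})) :
    LinearIndependent K v := by
  classical
  rw [Fintype.linearIndependent_iff]
  intro g hg
  by_contra hne
  push Not at hne
  obtain ⟨i0, hi0⟩ := hne
  obtain ⟨i, hi, hmax⟩ := Finset.exists_max_image (Finset.univ.filter fun i => g i ≠ 0) r
    ⟨i0, by simpa using hi0⟩
  have hgi : g i ≠ 0 := by simpa using hi
  refine h i ?_
  rw [← Finset.add_sum_erase _ _ (Finset.mem_univ i)] at hg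
  have hv : v i = (g i)⁻¹ • -∑ x ∈ Finset.univ.erase i, g x • v x := by
    rw [← eq_neg_of_add_eq_zero_left hg, smul_smul, inv_mul_cancel₀ hgi, one_smul]
  rw [hv]
  refine Submodule.smul_mem _ _ (Submodule.neg_mem _ (Submodule.sum_mem _ fun j hj => ?_))
  by_cases hgj : g j = 0
  · simp [hgj]
  · exact Submodule.smul_mem _ _ (Submodule.subset_span
      ⟨j, ⟨Finset.ne_of_mem_erase hj, hmax j (by simpa using hgj)⟩, rfl⟩)

/-- Finite-dimensional subspaces are closed, so membership means approximation within 1/(n+1), for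
all n, by linear combinations. For fixed coefficients this approximation is an open condition. -/
theorem measurableSet_mem_span {𝕜 V α ι : Type*} [RCLike 𝕜] [NormedAddCommGroup V]
    [InnerProductSpace 𝕜 V] [FiniteDimensional 𝕜 V] [TopologicalSpace α] [MeasurableSpace α]
    [BorelSpace α] [Finite ι] {u : α → V} (hu : Continuous u) {w : ι → α → V}
    (hw : ∀ i, Continuous (w i)) :
    MeasurableSet {a | u a ∈ Submodule.span 𝕜 (Set.range fun i => w i a)} := by
  cases nonempty_fintype ι
  have : {a | u a ∈ Submodule.span 𝕜 (Set.range fun i => w i a)} =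
      ⋂ n : ℕ, ⋃ c : ι → 𝕜, {a | ‖u a - ∑ i, c i • w i a‖ < 1 / ((n : ℝ) + 1)} := by
    ext a
    simp only [Set.mem_ofPred_eq, Set.mem_iInter, Set.mem_iUnion]
    constructor
    · intro h n
      obtain ⟨c, hc⟩ := (Submodule.mem_span_range_iff_exists_fun 𝕜).1 h
      refine ⟨c, ?_⟩
      rw [hc, sub_self, norm_zero]
      positivity
    · intro h
      rw [← SetLike.mem_coe, ← (Submodule.closed_of_finiteDimensional _).closure_eq,
        Metric.mem_closure_iff]
      intro ε hε
      obtain ⟨n, hn⟩ := exists_nat_one_div_lt hε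
      obtain ⟨c, hc⟩ := h n
      refine ⟨∑ i, c i • w i a, ?_, ?_⟩
      · exact Submodule.sum_mem _ fun i _ => Submodule.smul_mem _ _
          (Submodule.subset_span ⟨i, rfl⟩)
      · rw [dist_eq_norm]
        exact hc.trans hn
  rw [this]
  refine MeasurableSet.iInter fun n => IsOpen.measurableSet (isOpen_iUnion fun c => ?_)
  refine isOpen_lt (Continuous.norm (hu.sub ?_)) continuous_const
  exact continuous_finsetSum _ fun i _ => (hw i).const_smul (c i)

end LinAlg

end SympStiefel

namespace SympStiefel

section Chaining

variable {𝕜 V : Type*} [RCLike 𝕜] [NormedAddCommGroup V] [InnerProductSpace 𝕜 V]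

/-! ### Dimension counts -/

theorem lineSpan_eq_span (S : Set (ℙ 𝕜 V)) :
    lineSpan S = Submodule.span 𝕜 (Projectivization.rep '' S) := by
  rw [lineSpan, Submodule.span_eq_iSup_of_singleton_spans, iSup_image]
  exact iSup_congr fun x => iSup_congr fun _ => Projectivization.submodule_eq x

theorem finrank_lineSpan_le (S : Finset (ℙ 𝕜 V)) :
    finrank 𝕜 (lineSpan (S : Set (ℙ 𝕜 V))) ≤ S.card := by
  classical
  rw [lineSpan_eq_span, ← Finset.coe_image]
  exact (finrank_span_finset_le_card _).trans Finset.card_image_le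

theorem submodule_le_lineSpan {S : Set (ℙ 𝕜 V)} {x : ℙ 𝕜 V} (hx : x ∈ S) :
    x.submodule ≤ lineSpan S :=
  le_biSup (fun x : ℙ 𝕜 V => x.submodule) hx

theorem lineSpan_le {S : Set (ℙ 𝕜 V)} {U : Submodule 𝕜 V} :
    lineSpan S ≤ U ↔ ∀ x ∈ S, x.submodule ≤ U :=
  iSup₂_le_iff

variable [FiniteDimensional 𝕜 V]

theorem finrank_orthogonalBilin {ω : V →ₗ[𝕜] V →ₗ[𝕜] 𝕜} (hω : ω.Nondegenerate)
    (U : Submodule 𝕜 V) : finrank 𝕜 (U.orthogonalBilin ω) = finrank 𝕜 V - finrank 𝕜 U :=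
  LinearMap.BilinForm.finrank_orthogonal (B := ω) hω U

theorem orthogonalBilin_orthogonalBilin {ω : V →ₗ[𝕜] V →ₗ[𝕜] 𝕜} (hω : ω.Nondegenerate)
    (halt : ω.IsAlt) (U : Submodule 𝕜 V) : (U.orthogonalBilin ω).orthogonalBilin ω = U :=
  LinearMap.BilinForm.orthogonal_orthogonal (B := ω) hω halt.isRefl U

theorem le_of_orthogonalBilin_le {ω : V →ₗ[𝕜] V →ₗ[𝕜] 𝕜} (hω : ω.Nondegenerate)
    (halt : ω.IsAlt) {U W : Submodule 𝕜 V} (h : U.orthogonalBilin ω ≤ W.orthogonalBilin ω) :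
    W ≤ U := by
  rw [← orthogonalBilin_orthogonalBilin hω halt U, ← orthogonalBilin_orthogonalBilin hω halt W]
  exact fun x hx y hy => hx y (h hy)

theorem orthogonalBilin_ne_bot {ω : V →ₗ[𝕜] V →ₗ[𝕜] 𝕜} (hω : ω.Nondegenerate)
    {U : Submodule 𝕜 V} (h : finrank 𝕜 U < finrank 𝕜 V) : U.orthogonalBilin ω ≠ ⊥ := by
  intro hbot
  have := finrank_orthogonalBilin hω U
  rw [hbot, finrank_bot] at this
  omega

/-- Two points of projective space are `ω`-perpendicular. -/
def Perp (ω : V →ₗ[𝕜] V →ₗ[𝕜] 𝕜) (x y : ℙ 𝕜 V) : Prop := ω x.rep y.rep = 0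

theorem submodule_le_orthogonalBilin_iff {ω : V →ₗ[𝕜] V →ₗ[𝕜] 𝕜} {x : ℙ 𝕜 V}
    {S : Set (ℙ 𝕜 V)} : x.submodule ≤ (lineSpan S).orthogonalBilin ω ↔ ∀ y ∈ S, Perp ω y x := by
  rw [submodule_le_iff]
  constructor
  · intro h y hy
    exact h _ (submodule_le_iff.1 (submodule_le_lineSpan hy))
  · intro h z hz
    have : lineSpan S ≤ LinearMap.ker (ω.flip x.rep) :=
      lineSpan_le.2 fun y hy => submodule_le_iff.2 (h y hy)
    exact this hz

theorem submodule_le_orthogonalBilin_submodule_iff {ω : V →ₗ[𝕜] V →ₗ[𝕜] 𝕜} {x y : ℙ 𝕜 V} :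
    x.submodule ≤ y.submodule.orthogonalBilin ω ↔ Perp ω y x := by
  have : y.submodule = lineSpan {y} := by simp [lineSpan]
  rw [this, submodule_le_orthogonalBilin_iff]
  simp

theorem Perp.symm {ω : V →ₗ[𝕜] V →ₗ[𝕜] 𝕜} (halt : ω.IsAlt) {x y : ℙ 𝕜 V} (h : Perp ω x y) :
    Perp ω y x :=
  halt.isRefl _ _ h

theorem perp_mk_iff {ω : V →ₗ[𝕜] V →ₗ[𝕜] 𝕜} {v w : V} (hv : v ≠ 0) (hw : w ≠ 0) :
    Perp ω (Projectivization.mk 𝕜 v hv) (Projectivization.mk 𝕜 w hw) ↔ ω v w = 0 := by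
  obtain ⟨a, ha⟩ := Projectivization.exists_smul_eq_mk_rep 𝕜 v hv
  obtain ⟨b, hb⟩ := Projectivization.exists_smul_eq_mk_rep 𝕜 w hw
  rw [Perp, ← ha, ← hb]
  simp [Units.smul_def]

variable [MeasurableSpace V] [BorelSpace V]

theorem measurableSet_perp (ω : V →ₗ[𝕜] V →ₗ[𝕜] 𝕜) {ι : Type*} [Countable ι] (i j : ι) :
    MeasurableSet {y : ι → ℙ 𝕜 V | Perp ω (y i) (y j)} := by
  rw [← measurableSet_lines_preimage]
  have : lines ⁻¹' {y : ι → ℙ 𝕜 V | Perp ω (y i) (y j)} =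
      {v : ι → {v : V // v ≠ 0} | inner 𝕜 (formDual ω (v i)) (v j : V) = 0} := by
    ext v
    rw [Set.mem_ofPred_eq, inner_formDual]
    exact perp_mk_iff _ _
  rw [this]
  refine (isClosed_eq ?_ continuous_const).measurableSet
  exact Continuous.inner ((continuous_formDual ω).comp
    (continuous_subtype_val.comp (continuous_apply i)))
    (continuous_subtype_val.comp (continuous_apply j))

theorem measurableSet_le_lineSpan {ι : Type*} [Finite ι] (i : ι) (I : Set ι) :
    MeasurableSet {y : ι → ℙ 𝕜 V | (y i).submodule ≤ lineSpan (y '' I)} := by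
  rw [← measurableSet_lines_preimage]
  have : lines ⁻¹' {y : ι → ℙ 𝕜 V | (y i).submodule ≤ lineSpan (y '' I)} =
      {v : ι → {v : V // v ≠ 0} |
        (v i : V) ∈ Submodule.span 𝕜 (Set.range fun j : I => (v j : V))} := by
    ext v
    rw [Set.mem_ofPred_eq, Set.mem_preimage, Set.mem_ofPred_eq,
      ← lineSpan_range_lines (𝕜 := 𝕜) fun j : I => v j, Set.image_eq_range]
    exact submodule_mk_le _
  rw [this]
  exact measurableSet_mem_span (continuous_subtype_val.comp (continuous_apply i))
    fun j => continuous_subtype_val.comp (continuous_apply (j : ι))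

theorem isProbabilityMeasure_perpMeasure {ω : V →ₗ[𝕜] V →ₗ[𝕜] 𝕜} (hω : ω.Nondegenerate)
    {S : Set (ℙ 𝕜 V)} (h : finrank 𝕜 (lineSpan S) < finrank 𝕜 V) :
    IsProbabilityMeasure (perpMeasure ω S) :=
  isProbabilityMeasure_projMeasure (orthogonalBilin_ne_bot hω h)

theorem ae_perpMeasure_perp (ω : V →ₗ[𝕜] V →ₗ[𝕜] 𝕜) (S : Set (ℙ 𝕜 V)) :
    ∀ᵐ x ∂perpMeasure ω S, ∀ y ∈ S, Perp ω y x := by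
  filter_upwards [ae_projMeasure_le ((lineSpan S).orthogonalBilin ω)] with x hx
  exact submodule_le_orthogonalBilin_iff.1 hx

/-! ### The chaining law -/

variable {k : ℕ}

/-- The points which are used to sample `t_J`. -/
def ancestors (p : Fin (k + 1) → ℙ 𝕜 V) (t : Finset (Fin (k + 1)) → ℙ 𝕜 V)
    (J : Finset (Fin (k + 1))) : Set (ℙ 𝕜 V) :=
  p '' (J : Set (Fin (k + 1))) ∪ t '' {J' | J' ⊂ J}

/-- There are |J| points p_j and 2^|J| − 1 proper subsets. -/
theorem finrank_ancestors_le (p : Fin (k + 1) → ℙ 𝕜 V) (t : Finset (Fin (k + 1)) → ℙ 𝕜 V)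
    (J : Finset (Fin (k + 1))) :
    finrank 𝕜 (lineSpan (ancestors p t J)) + 1 ≤ J.card + 2 ^ J.card := by
  classical
  have h : ancestors p t J = ((J.image p ∪ J.ssubsets.image t : Finset (ℙ 𝕜 V)) : Set (ℙ 𝕜 V)) := by
    ext x
    simp [ancestors]
  have h1 := finrank_lineSpan_le (J.image p ∪ J.ssubsets.image t)
  have h2 := Finset.card_union_le (J.image p) (J.ssubsets.image t)
  have h3 : (J.image p).card ≤ J.card := Finset.card_image_le
  have h4 : (J.ssubsets.image t).card ≤ J.ssubsets.card := Finset.card_image_le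
  have h5 : J.ssubsets.card + 1 = 2 ^ J.card := by
    rw [Finset.ssubsets, Finset.card_erase_add_one (Finset.mem_powerset_self J),
      Finset.card_powerset]
  rw [h]
  omega

theorem finrank_ancestors_lt (hdim : 2 ^ (k + 1) + (k + 1) ≤ finrank 𝕜 V)
    (p : Fin (k + 1) → ℙ 𝕜 V) (t : Finset (Fin (k + 1)) → ℙ 𝕜 V) (J : Finset (Fin (k + 1))) :
    finrank 𝕜 (lineSpan (ancestors p t J)) < finrank 𝕜 V := by
  have h1 := finrank_ancestors_le p t J
  have h2 : J.card ≤ k + 1 := card_finset_fin_le J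
  have h3 : 2 ^ J.card ≤ 2 ^ (k + 1) := Nat.pow_le_pow_right (by norm_num) h2
  omega

/-- The law of `t_J` in the step which samples the points `t_J` with `|J| = m`. -/
noncomputable def stepFactor (ω : V →ₗ[𝕜] V →ₗ[𝕜] 𝕜) (p : Fin (k + 1) → ℙ 𝕜 V) (m : ℕ)
    (t : Finset (Fin (k + 1)) → ℙ 𝕜 V) (J : Finset (Fin (k + 1))) : Measure (ℙ 𝕜 V) :=
  if J.card = m then perpMeasure ω (ancestors p t J) else Measure.dirac (t J)

theorem chainingStep_eq (ω : V →ₗ[𝕜] V →ₗ[𝕜] 𝕜) (p : Fin (k + 1) → ℙ 𝕜 V) (m : ℕ)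
    (t : Finset (Fin (k + 1)) → ℙ 𝕜 V) :
    chainingStep ω p m t = Measure.pi (stepFactor ω p m t) := rfl

variable {ω : V →ₗ[𝕜] V →ₗ[𝕜] 𝕜}

theorem isProbabilityMeasure_stepFactor (hω : ω.Nondegenerate)
    (hdim : 2 ^ (k + 1) + (k + 1) ≤ finrank 𝕜 V) (p : Fin (k + 1) → ℙ 𝕜 V) (m : ℕ)
    (t : Finset (Fin (k + 1)) → ℙ 𝕜 V) (J : Finset (Fin (k + 1))) :
    IsProbabilityMeasure (stepFactor ω p m t J) := by
  rw [stepFactor]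
  split_ifs
  · exact isProbabilityMeasure_perpMeasure hω (finrank_ancestors_lt hdim p t J)
  · infer_instance

theorem isProbabilityMeasure_chainingStep (hω : ω.Nondegenerate)
    (hdim : 2 ^ (k + 1) + (k + 1) ≤ finrank 𝕜 V) (p : Fin (k + 1) → ℙ 𝕜 V) (m : ℕ)
    (t : Finset (Fin (k + 1)) → ℙ 𝕜 V) : IsProbabilityMeasure (chainingStep ω p m t) := by
  have := isProbabilityMeasure_stepFactor hω hdim p m t
  rw [chainingStep_eq]
  infer_instance

theorem measurable_stepFactor (ω : V →ₗ[𝕜] V →ₗ[𝕜] 𝕜) (m : ℕ) (J : Finset (Fin (k + 1))) :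
    Measurable fun z : (Fin (k + 1) → ℙ 𝕜 V) × (Finset (Fin (k + 1)) → ℙ 𝕜 V) =>
      stepFactor ω z.1 m z.2 J := by
  simp only [stepFactor]
  split_ifs
  · have h : (fun z : (Fin (k + 1) → ℙ 𝕜 V) × (Finset (Fin (k + 1)) → ℙ 𝕜 V) =>
        perpMeasure ω (ancestors z.1 z.2 J)) =
        (fun y : {j // j ∈ J} ⊕ {J' // J' ⊂ J} → ℙ 𝕜 V => perpMeasure ω (Set.range y)) ∘
        fun z => Sum.elim (fun j => z.1 j) fun J' => z.2 J' := by
      funext z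
      rw [Function.comp_apply, Set.Sum.elim_range, ancestors, Set.image_eq_range,
        Set.image_eq_range]
      rfl
    rw [h]
    refine (measurable_perpMeasure ω _).comp (measurable_pi_lambda _ ?_)
    rintro (j | J')
    · exact (measurable_pi_apply _).comp measurable_fst
    · exact (measurable_pi_apply _).comp measurable_snd
  · exact Measure.measurable_dirac.comp ((measurable_pi_apply J).comp measurable_snd)

theorem measurable_chainingStep (hω : ω.Nondegenerate)
    (hdim : 2 ^ (k + 1) + (k + 1) ≤ finrank 𝕜 V) (m : ℕ) :
    Measurable fun z : (Fin (k + 1) → ℙ 𝕜 V) × (Finset (Fin (k + 1)) → ℙ 𝕜 V) =>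
      chainingStep ω z.1 m z.2 := by
  obtain ⟨F, hF⟩ : ∃ F : Finset (Fin (k + 1)) → (Fin (k + 1) → ℙ 𝕜 V) ×
      (Finset (Fin (k + 1)) → ℙ 𝕜 V) → Measure (ℙ 𝕜 V),
      F = fun J z => stepFactor ω z.1 m z.2 J := ⟨_, rfl⟩
  have hprob (J : Finset (Fin (k + 1)))
      (z : (Fin (k + 1) → ℙ 𝕜 V) × (Finset (Fin (k + 1)) → ℙ 𝕜 V)) :
      IsProbabilityMeasure (F J z) := by
    rw [hF]
    exact isProbabilityMeasure_stepFactor hω hdim z.1 m z.2 J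
  have hmeas (J : Finset (Fin (k + 1))) : Measurable (F J) := by
    rw [hF]
    exact measurable_stepFactor ω m J
  have h := measurable_measure_pi hmeas
  simp only [hF] at h
  exact h

theorem measurable_chainingStep_right (hω : ω.Nondegenerate)
    (hdim : 2 ^ (k + 1) + (k + 1) ≤ finrank 𝕜 V) (m : ℕ) (p : Fin (k + 1) → ℙ 𝕜 V) :
    Measurable (chainingStep ω p m) := by
  have h : Measurable fun t : Finset (Fin (k + 1)) → ℙ 𝕜 V => (p, t) := measurable_prodMk_left
  have h' := (measurable_chainingStep hω hdim m).comp h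
  exact h'

theorem isProbabilityMeasure_chainingLawUpTo (hω : ω.Nondegenerate)
    (hdim : 2 ^ (k + 1) + (k + 1) ≤ finrank 𝕜 V) (p : Fin (k + 1) → ℙ 𝕜 V) (m : ℕ) :
    IsProbabilityMeasure (chainingLawUpTo ω p m) := by
  induction m with
  | zero =>
    have : IsProbabilityMeasure (projMeasure (⊤ : Submodule 𝕜 V)) := by
      refine isProbabilityMeasure_projMeasure fun h => ?_
      have := finrank_top 𝕜 V
      rw [h, finrank_bot] at this
      have := Nat.one_le_two_pow (n := k + 1)
      omega
    rw [chainingLawUpTo]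
    infer_instance
  | succ m ih =>
    rw [chainingLawUpTo]
    exact isProbabilityMeasure_bind (measurable_chainingStep_right hω hdim (m + 1) p).aemeasurable
      (Filter.Eventually.of_forall fun t =>
        isProbabilityMeasure_chainingStep hω hdim p (m + 1) t)

theorem measurable_chainingLawUpTo (hω : ω.Nondegenerate)
    (hdim : 2 ^ (k + 1) + (k + 1) ≤ finrank 𝕜 V) (m : ℕ) :
    Measurable fun p : Fin (k + 1) → ℙ 𝕜 V => chainingLawUpTo ω p m := by
  induction m with
  | zero => exact measurable_const
  | succ m ih =>
    refine Measure.measurable_of_measurable_coe _ fun s hs => ?_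
    simp only [chainingLawUpTo]
    have h (p : Fin (k + 1) → ℙ 𝕜 V) := Measure.bind_apply (m := chainingLawUpTo ω p m) hs
      (measurable_chainingStep_right hω hdim (m + 1) p).aemeasurable
    simp only [h]
    let κ : ProbabilityTheory.Kernel (Fin (k + 1) → ℙ 𝕜 V) (Finset (Fin (k + 1)) → ℙ 𝕜 V) :=
      ⟨fun p => chainingLawUpTo ω p m, ih⟩
    have : ProbabilityTheory.IsMarkovKernel κ :=
      ⟨fun p => isProbabilityMeasure_chainingLawUpTo hω hdim p m⟩
    exact Measurable.lintegral_kernel_prod_right' (κ := κ)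
      ((Measure.measurable_coe hs).comp (measurable_chainingStep hω hdim (m + 1)))

theorem ae_chainingLawUpTo_succ (hω : ω.Nondegenerate)
    (hdim : 2 ^ (k + 1) + (k + 1) ≤ finrank 𝕜 V) (p : Fin (k + 1) → ℙ 𝕜 V) (m : ℕ)
    {P : (Finset (Fin (k + 1)) → ℙ 𝕜 V) → Prop} (hP : MeasurableSet {t | P t}) :
    (∀ᵐ t ∂chainingLawUpTo ω p (m + 1), P t) ↔
      ∀ᵐ t ∂chainingLawUpTo ω p m, ∀ᵐ t' ∂chainingStep ω p (m + 1) t, P t' :=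
  ae_bind_iff (measurable_chainingStep_right hω hdim (m + 1) p) hP

theorem ae_chainingStep_eq (hω : ω.Nondegenerate)
    (hdim : 2 ^ (k + 1) + (k + 1) ≤ finrank 𝕜 V) (p : Fin (k + 1) → ℙ 𝕜 V) (m : ℕ)
    (t : Finset (Fin (k + 1)) → ℙ 𝕜 V) :
    ∀ᵐ t' ∂chainingStep ω p m t, ∀ J, J.card ≠ m → t' J = t J := by
  have := isProbabilityMeasure_stepFactor hω hdim p m t
  rw [chainingStep_eq, ae_all_iff]
  intro J
  by_cases hJ : J.card = m
  · exact Filter.Eventually.of_forall fun t' h => absurd hJ h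
  · have h1 : ∀ᵐ x ∂stepFactor ω p m t J, x = t J := by
      rw [stepFactor, if_neg hJ]
      exact (ae_dirac_iff (measurableSet_singleton _)).2 rfl
    filter_upwards [Measure.tendsto_eval_ae_ae.eventually h1] with t' ht' _
    exact ht'

theorem ae_chainingStep_of_ae (hω : ω.Nondegenerate)
    (hdim : 2 ^ (k + 1) + (k + 1) ≤ finrank 𝕜 V) (p : Fin (k + 1) → ℙ 𝕜 V) {m : ℕ}
    (t : Finset (Fin (k + 1)) → ℙ 𝕜 V) {J : Finset (Fin (k + 1))} (hJ : J.card = m)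
    {P : ℙ 𝕜 V → Prop} (h : ∀ᵐ x ∂perpMeasure ω (ancestors p t J), P x) :
    ∀ᵐ t' ∂chainingStep ω p m t, P (t' J) := by
  have := isProbabilityMeasure_stepFactor hω hdim p m t
  have h1 : ∀ᵐ x ∂stepFactor ω p m t J, P x := by rwa [stepFactor, if_pos hJ]
  rw [chainingStep_eq]
  exact Measure.tendsto_eval_ae_ae.eventually h1

/-- An almost sure property of the points `t_J` with `|J| ≤ m` persists in later steps. -/
theorem ae_chainingLawUpTo_mono (hω : ω.Nondegenerate)
    (hdim : 2 ^ (k + 1) + (k + 1) ≤ finrank 𝕜 V) (p : Fin (k + 1) → ℙ 𝕜 V) {m m' : ℕ}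
    (hmm : m ≤ m') {P : (Finset (Fin (k + 1)) → ℙ 𝕜 V) → Prop} (hP : MeasurableSet {t | P t})
    (hdep : ∀ t t', (∀ J, J.card ≤ m → t' J = t J) → P t → P t')
    (h : ∀ᵐ t ∂chainingLawUpTo ω p m, P t) : ∀ᵐ t ∂chainingLawUpTo ω p m', P t := by
  induction m', hmm using Nat.le_induction with
  | base => exact h
  | succ m' hm ih =>
    rw [ae_chainingLawUpTo_succ hω hdim p m' hP]
    filter_upwards [ih] with t ht
    filter_upwards [ae_chainingStep_eq hω hdim p (m' + 1) t] with t' ht'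
    exact hdep t t' (fun J hJ => ht' J (by omega)) ht

end Chaining

end SympStiefel

namespace SympStiefel

/-! ### Marginals of the chaining law over faces, and general position. -/

section Generic

variable {𝕜 V : Type*} [RCLike 𝕜] [NormedAddCommGroup V] [InnerProductSpace 𝕜 V]
variable {k : ℕ} {ω : V →ₗ[𝕜] V →ₗ[𝕜] 𝕜}

theorem isProbabilityMeasure_projMeasure_top [FiniteDimensional 𝕜 V] [MeasurableSpace V]
    [BorelSpace V] (h : 0 < finrank 𝕜 V) :
    IsProbabilityMeasure (projMeasure (⊤ : Submodule 𝕜 V)) := by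
  refine isProbabilityMeasure_projMeasure fun hbot => ?_
  have := finrank_top 𝕜 V
  rw [hbot, finrank_bot] at this
  omega

theorem ancestors_image (p : Fin (k + 2) → ℙ 𝕜 V) (t : Finset (Fin (k + 2)) → ℙ 𝕜 V)
    (j : Fin (k + 2)) (J : Finset (Fin (k + 1))) :
    ancestors p t (J.image j.succAbove) =
      ancestors (p ∘ j.succAbove) (fun J => t (J.image j.succAbove)) J := by
  have h : {J' | J' ⊂ J.image j.succAbove} =
      (fun J' : Finset (Fin (k + 1)) => J'.image j.succAbove) '' {J' | J' ⊂ J} := by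
    ext J'
    simp only [Set.mem_ofPred_eq, Set.mem_image]
    constructor
    · intro hJ'
      obtain ⟨s, -, rfl⟩ := Finset.subset_image_iff.1 hJ'.1
      exact ⟨s, (Finset.image_ssubset_image Fin.succAbove_right_injective).1 hJ', rfl⟩
    · rintro ⟨s, hs, rfl⟩
      exact (Finset.image_ssubset_image Fin.succAbove_right_injective).2 hs
  rw [ancestors, ancestors, h, Finset.coe_image, Set.image_image, Set.image_image]
  rfl

theorem ancestors_congr (p : Fin (k + 1) → ℙ 𝕜 V) {t t' : Finset (Fin (k + 1)) → ℙ 𝕜 V}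
    {J : Finset (Fin (k + 1))} (h : ∀ J' ⊂ J, t' J' = t J') :
    ancestors p t' J = ancestors p t J := by
  rw [ancestors, ancestors]
  congr 1
  exact Set.image_congr fun J' hJ' => h J' hJ'

variable [FiniteDimensional 𝕜 V] [MeasurableSpace V] [BorelSpace V]

/-- Restriction of a family of points to the subsets not containing `j`. -/
def restrictFamily {P : Type*} (j : Fin (k + 2)) (t : Finset (Fin (k + 2)) → P) :
    Finset (Fin (k + 1)) → P := fun J => t (J.image j.succAbove)

theorem measurable_restrictFamily {P : Type*} [MeasurableSpace P] (j : Fin (k + 2)) :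
    Measurable (restrictFamily (P := P) j) :=
  measurable_pi_lambda _ fun _ => measurable_pi_apply _

/-- For j ∉ J, sampling t_J only uses points t_{J'} with J' ⊊ J and points p_i with i ≠ j, so it
commutes with forgetting the subsets containing j. -/
theorem map_chainingStep (hω : ω.Nondegenerate)
    (hdim : 2 ^ (k + 1 + 1) + (k + 1 + 1) ≤ finrank 𝕜 V) (p : Fin (k + 2) → ℙ 𝕜 V) (m : ℕ)
    (t : Finset (Fin (k + 2)) → ℙ 𝕜 V) (j : Fin (k + 2)) :
    (chainingStep ω p m t).map (restrictFamily j) =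
      chainingStep ω (p ∘ j.succAbove) m (restrictFamily j t) := by
  have := isProbabilityMeasure_stepFactor hω hdim p m t
  rw [chainingStep_eq, chainingStep_eq]
  refine (map_comp_measure_pi (Finset.image_injective (Fin.succAbove_right_injective (p := j)))
    (stepFactor ω p m t)).trans ?_
  congr 1
  funext J
  rw [stepFactor, stepFactor, ancestors_image,
    Finset.card_image_of_injective _ Fin.succAbove_right_injective]
  rfl

theorem map_chainingLawUpTo (hω : ω.Nondegenerate)
    (hdim : 2 ^ (k + 1 + 1) + (k + 1 + 1) ≤ finrank 𝕜 V) (p : Fin (k + 2) → ℙ 𝕜 V) (m : ℕ)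
    (j : Fin (k + 2)) :
    (chainingLawUpTo ω p m).map (restrictFamily j) =
      chainingLawUpTo ω (p ∘ j.succAbove) m := by
  have hdim' : 2 ^ (k + 1) + (k + 1) ≤ finrank 𝕜 V := by
    rw [pow_succ] at hdim
    omega
  induction m with
  | zero =>
    have : IsProbabilityMeasure (projMeasure (⊤ : Submodule 𝕜 V)) :=
      isProbabilityMeasure_projMeasure_top ((Nat.succ_pos _).trans_le (le_of_add_le_right hdim))
    exact map_comp_measure_pi (Finset.image_injective (Fin.succAbove_right_injective (p := j))) _
  | succ m ih =>
    rw [chainingLawUpTo, chainingLawUpTo, ← ih]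
    ext s hs
    have hm (q : Fin (k + 1) → ℙ 𝕜 V) : Measurable fun t => chainingStep ω q (m + 1) t s :=
      (Measure.measurable_coe hs).comp (measurable_chainingStep_right hω hdim' _ _)
    rw [Measure.map_apply (measurable_restrictFamily j) hs,
      Measure.bind_apply (measurable_restrictFamily j hs)
        (measurable_chainingStep_right hω hdim _ p).aemeasurable,
      Measure.bind_apply hs (measurable_chainingStep_right hω hdim' _ _).aemeasurable,
      lintegral_map (hm _) (measurable_restrictFamily j)]
    refine lintegral_congr fun t => ?_
    rw [← map_chainingStep hω hdim, Measure.map_apply (measurable_restrictFamily j) hs]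

/-- The chaining law of a face is the marginal of the chaining law. -/
theorem map_chainingLaw (hω : ω.Nondegenerate)
    (hdim : 2 ^ (k + 1 + 1) + (k + 1 + 1) ≤ finrank 𝕜 V) (p : Fin (k + 2) → ℙ 𝕜 V)
    (j : Fin (k + 2)) :
    (chainingLaw ω p).map (restrictFamily j) = chainingLaw ω (p ∘ j.succAbove) := by
  rw [chainingLaw, map_chainingLawUpTo hω hdim, chainingLawUpTo]
  -- The law over p has one sampling step more than the law over its face. That step is trivial on
  -- the face, which has no index sets with `k + 2` elements.
  have h (t : Finset (Fin (k + 1)) → ℙ 𝕜 V) :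
      chainingStep ω (p ∘ j.succAbove) (k + 1 + 1) t = Measure.dirac t := by
    rw [chainingStep_eq, ← pi_dirac]
    congr 1
    funext J
    have := card_finset_fin_le J
    rw [stepFactor, if_neg (by omega)]
  rw [funext h]
  exact Measure.bind_dirac

/-! ### Genericity of the random points -/

theorem measurable_sumElim (p : Fin (k + 1) → ℙ 𝕜 V) :
    Measurable fun t : Finset (Fin (k + 1)) → ℙ 𝕜 V => Sum.elim p t := by
  refine measurable_pi_lambda _ ?_
  rintro (i | J)
  · exact measurable_const
  · exact measurable_pi_apply J

theorem measurableSet_family_perp (p : Fin (k + 1) → ℙ 𝕜 V) (i : Fin (k + 1))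
    (J : Finset (Fin (k + 1))) :
    MeasurableSet {t : Finset (Fin (k + 1)) → ℙ 𝕜 V | Perp ω (p i) (t J)} :=
  measurable_sumElim p (measurableSet_perp ω (Sum.inl i) (Sum.inr J))

theorem measurableSet_family_le (p : Fin (k + 1) → ℙ 𝕜 V) (J : Finset (Fin (k + 1)))
    (A : Set (Fin (k + 1))) (S : Set (Finset (Fin (k + 1)))) :
    MeasurableSet {t : Finset (Fin (k + 1)) → ℙ 𝕜 V |
      (t J).submodule ≤ lineSpan (p '' A ∪ t '' S)} := by
  have := measurable_sumElim p (measurableSet_le_lineSpan (Sum.inr J) (Sum.inl '' A ∪ Sum.inr '' S))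
  simp only [Set.image_union, Set.image_image] at this
  exact this

theorem measurableSet_ancestors_perp (p : Fin (k + 1) → ℙ 𝕜 V) (J : Finset (Fin (k + 1))) :
    MeasurableSet {t : Finset (Fin (k + 1)) → ℙ 𝕜 V |
      ∀ y ∈ ancestors p t J, Perp ω y (t J)} := by
  have : {t : Finset (Fin (k + 1)) → ℙ 𝕜 V | ∀ y ∈ ancestors p t J, Perp ω y (t J)} =
      (⋂ i ∈ J, {t | Perp ω (p i) (t J)}) ∩
        ⋂ J' ∈ {J' | J' ⊂ J}, {t | Perp ω (t J') (t J)} := by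
    ext t
    simp [ancestors, or_imp, forall_and]
  rw [this]
  refine MeasurableSet.inter ?_ ?_
  · exact MeasurableSet.biInter (Set.to_countable _) fun i _ => measurableSet_family_perp p i J
  · exact MeasurableSet.biInter (Set.to_countable _) fun J' _ => measurableSet_perp ω J' J

theorem ae_chainingStep_forall (hω : ω.Nondegenerate)
    (hdim : 2 ^ (k + 1) + (k + 1) ≤ finrank 𝕜 V) (p : Fin (k + 1) → ℙ 𝕜 V) {m : ℕ}
    (t : Finset (Fin (k + 1)) → ℙ 𝕜 V) {P : Finset (Fin (k + 1)) → ℙ 𝕜 V → Prop}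
    (h : ∀ J, J.card = m → ∀ᵐ x ∂perpMeasure ω (ancestors p t J), P J x) :
    ∀ᵐ t' ∂chainingStep ω p m t, ∀ J, J.card = m → P J (t' J) := by
  rw [ae_all_iff]
  intro J
  by_cases hJ : J.card = m
  · filter_upwards [ae_chainingStep_of_ae hω hdim p t hJ (h J hJ)] with t' ht' _ using ht'
  · exact Filter.Eventually.of_forall fun t' h' => absurd h' hJ

theorem ae_ancestors_perp (hω : ω.Nondegenerate)
    (hdim : 2 ^ (k + 1) + (k + 1) ≤ finrank 𝕜 V) (p : Fin (k + 1) → ℙ 𝕜 V) (m : ℕ) :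
    ∀ᵐ t ∂chainingLawUpTo ω p m, ∀ J, J.card ≤ m → ∀ y ∈ ancestors p t J, Perp ω y (t J) := by
  induction m with
  | zero =>
    refine Filter.Eventually.of_forall fun t J hJ => ?_
    obtain rfl : J = ∅ := Finset.card_eq_zero.1 (by omega)
    simp [ancestors]
  | succ m ih =>
    rw [ae_chainingLawUpTo_succ hω hdim]
    · filter_upwards [ih] with t ht
      filter_upwards [ae_chainingStep_eq hω hdim p (m + 1) t,
        ae_chainingStep_forall hω hdim p t (m := m + 1)
          fun J _ => ae_perpMeasure_perp ω (ancestors p t J)] with t' h1 h2 J hJ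
      have hanc : ancestors p t' J = ancestors p t J := ancestors_congr p fun J' hJ' =>
        h1 J' (by have := Finset.card_lt_card hJ'; omega)
      rw [hanc]
      by_cases hJm : J.card = m + 1
      · exact h2 J hJm
      · rw [h1 J hJm]
        exact ht J (by omega)
    · simp only [Set.ofPred_forall]
      exact MeasurableSet.iInter fun J => MeasurableSet.iInter fun _ => by
        simpa only [Set.ofPred_forall] using measurableSet_ancestors_perp p J

/-- The proper subsets of `I` other than `J` which are sampled not later than `J`. -/
def rivals (I J : Finset (Fin (k + 1))) : Set (Finset (Fin (k + 1))) :=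
  {J' | J' ⊂ I ∧ J' ≠ J ∧ J'.card ≤ J.card}

theorem finrank_rivals_le (p : Fin (k + 1) → ℙ 𝕜 V) (t : Finset (Fin (k + 1)) → ℙ 𝕜 V)
    {I J : Finset (Fin (k + 1))} (hJ : J ⊂ I) :
    finrank 𝕜 (lineSpan (p '' Set.univ ∪ t '' rivals I J)) + 2 ≤ k + 1 + 2 ^ I.card := by
  classical
  have h : p '' Set.univ ∪ t '' rivals I J ⊆
      ((Finset.univ.image p ∪ (I.ssubsets.erase J).image t : Finset (ℙ 𝕜 V)) : Set (ℙ 𝕜 V)) := by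
    rintro x (⟨i, -, rfl⟩ | ⟨J', ⟨h1, h2, -⟩, rfl⟩)
    · simp
    · simp only [Finset.coe_union, Finset.coe_image, Set.mem_union]
      exact Or.inr ⟨J', by simp [h1, h2], rfl⟩
  have h1 := finrank_lineSpan_le (Finset.univ.image p ∪ (I.ssubsets.erase J).image t)
  have h2 := Finset.card_union_le (Finset.univ.image p) ((I.ssubsets.erase J).image t)
  have h3 : (Finset.univ.image p).card ≤ k + 1 := Finset.card_image_le.trans (by simp)
  have h4 : ((I.ssubsets.erase J).image t).card ≤ (I.ssubsets.erase J).card :=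
    Finset.card_image_le
  have h5 : (I.ssubsets.erase J).card + 2 = 2 ^ I.card := by
    have h6 := Finset.card_erase_add_one (Finset.mem_ssubsets.2 hJ)
    have h7 := Finset.card_erase_add_one (Finset.mem_powerset_self I)
    rw [Finset.card_powerset] at h7
    rw [← h7, ← Finset.ssubsets, ← h6]
  have h6 := Submodule.finrank_mono (lineSpan_mono h)
  omega

/-- With i = |I| and j = |J|, the complement from which t_J is drawn has dimension at least N + 1 −
j − 2^j, while all the p's and the rivals of J span at most k − 1 + 2^i dimensions. The claim says
that the former number is larger; it holds because both 2^i and j + 2^j are at most 2^k. -/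
theorem rivals_count {i j k N : ℕ} (hji : j < i) (hik : i ≤ k) (hN : 2 ^ (k + 1) + (k + 1) ≤ N) :
    j + 2 ^ j + (k + 1 + 2 ^ i) < N + 3 := by
  have h1 : 2 ^ i ≤ 2 ^ k := Nat.pow_le_pow_right (by norm_num) hik
  have h2 : 2 ^ (j + 1) ≤ 2 ^ k := Nat.pow_le_pow_right (by norm_num) (by omega)
  have h3 : j < 2 ^ j := Nat.lt_two_pow_self
  rw [pow_succ] at hN h2
  omega

/-- A proper subset `I` has at most `k` elements, and this is what keeps the span of the p's and the
rivals too small to contain the complement that t_J is drawn from. -/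
theorem ae_not_le_rivals (hω : ω.Nondegenerate)
    (hdim : 2 ^ (k + 1) + (k + 1) ≤ finrank 𝕜 V) (p : Fin (k + 1) → ℙ 𝕜 V)
    {I : Finset (Fin (k + 1))} (hI : I ≠ Finset.univ) (m : ℕ) :
    ∀ᵐ t ∂chainingLawUpTo ω p m, ∀ J, J ⊂ I → J.card ≤ m →
      ¬ (t J).submodule ≤ lineSpan (p '' Set.univ ∪ t '' rivals I J) := by
  classical
  have hIc : I.card ≤ k := by
    have := Finset.card_lt_univ_of_notMem (s := I)
      (Classical.choose_spec (not_forall.1 fun h => hI (Finset.eq_univ_iff_forall.2 h)))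
    simpa [Nat.lt_succ_iff] using this
  have hupd (J : Finset (Fin (k + 1))) (x : Finset (Fin (k + 1)) → ℙ 𝕜 V) (y : ℙ 𝕜 V) :
      Function.update x J y '' rivals I J = x '' rivals I J :=
    Set.image_congr fun J' hJ' => Function.update_of_ne hJ'.2.1 _ _
  have hms (J : Finset (Fin (k + 1))) := (measurableSet_family_le p J Set.univ (rivals I J)).compl
  induction m with
  | zero =>
    have : IsProbabilityMeasure (projMeasure (⊤ : Submodule 𝕜 V)) :=
      isProbabilityMeasure_projMeasure_top ((Nat.succ_pos _).trans_le (le_of_add_le_right hdim))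
    simp only [ae_all_iff]
    intro J hJ hJc
    refine ae_pi_of_ae_update _ J (hms J) fun x => ?_
    simp only [Function.update_self, hupd]
    refine ae_projMeasure_not_le fun hle => ?_
    have h1 := Submodule.finrank_mono hle
    have h2 := finrank_rivals_le p x hJ
    have h3 := rivals_count (Finset.card_lt_card hJ) hIc hdim
    have h4 := Nat.one_le_two_pow (n := J.card)
    rw [finrank_top] at h1
    omega
  | succ m ih =>
    rw [ae_chainingLawUpTo_succ hω hdim]
    · filter_upwards [ih] with t ht
      have hnew : ∀ᵐ t' ∂chainingStep ω p (m + 1) t, ∀ J, J ⊂ I → J.card = m + 1 →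
          ¬ (t' J).submodule ≤ lineSpan (p '' Set.univ ∪ t' '' rivals I J) := by
        have := isProbabilityMeasure_stepFactor hω hdim p (m + 1) t
        simp only [ae_all_iff]
        intro J hJ hJc
        rw [chainingStep_eq]
        -- Rivals of equal cardinality are sampled in the same step but independently of t_J. They
        -- are frozen in `x`.
        refine ae_pi_of_ae_update _ J (hms J) fun x => ?_
        simp only [Function.update_self, hupd]
        rw [stepFactor, if_pos hJc]
        refine ae_projMeasure_not_le fun hle => ?_
        have h1 := Submodule.finrank_mono hle
        have h2 := finrank_rivals_le p x hJ
        have h3 := rivals_count (Finset.card_lt_card hJ) hIc hdim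
        have h4 := finrank_ancestors_le p t J
        rw [finrank_orthogonalBilin hω] at h1
        omega
      filter_upwards [ae_chainingStep_eq hω hdim p (m + 1) t, hnew] with t' h1 h2 J hJ hJc
      by_cases hJm : J.card = m + 1
      · exact h2 J hJ hJm
      · have himg : t' '' rivals I J = t '' rivals I J := Set.image_congr fun J' hJ' =>
          h1 J' (by have := hJ'.2.2; omega)
        rw [himg, h1 J hJm]
        exact ht J hJ (by omega)
    · simp only [Set.ofPred_forall]
      exact MeasurableSet.iInter fun J => MeasurableSet.iInter fun _ =>
        MeasurableSet.iInter fun _ => hms J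

/-- Giving the p's rank 0 and t_J rank |J| + 1 shows that the p's and the t_J with J ⊊ I are jointly
independent. The ancestors of I belong to this family, and p_i is not among them. -/
theorem not_le_lineSpan_ancestors {p : Fin (k + 1) → ℙ 𝕜 V}
    (hp : LinearIndependent 𝕜 fun i => (p i).rep) {t : Finset (Fin (k + 1)) → ℙ 𝕜 V}
    {I : Finset (Fin (k + 1))}
    (ht : ∀ J, J ⊂ I → ¬ (t J).submodule ≤ lineSpan (p '' Set.univ ∪ t '' rivals I J))
    {i : Fin (k + 1)} (hi : i ∉ I) : ¬ (p i).submodule ≤ lineSpan (ancestors p t I) := by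
  classical
  let v : Fin (k + 1) ⊕ {J // J ⊂ I} → V :=
    Sum.elim (fun i => (p i).rep) fun J => (t J).rep
  have hv : LinearIndependent 𝕜 v := by
    refine linearIndependent_of_rank v (Sum.elim (fun _ => 0) fun J => J.1.card + 1) ?_
    rintro (j | J)
    · intro hmem
      refine hp.notMem_span_image (s := {l | l ≠ j}) (x := j) (by simp)
        (Submodule.span_mono ?_ hmem)
      rintro _ ⟨l | J', ⟨hl, hr⟩, rfl⟩
      · exact ⟨l, fun h => hl (congrArg _ h), rfl⟩
      · simp at hr
    · intro hmem
      refine ht J J.2 (submodule_le_iff.2 ?_)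
      rw [lineSpan_eq_span]
      refine Submodule.span_mono ?_ hmem
      rintro _ ⟨l | J', ⟨hl, hr⟩, rfl⟩
      · exact ⟨p l, Or.inl ⟨l, trivial, rfl⟩, rfl⟩
      · exact ⟨t J', Or.inr ⟨J', ⟨J'.2, fun h => hl (congrArg _ (Subtype.ext h)),
          by simpa using hr⟩, rfl⟩, rfl⟩
  intro hle
  rw [submodule_le_iff, lineSpan_eq_span] at hle
  refine hv.notMem_span_image (s := {x | x ≠ Sum.inl i}) (x := Sum.inl i) (by simp)
    (Submodule.span_mono ?_ hle)
  rintro _ ⟨_, ⟨l, hl, rfl⟩ | ⟨J, hJ, rfl⟩, rfl⟩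
  · exact ⟨Sum.inl l, fun h => hi (Sum.inl_injective h ▸ hl), rfl⟩
  · exact ⟨Sum.inr ⟨J, hJ⟩, by simp, rfl⟩

/-- If the complement of the ancestors of I were contained in that of p_i, taking complements again
would put p_i into the span of the ancestors. So a random point t_I of the former complement avoids
the latter. -/
theorem ae_not_perp (hω : ω.Nondegenerate) (halt : ω.IsAlt)
    (hdim : 2 ^ (k + 1) + (k + 1) ≤ finrank 𝕜 V) {p : Fin (k + 1) → ℙ 𝕜 V}
    (hp : LinearIndependent 𝕜 fun i => (p i).rep) (m : ℕ) :
    ∀ᵐ t ∂chainingLawUpTo ω p m, ∀ I, I.card ≤ m → ∀ i, i ∉ I → ¬ Perp ω (p i) (t I) := by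
  classical
  have hms (I : Finset (Fin (k + 1))) (i : Fin (k + 1)) :=
    (measurableSet_family_perp (ω := ω) p i I).compl
  induction m with
  | zero =>
    have : IsProbabilityMeasure (projMeasure (⊤ : Submodule 𝕜 V)) :=
      isProbabilityMeasure_projMeasure_top ((Nat.succ_pos _).trans_le (le_of_add_le_right hdim))
    simp only [ae_all_iff]
    intro I hI i hi
    have h : ∀ᵐ x ∂projMeasure (⊤ : Submodule 𝕜 V), ¬ Perp ω (p i) x := by
      have hle : ¬ (⊤ : Submodule 𝕜 V) ≤ (p i).submodule.orthogonalBilin ω := by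
        intro hle
        have h1 := Submodule.finrank_mono hle
        rw [finrank_top, finrank_orthogonalBilin hω, Projectivization.finrank_submodule] at h1
        have := (Nat.succ_pos k).trans_le (le_of_add_le_right hdim)
        omega
      filter_upwards [ae_projMeasure_not_le hle] with x hx hperp
      exact hx (submodule_le_orthogonalBilin_submodule_iff.2 hperp)
    exact (Measure.tendsto_eval_ae_ae
      (μ := fun _ : Finset (Fin (k + 1)) => projMeasure (⊤ : Submodule 𝕜 V))
      (i := I)).eventually h
  | succ m ih =>
    rw [ae_chainingLawUpTo_succ hω hdim]
    · have hriv : ∀ᵐ t ∂chainingLawUpTo ω p m, ∀ I : Finset (Fin (k + 1)), I ≠ Finset.univ →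
          ∀ J, J ⊂ I → J.card ≤ m →
            ¬ (t J).submodule ≤ lineSpan (p '' Set.univ ∪ t '' rivals I J) := by
        rw [ae_all_iff]
        intro I
        by_cases hI : I = Finset.univ
        · exact Filter.Eventually.of_forall fun t h => absurd hI h
        · filter_upwards [ae_not_le_rivals hω hdim p hI m] with t ht _ using ht
      filter_upwards [ih, hriv] with t ht hr
      have hnew : ∀ᵐ t' ∂chainingStep ω p (m + 1) t, ∀ I, I.card = m + 1 →
          ∀ i, i ∉ I → ¬ Perp ω (p i) (t' I) := by
        refine ae_chainingStep_forall hω hdim p t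
          (P := fun I x => ∀ i, i ∉ I → ¬ Perp ω (p i) x) fun I hI => ?_
        simp only [ae_all_iff]
        intro i hi
        have hle : ¬ (lineSpan (ancestors p t I)).orthogonalBilin ω ≤
            (p i).submodule.orthogonalBilin ω := fun hle => by
          refine not_le_lineSpan_ancestors hp (fun J hJ => hr I ?_ J hJ ?_) hi
            (le_of_orthogonalBilin_le hω halt hle)
          · rintro rfl
            exact hi (Finset.mem_univ i)
          · have := Finset.card_lt_card hJ
            omega
        filter_upwards [ae_projMeasure_not_le hle] with x hx hperp
        exact hx (submodule_le_orthogonalBilin_submodule_iff.2 hperp)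
      filter_upwards [ae_chainingStep_eq hω hdim p (m + 1) t, hnew] with t' h1 h2 I hI
      by_cases hIm : I.card = m + 1
      · exact h2 I hIm
      · rw [h1 I hIm]
        exact ht I (by omega)
    · simp only [Set.ofPred_forall]
      exact MeasurableSet.iInter fun I => MeasurableSet.iInter fun _ =>
        MeasurableSet.iInter fun i => MeasurableSet.iInter fun _ => hms I i

end Generic

end SympStiefel

namespace SympStiefel

/-! ### The random tuples lie in the Stiefel variety. -/

section Tuples

variable {𝕜 V : Type*} [RCLike 𝕜] [NormedAddCommGroup V] [InnerProductSpace 𝕜 V]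
variable {k : ℕ} {ω : V →ₗ[𝕜] V →ₗ[𝕜] 𝕜} [FiniteDimensional 𝕜 V]

theorem mem_stiefel_iff {y : Fin (k + 1) → ℙ 𝕜 V} :
    y ∈ stiefel ω k ↔ (∀ i j, Perp ω (y i) (y j)) ∧ LinearIndependent 𝕜 fun i => (y i).rep := by
  refine and_congr ?_ ?_
  · rw [lineSpan_le]
    simp only [submodule_le_orthogonalBilin_iff, Set.forall_mem_range]
    exact forall_comm
  · rw [linearIndependent_iff_card_eq_finrank_span, Set.finrank, ← lineSpan_range,
      Fintype.card_fin]
    exact eq_comm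

theorem DescChain.card_lt {n : ℕ} (C : DescChain k n) {a b : Fin (n + 1)} (h : a < b) :
    (C.1 b).card < (C.1 a).card := by
  have h1 := C.2.2 a
  have h2 := C.2.2 b
  rw [Fin.lt_def] at h
  omega

theorem DescChain.ssubset {n : ℕ} (C : DescChain k n) {a b : Fin (n + 1)} (h : a < b) :
    C.1 b ⊂ C.1 a :=
  ⟨C.2.1 h.le, fun h' => absurd (Finset.card_le_card h') (not_le.2 (C.card_lt h))⟩

/-- The points following `t_{C_m}` in the tuple of a descending chain. -/
def followers {n : ℕ} (C : DescChain k n) (p : Fin (k + 1) → ℙ 𝕜 V)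
    (t : Finset (Fin (k + 1)) → ℙ 𝕜 V) (m : Fin (n + 1)) : Set (ℙ 𝕜 V) :=
  p '' (C.1 (Fin.last n) : Set (Fin (k + 1))) ∪ t '' (C.1 '' {j | m < j})

/-- The coefficients of the t's are eliminated starting with the smallest subset. Let `e` be the
element removed between C_l and C_{l+1}. Pairing with p_e annihilates w, the p's and every t_{C_j}
with m < j ≤ l, but not t_{C_{l+1}}, whose coefficient therefore vanishes. -/
theorem mem_lineSpan_of_perp {n : ℕ} (C : DescChain k n) {p : Fin (k + 1) → ℙ 𝕜 V}
    (hp : ∀ i j, Perp ω (p i) (p j)) {t : Finset (Fin (k + 1)) → ℙ 𝕜 V} {m : Fin (n + 1)}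
    (hperp : ∀ J, J ⊂ C.1 m → ∀ y ∈ ancestors p t J, Perp ω y (t J))
    (hnot : ∀ J, J ⊂ C.1 m → ∀ i, i ∉ J → ¬ Perp ω (p i) (t J))
    {w : V} (hw : ∀ i ∈ C.1 m, ω (p i).rep w = 0) (l : ℕ)
    (hmem : w ∈ lineSpan (p '' (C.1 (Fin.last n) : Set (Fin (k + 1))) ∪
      t '' (C.1 '' {j | m < j ∧ (j : ℕ) ≤ l}))) :
    w ∈ lineSpan (p '' (C.1 (Fin.last n) : Set (Fin (k + 1)))) := by
  induction l with
  | zero =>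
    have : {j | m < j ∧ (j : ℕ) ≤ 0} = ∅ := by
      ext j
      simp only [Set.mem_ofPred_eq, Set.mem_empty_iff_false, iff_false, not_and, Fin.lt_def]
      omega
    rwa [this, Set.image_empty, Set.image_empty, Set.union_empty] at hmem
  | succ l ih =>
    apply ih
    by_cases hl : l + 1 ≤ n ∧ (m : ℕ) ≤ l
    · let a : Fin (n + 1) := ⟨l, by omega⟩
      let b : Fin (n + 1) := ⟨l + 1, by omega⟩
      have hab : a < b := by
        rw [Fin.lt_def]
        exact Nat.lt_succ_self l
      have hma : m ≤ a := hl.2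
      obtain ⟨e, hea, heb⟩ := Set.not_subset.1 (C.ssubset hab).2
      have hem : e ∈ C.1 m := C.2.1 hma hea
      have hle : lineSpan (p '' (C.1 (Fin.last n) : Set (Fin (k + 1))) ∪
          t '' (C.1 '' {j | m < j ∧ (j : ℕ) ≤ l + 1})) ≤
          lineSpan (p '' (C.1 (Fin.last n) : Set (Fin (k + 1))) ∪
            t '' (C.1 '' {j | m < j ∧ (j : ℕ) ≤ l})) ⊔ (t (C.1 b)).submodule := by
        refine lineSpan_le.2 ?_
        rintro x (hx | ⟨_, ⟨j, hj, rfl⟩, rfl⟩)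
        · exact le_sup_of_le_left (submodule_le_lineSpan (Or.inl hx))
        · by_cases hjb : j = b
          · exact hjb ▸ le_sup_right
          · refine le_sup_of_le_left (submodule_le_lineSpan (Or.inr ⟨_, ⟨j, ⟨hj.1, ?_⟩, rfl⟩, rfl⟩))
            have h1 := hj.2
            have h2 : (j : ℕ) ≠ l + 1 := fun h => hjb (Fin.ext h)
            omega
      obtain ⟨u, hu, v, hv, rfl⟩ := Submodule.mem_sup.1 (hle hmem)
      have hu0 : ω (p e).rep u = 0 := by
        have : lineSpan (p '' (C.1 (Fin.last n) : Set (Fin (k + 1))) ∪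
            t '' (C.1 '' {j | m < j ∧ (j : ℕ) ≤ l})) ≤ LinearMap.ker (ω (p e).rep) := by
          refine lineSpan_le.2 ?_
          rintro x (⟨i, hi, rfl⟩ | ⟨_, ⟨j, hj, rfl⟩, rfl⟩)
          · exact submodule_le_iff.2 (hp e i)
          · refine submodule_le_iff.2 (hperp _ (C.ssubset hj.1) _ (Or.inl ⟨e, ?_, rfl⟩))
            exact C.2.1 (show j ≤ a from hj.2) hea
        exact this hu
      have hv0 : ω (p e).rep v = 0 := by
        have := hw e hem
        rwa [map_add, hu0, zero_add] at this
      rw [Projectivization.submodule_eq] at hv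
      obtain ⟨c, rfl⟩ := Submodule.mem_span_singleton.1 hv
      rw [map_smul, smul_eq_mul, mul_eq_zero] at hv0
      have hmb : m < b := lt_of_le_of_lt hma hab
      rcases hv0 with rfl | h0
      · simpa using hu
      · exact absurd h0 (hnot _ (C.ssubset hmb) e heb)
    · have : {j : Fin (n + 1) | m < j ∧ (j : ℕ) ≤ l + 1} = {j | m < j ∧ (j : ℕ) ≤ l} := by
        ext j
        simp only [Set.mem_ofPred_eq, Fin.lt_def]
        have := j.2
        omega
      rwa [this] at hmem

/-- After the elimination w is a combination of the p_i with i in the last set. The ancestor t_{C_m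
∖ {i}} of t_{C_m} is perpendicular to w and to the other p_j but not to p_i, which kills the
coefficient of p_i. -/
theorem eq_zero_of_mem_followers {n : ℕ} (C : DescChain k n) {p : Fin (k + 1) → ℙ 𝕜 V}
    (halt : ω.IsAlt)
    (hp : ∀ i j, Perp ω (p i) (p j)) {t : Finset (Fin (k + 1)) → ℙ 𝕜 V} {m : Fin (n + 1)}
    (hperp : ∀ J, J ⊂ C.1 m → ∀ y ∈ ancestors p t J, Perp ω y (t J))
    (hnot : ∀ J, J ⊂ C.1 m → ∀ i, i ∉ J → ¬ Perp ω (p i) (t J))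
    {w : V} (hw : ∀ y ∈ ancestors p t (C.1 m), ω y.rep w = 0)
    (hmem : w ∈ lineSpan (followers C p t m)) : w = 0 := by
  classical
  have h1 : w ∈ lineSpan (p '' (C.1 (Fin.last n) : Set (Fin (k + 1)))) := by
    refine mem_lineSpan_of_perp C hp hperp hnot (fun i hi => hw _ (Or.inl ⟨i, hi, rfl⟩)) n ?_
    have : {j : Fin (n + 1) | m < j ∧ (j : ℕ) ≤ n} = {j | m < j} := by
      ext j
      have := j.2
      simp only [Set.mem_ofPred_eq, and_iff_left_iff_imp]
      omega
    rwa [this]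
  rw [lineSpan_eq_span, Set.image_image, Submodule.mem_span_image_finset_iff_exists_fun'] at h1
  obtain ⟨a, rfl⟩ := h1
  refine Finset.sum_eq_zero fun i hi => ?_
  have him : i ∈ C.1 m := C.2.1 (Fin.le_last m) hi
  have hss : (C.1 m).erase i ⊂ C.1 m := Finset.erase_ssubset him
  have h2 := hw _ (Or.inr ⟨(C.1 m).erase i, hss, rfl⟩)
  rw [map_sum, Finset.sum_eq_single i] at h2
  · rw [map_smul, smul_eq_mul, mul_eq_zero] at h2
    rcases h2 with h | h
    · rw [h, zero_smul]
    · exact absurd (Perp.symm halt h) (hnot _ hss i (Finset.notMem_erase i _))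
  · intro j hj hji
    rw [map_smul, smul_eq_mul]
    have : Perp ω (t ((C.1 m).erase i)) (p j) := Perp.symm halt (hperp _ hss _ (Or.inl
      ⟨j, Finset.mem_erase.2 ⟨hji, C.2.1 (Fin.le_last m) hj⟩, rfl⟩))
    rw [show ω (t ((C.1 m).erase i)).rep (p j).rep = 0 from this, mul_zero]
  · exact fun h => absurd hi h

variable [MeasurableSpace V] [BorelSpace V]

/-- The complement of the ancestors is nonzero and meets the span of the followers only in 0. It is
therefore not contained in this span, and its random point t_{C_m} avoids the span. -/
theorem ae_not_le_followers (hω : ω.Nondegenerate) (halt : ω.IsAlt)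
    (hdim : 2 ^ (k + 1) + (k + 1) ≤ finrank 𝕜 V) {p : Fin (k + 1) → ℙ 𝕜 V}
    (hp : p ∈ stiefel ω k) {n : ℕ} (C : DescChain k n) (m : Fin (n + 1)) :
    ∀ᵐ t ∂chainingLaw ω p, ¬ (t (C.1 m)).submodule ≤ lineSpan (followers C p t m) := by
  obtain ⟨hiso, hli⟩ := mem_stiefel_iff.1 hp
  have hms : MeasurableSet {t : Finset (Fin (k + 1)) → ℙ 𝕜 V |
      ¬ (t (C.1 m)).submodule ≤ lineSpan (followers C p t m)} :=
    (measurableSet_family_le p (C.1 m) _ _).compl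
  have hfol {t t' : Finset (Fin (k + 1)) → ℙ 𝕜 V}
      (h : ∀ J, J.card < (C.1 m).card → t' J = t J) : followers C p t' m = followers C p t m := by
    rw [followers, followers]
    congr 1
    refine Set.image_congr ?_
    rintro _ ⟨j, hj, rfl⟩
    exact h _ (C.card_lt hj)
  -- Only points t_J with |J| ≤ |C_m| occur, so the claim may be checked right after t_{C_m} has
  -- been sampled.
  refine ae_chainingLawUpTo_mono hω hdim p (card_finset_fin_le (C.1 m)) hms ?_ ?_
  · intro t t' h
    rw [hfol fun J hJ => h J hJ.le, h _ le_rfl]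
    exact id
  · obtain ⟨c, hc⟩ : ∃ c, (C.1 m).card = c := ⟨_, rfl⟩
    rw [hc]
    cases c with
    | zero =>
      have : IsProbabilityMeasure (projMeasure (⊤ : Submodule 𝕜 V)) :=
        isProbabilityMeasure_projMeasure_top ((Nat.succ_pos _).trans_le (le_of_add_le_right hdim))
      -- If C_m = ∅ the chain ends there and nothing follows t_∅.
      have hfe (t : Finset (Fin (k + 1)) → ℙ 𝕜 V) : followers C p t m = ∅ := by
        have h1 : C.1 (Fin.last n) = ∅ :=
          Finset.subset_empty.1 ((C.2.1 (Fin.le_last m)).trans (Finset.card_eq_zero.1 hc).le)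
        have h2 : {j | m < j} = ∅ := by
          ext j
          simp only [Set.mem_ofPred_eq, Set.mem_empty_iff_false, iff_false]
          intro hj
          have := C.card_lt hj
          omega
        simp [followers, h1, h2]
      have h : ∀ᵐ x ∂projMeasure (⊤ : Submodule 𝕜 V),
          ¬ x.submodule ≤ lineSpan (∅ : Set (ℙ 𝕜 V)) := by
        refine ae_projMeasure_not_le fun hle => ?_
        have h1 := Submodule.finrank_mono hle
        rw [finrank_top, show lineSpan (∅ : Set (ℙ 𝕜 V)) = ⊥ by simp [lineSpan],
          finrank_bot] at h1
        have := (Nat.succ_pos k).trans_le (le_of_add_le_right hdim)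
        omega
      have h' : ∀ᵐ t ∂chainingLawUpTo ω p 0,
          ¬ (t (C.1 m)).submodule ≤ lineSpan (∅ : Set (ℙ 𝕜 V)) :=
        (Measure.tendsto_eval_ae_ae
          (μ := fun _ : Finset (Fin (k + 1)) => projMeasure (⊤ : Submodule 𝕜 V))
          (i := C.1 m)).eventually h
      filter_upwards [h'] with t ht
      rwa [hfe]
    | succ c =>
      rw [ae_chainingLawUpTo_succ hω hdim p c hms]
      filter_upwards [ae_ancestors_perp hω hdim p c, ae_not_perp hω halt hdim hli c] with t h1 h2
      have hcard {J : Finset (Fin (k + 1))} (hJ : J ⊂ C.1 m) : J.card ≤ c := by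
        have := Finset.card_lt_card hJ
        omega
      have hnew : ∀ᵐ x ∂perpMeasure ω (ancestors p t (C.1 m)),
          ¬ x.submodule ≤ lineSpan (followers C p t m) := by
        refine ae_projMeasure_not_le fun hle => ?_
        refine orthogonalBilin_ne_bot hω (finrank_ancestors_lt hdim p t (C.1 m)) ?_
        rw [eq_bot_iff]
        intro w hw
        refine eq_zero_of_mem_followers C halt hiso (fun J hJ => h1 J (hcard hJ))
          (fun J hJ => h2 J (hcard hJ)) (fun y hy => ?_) (hle hw)
        exact hw _ (submodule_le_iff.1 (submodule_le_lineSpan hy))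
      filter_upwards [ae_chainingStep_eq hω hdim p (c + 1) t,
        ae_chainingStep_of_ae hω hdim p t hc hnew] with t' h3 h4
      rwa [hfol fun J hJ => h3 J (by omega)]

/-- Almost surely, the tuples of all descending chains belong to the Stiefel variety. -/
theorem ae_tuple_mem_stiefel (hω : ω.Nondegenerate) (halt : ω.IsAlt)
    (hdim : 2 ^ (k + 1) + (k + 1) ≤ finrank 𝕜 V) {p : Fin (k + 1) → ℙ 𝕜 V}
    (hp : p ∈ stiefel ω k) {n : ℕ} (C : DescChain k n) :
    ∀ᵐ t ∂chainingLaw ω p, C.tuple p t ∈ stiefel ω (k + 1) := by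
  obtain ⟨hiso, hli⟩ := mem_stiefel_iff.1 hp
  filter_upwards [ae_all_iff.2 (ae_not_le_followers hω halt hdim hp C),
    ae_ancestors_perp hω hdim p (k + 1)] with t hfol hanc
  have hanc' (J : Finset (Fin (k + 1))) := hanc J (card_finset_fin_le J)
  have hself (x : ℙ 𝕜 V) : Perp ω x x := halt x.rep
  have hcase (j : Fin (k + 2)) : (∃ a : Fin (n + 1), (a : ℕ) = j ∧ C.tuple p t j = t (C.1 a)) ∨
      (n < (j : ℕ) ∧ ∃ i ∈ C.1 (Fin.last n), C.tuple p t j = p i) := by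
    by_cases hj : (j : ℕ) ≤ n
    · exact Or.inl ⟨⟨j, Nat.lt_succ_of_le hj⟩, rfl, by rw [DescChain.tuple, dif_pos hj]⟩
    · exact Or.inr ⟨not_le.1 hj, _, Finset.orderEmbOfFin_mem _ _ _, by
        rw [DescChain.tuple, dif_neg hj]⟩
  refine mem_stiefel_iff.2 ⟨fun i j => ?_, ?_⟩
  · have htt {a b : Fin (n + 1)} (hab : a < b) : Perp ω (t (C.1 b)) (t (C.1 a)) :=
      hanc' _ _ (Or.inr ⟨_, C.ssubset hab, rfl⟩)
    have hpt (a : Fin (n + 1)) {i : Fin (k + 1)} (hi : i ∈ C.1 (Fin.last n)) :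
        Perp ω (p i) (t (C.1 a)) :=
      hanc' _ _ (Or.inl ⟨i, C.2.1 (Fin.le_last a) hi, rfl⟩)
    rcases hcase i with ⟨a, -, ha⟩ | ⟨-, i', hi', hi⟩ <;>
      rcases hcase j with ⟨b, -, hb⟩ | ⟨-, j', hj', hj⟩
    · rw [ha, hb]
      rcases lt_trichotomy a b with hab | rfl | hab
      · exact (htt hab).symm halt
      · exact hself _
      · exact htt hab
    · rw [ha, hj]
      exact (hpt a hj').symm halt
    · rw [hi, hb]
      exact hpt b hi'
    · rw [hi, hj]
      exact hiso _ _
  -- The rank decreases along the tuple, so each entry only has to avoid the span of the later ones.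
  · refine linearIndependent_of_rank _ (fun j => k + 1 - (j : ℕ)) fun i hmem => ?_
    have hlater {j : Fin (k + 2)} (hj : j ∈ {j : Fin (k + 2) | j ≠ i ∧
        k + 1 - (j : ℕ) ≤ k + 1 - (i : ℕ)}) : (i : ℕ) < j := by
      have h1 := hj.2
      have h2 := j.2
      have h3 := i.2
      have h4 : (j : ℕ) ≠ i := fun h => hj.1 (Fin.ext h)
      omega
    by_cases hi : (i : ℕ) ≤ n
    · have htup : C.tuple p t i = t (C.1 ⟨i, Nat.lt_succ_of_le hi⟩) := by
        rw [DescChain.tuple, dif_pos hi]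
      refine hfol ⟨i, Nat.lt_succ_of_le hi⟩ (submodule_le_iff.2 ?_)
      rw [← htup, lineSpan_eq_span]
      refine Submodule.span_mono ?_ hmem
      rintro _ ⟨j, hj, rfl⟩
      refine ⟨C.tuple p t j, ?_, rfl⟩
      rcases hcase j with ⟨b, hb, htb⟩ | ⟨-, j', hj', htb⟩
      · refine htb ▸ Or.inr ⟨_, ⟨b, ?_, rfl⟩, rfl⟩
        rw [Set.mem_ofPred_eq, Fin.lt_def, hb]
        exact hlater hj
      · exact htb ▸ Or.inl ⟨j', hj', rfl⟩
    · have hform (j : Fin (k + 2)) (hj : ¬ (j : ℕ) ≤ n) : ∃ x : Fin (C.1 (Fin.last n)).card,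
          (x : ℕ) = j - (n + 1) ∧
          C.tuple p t j = p ((C.1 (Fin.last n)).orderEmbOfFin rfl x) := by
        refine ⟨⟨j - (n + 1), ?_⟩, rfl, by rw [DescChain.tuple, dif_neg hj]⟩
      obtain ⟨x, hx, htx⟩ := hform i hi
      refine hli.notMem_span_image (s := {l | l ≠ (C.1 (Fin.last n)).orderEmbOfFin rfl x})
        (x := (C.1 (Fin.last n)).orderEmbOfFin rfl x) (by simp) ?_
      rw [htx] at hmem
      refine Submodule.span_mono ?_ hmem
      rintro _ ⟨j, hj, rfl⟩
      have hij := hlater hj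
      obtain ⟨z, hz, htz⟩ := hform j (by omega)
      refine ⟨(C.1 (Fin.last n)).orderEmbOfFin rfl z, fun h => ?_, by simp only [htz]⟩
      have := congrArg Fin.val ((Finset.orderEmbOfFin _ rfl).injective h)
      omega

end Tuples

end SympStiefel

namespace SympStiefel

/-! ### Witt's theorem for isotropic frames. -/

section Witt

variable {𝕜 V : Type*} [RCLike 𝕜] [NormedAddCommGroup V] [InnerProductSpace 𝕜 V]
variable {ω : V →ₗ[𝕜] V →ₗ[𝕜] 𝕜} [FiniteDimensional 𝕜 V]

/-- The span U of the frame is smaller than its complement, so some x in the complement lies outside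
U. Since ω is alternating, x is also perpendicular to itself. -/
theorem exists_isotropic_snoc (hω : ω.Nondegenerate) (halt : ω.IsAlt) {n : ℕ}
    (hn : 2 * n + 2 ≤ finrank 𝕜 V) {v : Fin n → V} (hv : LinearIndependent 𝕜 v)
    (hiso : ∀ i j, ω (v i) (v j) = 0) :
    ∃ x, LinearIndependent 𝕜 (Fin.snoc v x : Fin (n + 1) → V) ∧
      ∀ i j, ω ((Fin.snoc v x : Fin (n + 1) → V) i) ((Fin.snoc v x : Fin (n + 1) → V) j) = 0 := by
  have hdim : finrank 𝕜 (Submodule.span 𝕜 (Set.range v)) = n := by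
    rw [finrank_span_eq_card hv, Fintype.card_fin]
  have hnot : ¬ (Submodule.span 𝕜 (Set.range v)).orthogonalBilin ω ≤
      Submodule.span 𝕜 (Set.range v) := by
    intro hle
    have h1 := Submodule.finrank_mono hle
    rw [finrank_orthogonalBilin hω, hdim] at h1
    omega
  obtain ⟨x, hx, hxv⟩ := Set.not_subset.1 hnot
  have hvx (i : Fin n) : ω (v i) x = 0 := hx _ (Submodule.subset_span ⟨i, rfl⟩)
  refine ⟨x, linearIndependent_finSnoc.2 ⟨hv, hxv⟩, fun i j => ?_⟩
  induction i using Fin.lastCases with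
  | last =>
    induction j using Fin.lastCases with
    | last => simpa using halt x
    | cast j => simpa using halt.isRefl _ _ (hvx j)
  | cast i =>
    induction j using Fin.lastCases with
    | last => simpa using hvx i
    | cast j => simpa using hiso i j

theorem exists_isotropic_extension (hω : ω.Nondegenerate) (halt : ω.IsAlt) {n m : ℕ} (hnm : n ≤ m)
    (hm : 2 * m ≤ finrank 𝕜 V) {v : Fin n → V} (hv : LinearIndependent 𝕜 v)
    (hiso : ∀ i j, ω (v i) (v j) = 0) :
    ∃ u : Fin m → V, LinearIndependent 𝕜 u ∧ (∀ i j, ω (u i) (u j) = 0) ∧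
      ∀ i, u (Fin.castLE hnm i) = v i := by
  induction m, hnm using Nat.le_induction with
  | base => exact ⟨v, hv, hiso, fun i => rfl⟩
  | succ m h ih =>
    obtain ⟨u, hu, hui, huv⟩ := ih (by omega)
    obtain ⟨x, hx, hxi⟩ := exists_isotropic_snoc hω halt (by omega) hu hui
    refine ⟨_, hx, hxi, fun i => ?_⟩
    rw [← huv i]
    exact Fin.snoc_castSucc (α := fun _ => V) x u (Fin.castLE h i)

/-- As v_j is not in the span of the other vectors, double complements give a vector perpendicular
to those but not to v_j. -/
theorem exists_dual_family (hω : ω.Nondegenerate) (halt : ω.IsAlt) {n : ℕ} {v : Fin n → V}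
    (hv : LinearIndependent 𝕜 v) :
    ∃ w : Fin n → V, ∀ i j, ω (v i) (w j) = if i = j then 1 else 0 := by
  have h (j : Fin n) : ∃ x, ∀ i, ω (v i) x = if i = j then 1 else 0 := by
    have hnot : ¬ (Submodule.span 𝕜 (v '' {i | i ≠ j})).orthogonalBilin ω ≤
        (Submodule.span 𝕜 {v j}).orthogonalBilin ω := fun hle =>
      hv.notMem_span_image (s := {i | i ≠ j}) (x := j) (by simp)
        (le_of_orthogonalBilin_le hω halt hle (Submodule.mem_span_singleton_self _))
    obtain ⟨x, hx, hxj⟩ := Set.not_subset.1 hnot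
    have hne : ω (v j) x ≠ 0 := by
      intro h0
      refine hxj fun y hy => ?_
      obtain ⟨c, rfl⟩ := Submodule.mem_span_singleton.1 hy
      simp [h0]
    refine ⟨(ω (v j) x)⁻¹ • x, fun i => ?_⟩
    split_ifs with hij
    · subst hij
      simp [hne]
    · have : ω (v i) x = 0 := hx _ (Submodule.subset_span ⟨i, hij, rfl⟩)
      simp [this]
  choose w hw using h
  exact ⟨w, fun i j => hw j i⟩

theorem exists_isotropic_dual_family (hω : ω.Nondegenerate) (halt : ω.IsAlt) {n : ℕ}
    {v : Fin n → V} (hv : LinearIndependent 𝕜 v) (hiso : ∀ i j, ω (v i) (v j) = 0) :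
    ∃ w : Fin n → V, (∀ i j, ω (v i) (w j) = if i = j then 1 else 0) ∧
      ∀ i j, ω (w i) (w j) = 0 := by
  obtain ⟨w, hw⟩ := exists_dual_family hω halt hv
  have hw' (i j : Fin n) : ω (w i) (v j) = if i = j then -1 else 0 := by
    rw [← halt.neg, hw]
    simp only [eq_comm (a := j)]
    split_ifs <;> simp
  -- The v's are isotropic, so adding them to the w's does not change the duality; half of the Gram
  -- matrix of w is the correction that makes the new family isotropic.
  refine ⟨fun j => w j + ∑ l, (ω (w l) (w j) / 2) • v l, fun i j => ?_, fun i j => ?_⟩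
  · simp [hw, hiso]
  · have := halt.neg (w i) (w j)
    simp only [map_add, map_sum, map_smul, LinearMap.add_apply, LinearMap.sum_apply,
      LinearMap.smul_apply, hw, hw', hiso, smul_eq_mul, mul_ite, mul_zero, mul_one, mul_neg,
      Finset.sum_ite_eq, Finset.sum_ite_eq', Finset.mem_univ, if_true, Finset.sum_const_zero,
      add_zero]
    linear_combination (-1 / 2) * this

theorem linearIndependent_symplectic {n : ℕ} {v w : Fin n → V}
    (hvv : ∀ i j, ω (v i) (v j) = 0) (hvw : ∀ i j, ω (v i) (w j) = if i = j then 1 else 0)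
    (hww : ∀ i j, ω (w i) (w j) = 0) (halt : ω.IsAlt) :
    LinearIndependent 𝕜 (Sum.elim v w) := by
  have hwv (i j : Fin n) : ω (w i) (v j) = if i = j then -1 else 0 := by
    rw [← halt.neg, hvw]
    simp only [eq_comm (a := j)]
    split_ifs <;> simp
  rw [Fintype.linearIndependent_iff]
  intro g hg
  simp only [Fintype.sum_sum_type, Sum.elim_inl, Sum.elim_inr] at hg
  rintro (i | i)
  · have := congrArg (ω (w i)) hg
    simpa [hwv, hww] using this
  · have := congrArg (ω (v i)) hg
    simpa [hvw, hvv] using this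

/-- Witt's theorem for isotropic frames. -/
theorem exists_isometry_of_isotropic (hω : ω.Nondegenerate) (halt : ω.IsAlt) {r : ℕ}
    (hr : finrank 𝕜 V = 2 * r) {n : ℕ} (hn : n ≤ r) {v v' : Fin n → V}
    (hv : LinearIndependent 𝕜 v) (hiso : ∀ i j, ω (v i) (v j) = 0)
    (hv' : LinearIndependent 𝕜 v') (hiso' : ∀ i j, ω (v' i) (v' j) = 0) :
    ∃ g : V ≃ₗ[𝕜] V, (∀ x y, ω (g x) (g y) = ω x y) ∧ ∀ i, g (v i) = v' i := by
  -- Both frames are completed to Lagrangian frames and then, by isotropic dual frames, to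
  -- symplectic bases. The map matching the two bases is an isometry.
  obtain ⟨u, hu, huu, huv⟩ := exists_isotropic_extension hω halt hn hr.ge hv hiso
  obtain ⟨u', hu', huu', huv'⟩ := exists_isotropic_extension hω halt hn hr.ge hv' hiso'
  obtain ⟨w, huw, hww⟩ := exists_isotropic_dual_family hω halt hu huu
  obtain ⟨w', huw', hww'⟩ := exists_isotropic_dual_family hω halt hu' huu'
  have hcard : Fintype.card (Fin r ⊕ Fin r) = finrank 𝕜 V := by
    rw [hr, Fintype.card_sum, Fintype.card_fin, two_mul]
  let b := basisOfLinearIndependentOfCardEqFinrank' _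
    (linearIndependent_symplectic huu huw hww halt) hcard
  let b' := basisOfLinearIndependentOfCardEqFinrank' _
    (linearIndependent_symplectic huu' huw' hww' halt) hcard
  have hb : ⇑b = Sum.elim u w := coe_basisOfLinearIndependentOfCardEqFinrank' _ _ _
  have hb' : ⇑b' = Sum.elim u' w' := coe_basisOfLinearIndependentOfCardEqFinrank' _ _ _
  have hg (i : Fin r ⊕ Fin r) : b.equiv b' (Equiv.refl _) (b i) = b' i := by simp
  refine ⟨b.equiv b' (Equiv.refl _), fun x y => ?_, fun i => ?_⟩
  · have : ω.compl₁₂ (b.equiv b' (Equiv.refl _)).toLinearMap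
        (b.equiv b' (Equiv.refl _)).toLinearMap = ω := by
      refine LinearMap.ext_basis b b fun i j => ?_
      rw [LinearMap.compl₁₂_apply, LinearEquiv.coe_coe, hg, hg, hb, hb']
      have hwu (i j : Fin r) : ω (w i) (u j) = ω (w' i) (u' j) := by
        rw [← halt.neg, ← halt.neg (u' j), huw, huw']
      rcases i with i | i <;> rcases j with j | j <;>
        simp only [Sum.elim_inl, Sum.elim_inr, huu, huu', huw, huw', hww, hww', hwu]
    exact LinearMap.congr_fun₂ this x y
  · have h := hg (Sum.inl (Fin.castLE hn i))
    simp only [hb, hb', Sum.elim_inl, huv, huv'] at h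
    exact h

end Witt

end SympStiefel

namespace SympStiefel

/-! ### Quasi-invariant measures -/

section QuasiInvariant

variable (G : Type*) {X Y : Type*} [Group G] [MeasurableSpace X] [MeasurableSpace Y]
  [MulAction G X] [MulAction G Y]

/-- The null sets of the measure are preserved by the group. -/
def QuasiInvariant (m : Measure X) : Prop :=
  ∀ (g : G) (P : X → Prop), MeasurableSet {x | P x} → (∀ᵐ x ∂m, P x) → ∀ᵐ x ∂m, P (g • x)

/-- The push-forward of `κ y` under `g` is absolutely continuous with respect to `κ (g • y)`. -/
def QuasiEquivariant (κ : Y → Measure X) : Prop :=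
  ∀ (g : G) (y : Y) (P : X → Prop), MeasurableSet {x | P x} → (∀ᵐ x ∂κ (g • y), P x) →
    ∀ᵐ x ∂κ y, P (g • x)

variable {G}

theorem QuasiInvariant.map [MeasurableConstSMul G Y] {m : Measure X} (hm : QuasiInvariant G m)
    {f : X → Y} (hf : Measurable f) (hfG : ∀ (g : G) x, f (g • x) = g • f x) :
    QuasiInvariant G (m.map f) := by
  intro g P hP h
  have h1 := (hm g (fun x => P (f x)) (hf hP)) ((ae_map_iff hf.aemeasurable hP).1 h)
  simp only [hfG] at h1
  exact (ae_map_iff hf.aemeasurable (measurable_const_smul g hP)).2 h1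

theorem QuasiInvariant.compProd [MeasurableConstSMul G X] [MeasurableConstSMul G Y]
    {m : Measure Y} (hm : QuasiInvariant G m) [SFinite m]
    (κ : ProbabilityTheory.Kernel Y X) [ProbabilityTheory.IsSFiniteKernel κ]
    (hκ : QuasiEquivariant G κ) :
    QuasiInvariant G (m.compProd κ) := by
  intro g P hP h
  rw [Measure.ae_compProd_iff hP] at h
  have hg : Measurable fun z : Y × X => g • z :=
    (measurable_fst.const_smul g).prodMk (measurable_snd.const_smul g)
  refine (Measure.ae_compProd_iff (p := fun z => P (g • z)) (hg hP)).2 ?_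
  have hmeas : MeasurableSet {y | ∀ᵐ x ∂κ y, P (y, x)} :=
    ProbabilityTheory.Kernel.measurable_kernel_prodMk_left hP.compl (measurableSet_singleton 0)
  filter_upwards [hm g _ hmeas h] with y hy
  exact hκ g y (fun x => P (g • y, x)) (measurable_prodMk_left hP) hy

variable [TopologicalSpace G] [IsTopologicalGroup G] [LocallyCompactSpace G]
  [SecondCountableTopology G] [MeasurableSpace G] [BorelSpace G]

/-- Let N be m₂-null. By Fubini some x₀ in S satisfies g x₀ ∉ N for Haar-almost every g; since right
translations preserve Haar null sets and S is contained in the orbit of x₀, the same holds for every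
x in S. Fubini for m₁ gives one g with g x ∉ N for m₁-almost every x, and quasi-invariance under g⁻¹
removes g. -/
theorem QuasiInvariant.absolutelyContinuous {m₁ m₂ : Measure X} [SFinite m₁] [SFinite m₂]
    (h₁ : QuasiInvariant G m₁) (h₂ : QuasiInvariant G m₂) (hne : m₂ ≠ 0)
    (hact : Measurable fun z : G × X => z.1 • z.2) {S : Set X} (hS₁ : ∀ᵐ x ∂m₁, x ∈ S)
    (hS₂ : ∀ᵐ x ∂m₂, x ∈ S) (hS : ∀ x ∈ S, ∀ y ∈ S, ∃ g : G, g • x = y) : m₁ ≪ m₂ := by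
  let η : Measure G := Measure.haar
  refine Measure.AbsolutelyContinuous.mk fun N hN hN0 => ?_
  have hNae : ∀ᵐ x ∂m₂, x ∉ N := measure_eq_zero_iff_ae_notMem.1 hN0
  have hmeas : MeasurableSet {z : G × X | z.1 • z.2 ∉ N} := hact hN.compl
  have hA : ∀ᵐ g ∂η, ∀ᵐ x ∂m₂, g • x ∉ N :=
    Filter.Eventually.of_forall fun g => h₂ g (· ∉ N) hN.compl hNae
  have hB : ∀ᵐ x ∂m₂, ∀ᵐ g ∂η, g • x ∉ N :=
    (Measure.ae_ae_comm (p := fun (g : G) (x : X) => g • x ∉ N) hmeas).1 hA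
  have : (ae m₂).NeBot := ae_neBot.2 hne
  obtain ⟨x₀, hx₀, hx₀S⟩ := (hB.and hS₂).exists
  have hC (x : X) (hx : x ∈ S) : ∀ᵐ g ∂η, g • x ∉ N := by
    obtain ⟨a, rfl⟩ := hS x₀ hx₀S x hx
    filter_upwards [(quasiMeasurePreserving_mul_right η a).ae hx₀] with g hg
    rwa [← mul_smul]
  have hD : ∀ᵐ g ∂η, ∀ᵐ x ∂m₁, g • x ∉ N :=
    (Measure.ae_ae_comm (p := fun (g : G) (x : X) => g • x ∉ N) hmeas).2 (hS₁.mono hC)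
  obtain ⟨g, hg⟩ := hD.exists
  have hE := h₁ g⁻¹ (fun x => g • x ∉ N)
    ((hact.comp measurable_prodMk_left) hN.compl) hg
  simp only [smul_inv_smul] at hE
  exact measure_eq_zero_iff_ae_notMem.2 hE

end QuasiInvariant

/-! ### The symplectic group -/

section SymplecticGroup

variable {𝕜 V : Type*} [RCLike 𝕜] [NormedAddCommGroup V] [InnerProductSpace 𝕜 V]

/-- The group of continuous linear automorphisms preserving `ω`. -/
def isometrySubgroup (ω : V →ₗ[𝕜] V →ₗ[𝕜] 𝕜) : Subgroup (V →L[𝕜] V)ˣ where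
  carrier := {g | ∀ x y, ω (g.1 x) (g.1 y) = ω x y}
  one_mem' _ _ := rfl
  mul_mem' {a b} ha hb x y := (ha _ _).trans (hb x y)
  inv_mem' {a} ha x y := by
    have h (z : V) : a.1 ((a⁻¹).1 z) = z := by
      rw [← mul_apply_eq_comp, Units.mul_inv, one_apply_eq_self]
    rw [← ha, h, h]

/-- The symplectic group of `ω`. -/
def SymplecticGroup (ω : V →ₗ[𝕜] V →ₗ[𝕜] 𝕜) : Type _ := isometrySubgroup ω

variable (ω : V →ₗ[𝕜] V →ₗ[𝕜] 𝕜)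

instance : Group (SymplecticGroup ω) := inferInstanceAs (Group (isometrySubgroup ω))

instance : TopologicalSpace (SymplecticGroup ω) :=
  inferInstanceAs (TopologicalSpace (isometrySubgroup ω))

instance : IsTopologicalGroup (SymplecticGroup ω) :=
  inferInstanceAs (IsTopologicalGroup (isometrySubgroup ω))

instance : MeasurableSpace (SymplecticGroup ω) := borel _

instance : BorelSpace (SymplecticGroup ω) := ⟨rfl⟩

noncomputable instance : DistribMulAction (SymplecticGroup ω) V :=
  inferInstanceAs (DistribMulAction (isometrySubgroup ω) V)

instance : SMulCommClass (SymplecticGroup ω) 𝕜 V :=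
  inferInstanceAs (SMulCommClass (isometrySubgroup ω) 𝕜 V)

theorem symplecticGroup_form (g : SymplecticGroup ω) (x y : V) : ω (g • x) (g • y) = ω x y :=
  g.2 x y

variable [FiniteDimensional 𝕜 V]

theorem exists_symplecticGroup_smul (g : V ≃ₗ[𝕜] V) (hg : ∀ x y, ω (g x) (g y) = ω x y) :
    ∃ a : SymplecticGroup ω, ∀ x : V, a • x = g x :=
  ⟨⟨ContinuousLinearEquiv.toUnit g.toContinuousLinearEquiv, hg⟩, fun _ => rfl⟩

variable [MeasurableSpace V] [BorelSpace V]

theorem continuous_symplecticGroup_val :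
    Continuous fun g : SymplecticGroup ω => (g.1.1 : V →L[𝕜] V) :=
  Units.continuous_val.comp continuous_subtype_val

/-- Closedness makes the symplectic group locally compact, so that it carries a Haar measure. -/
theorem isClosed_isometrySubgroup : IsClosed (isometrySubgroup ω : Set (V →L[𝕜] V)ˣ) := by
  have : (isometrySubgroup ω : Set (V →L[𝕜] V)ˣ) =
      ⋂ x : V, ⋂ y : V, {g | inner 𝕜 (formDual ω (g.1 x)) (g.1 y) = ω x y} := by
    ext g
    simp only [Set.mem_iInter, Set.mem_ofPred_eq, inner_formDual]
    rfl
  rw [this]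
  refine isClosed_iInter fun x => isClosed_iInter fun y => isClosed_eq ?_ continuous_const
  have h (z : V) : Continuous fun g : (V →L[𝕜] V)ˣ => g.1 z :=
    (ContinuousLinearMap.apply 𝕜 V z).continuous.comp Units.continuous_val
  exact ((continuous_formDual ω).comp (h x)).inner (h y)

instance : LocallyCompactSpace (SymplecticGroup ω) := by
  have : ProperSpace (V →L[𝕜] V) := FiniteDimensional.proper_rclike 𝕜 _
  exact (isClosed_isometrySubgroup ω).isClosedEmbedding_subtypeVal.locallyCompactSpace

instance : SecondCountableTopology (SymplecticGroup ω) := by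
  have : ProperSpace (V →L[𝕜] V) := FiniteDimensional.proper_rclike 𝕜 _
  have : SecondCountableTopology (V →L[𝕜] V)ᵐᵒᵖ :=
    MulOpposite.opHomeomorph.symm.isEmbedding.secondCountableTopology
  have : SecondCountableTopology (V →L[𝕜] V)ˣ :=
    Units.isEmbedding_embedProduct.secondCountableTopology
  exact Topology.IsEmbedding.subtypeVal.secondCountableTopology

/-- The saturation of an open set is the union of its scalar multiples. Openness is what survives
taking products, as needed for joint continuity of the action. -/
theorem isOpenQuotientMap_projMk :
    IsOpenQuotientMap (Projectivization.mk' 𝕜 : {v : V // v ≠ 0} → ℙ 𝕜 V) := by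
  refine ⟨projMk_surjective, continuous_projMk, fun U hU => ?_⟩
  refine isOpen_coinduced.2 ?_
  have : Projectivization.mk' 𝕜 ⁻¹' (Projectivization.mk' 𝕜 '' U) =
      ⋃ c : 𝕜ˣ, (fun v : {v : V // v ≠ 0} =>
        (⟨c • (v : V), (smul_ne_zero_iff_ne c).2 v.2⟩ : {v : V // v ≠ 0})) ⁻¹' U := by
    ext v
    simp only [Set.mem_preimage, Set.mem_image, Set.mem_iUnion]
    constructor
    · rintro ⟨w, hw, h⟩
      obtain ⟨c, hc⟩ := (Projectivization.mk_eq_mk_iff 𝕜 _ _ w.2 v.2).1 h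
      refine ⟨c, ?_⟩
      convert hw
    · rintro ⟨c, hc⟩
      exact ⟨_, hc, (Projectivization.mk_eq_mk_iff 𝕜 _ _ _ _).2 ⟨c, rfl⟩⟩
  rw [this]
  refine isOpen_iUnion fun c => hU.preimage ?_
  exact (continuous_subtype_val.const_smul (c : 𝕜)).subtype_mk _

instance : ContinuousSMul (SymplecticGroup ω) (ℙ 𝕜 V) where
  continuous_smul := by
    refine (IsOpenQuotientMap.prodMap .id isOpenQuotientMap_projMk).continuous_comp_iff.1 ?_
    have h : Continuous fun z : SymplecticGroup ω × {v : V // v ≠ 0} =>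
        (⟨z.1 • (z.2 : V), (smul_ne_zero_iff_ne z.1).2 z.2.2⟩ : {v : V // v ≠ 0}) := by
      refine Continuous.subtype_mk ?_ _
      exact ((continuous_symplecticGroup_val ω).comp continuous_fst).clm_apply
        (continuous_subtype_val.comp continuous_snd)
    exact continuous_projMk.comp h

end SymplecticGroup

end SympStiefel

namespace SympStiefel

/-! ### Equivariance of the sampling laws up to null sets. -/

theorem QuasiEquivariant.absolutelyContinuous {G X Y : Type*} [Group G] [MeasurableSpace X]
    [MulAction G X] [MulAction G Y] [MeasurableConstSMul G X] {κ : Y → Measure X}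
    (hκ : QuasiEquivariant G κ) (g : G) (y : Y) : (κ y).map (g • ·) ≪ κ (g • y) := by
  refine Measure.AbsolutelyContinuous.mk fun N hN h => ?_
  rw [measure_eq_zero_iff_ae_notMem] at h ⊢
  exact (ae_map_iff (measurable_const_smul g).aemeasurable hN.compl).2 (hκ g y _ hN.compl h)

theorem QuasiEquivariant.pi {G X Y ι : Type*} [Group G] [MeasurableSpace X] [Fintype ι]
    [MulAction G X] [MulAction G Y] [MeasurableConstSMul G X] {κ : ι → Y → Measure X}
    [∀ i y, IsProbabilityMeasure (κ i y)] (hκ : ∀ i, QuasiEquivariant G (κ i)) :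
    QuasiEquivariant G fun y => Measure.pi fun i => κ i y := by
  classical
  intro g y P hP h
  have hprob (i : ι) : IsProbabilityMeasure ((κ i y).map (g • ·)) :=
    Measure.isProbabilityMeasure_map (measurable_const_smul g).aemeasurable
  have h1 := (pi_absolutelyContinuous fun i => (hκ i).absolutelyContinuous g y).ae_le h
  rw [← Measure.pi_map_pi (f := fun _ x => g • x)
    fun i => (measurable_const_smul g).aemeasurable] at h1
  refine (ae_map_iff (f := fun (x : ι → X) i => g • x i) ?_ hP).1 h1
  exact (measurable_const_smul (α := ι → X) g).aemeasurable

section SymplecticGroup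

variable {𝕜 V : Type*} [RCLike 𝕜] [NormedAddCommGroup V] [InnerProductSpace 𝕜 V]
variable {k : ℕ} {ω : V →ₗ[𝕜] V →ₗ[𝕜] 𝕜}

theorem submodule_smul (g : SymplecticGroup ω) (x : ℙ 𝕜 V) :
    (g • x).submodule = x.submodule.map (DistribMulAction.toLinearEquiv 𝕜 V g).toLinearMap := by
  induction x with
  | h v hv =>
    rw [Projectivization.smul_mk, Projectivization.submodule_mk, Projectivization.submodule_mk,
      Submodule.map_span, Set.image_singleton]
    rfl

theorem lineSpan_image_smul (g : SymplecticGroup ω) (S : Set (ℙ 𝕜 V)) :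
    lineSpan ((g • ·) '' S) =
      (lineSpan S).map (DistribMulAction.toLinearEquiv 𝕜 V g).toLinearMap := by
  rw [lineSpan, lineSpan, iSup_image, Submodule.map_iSup]
  refine iSup_congr fun x => ?_
  rw [Submodule.map_iSup]
  exact iSup_congr fun _ => submodule_smul g x

theorem orthogonalBilin_map_smul (g : SymplecticGroup ω) (U : Submodule 𝕜 V) :
    (U.map (DistribMulAction.toLinearEquiv 𝕜 V g).toLinearMap).orthogonalBilin ω =
      (U.orthogonalBilin ω).map (DistribMulAction.toLinearEquiv 𝕜 V g).toLinearMap := by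
  ext x
  constructor
  · intro hx
    refine ⟨g⁻¹ • x, fun y hy => ?_, smul_inv_smul g x⟩
    have := hx _ (Submodule.mem_map_of_mem hy)
    rw [← symplecticGroup_form ω g, smul_inv_smul]
    exact this
  · rintro ⟨x, hx, rfl⟩ _ ⟨y, hy, rfl⟩
    exact (symplecticGroup_form ω g y x).trans (hx y hy)

variable [FiniteDimensional 𝕜 V]

theorem exists_symplecticGroup_smul_eq (hω : ω.Nondegenerate) (halt : ω.IsAlt) {r : ℕ}
    (hr : finrank 𝕜 V = 2 * r) (hk : k + 1 ≤ r) {p p' : Fin (k + 1) → ℙ 𝕜 V}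
    (hp : p ∈ stiefel ω k) (hp' : p' ∈ stiefel ω k) : ∃ g : SymplecticGroup ω, g • p = p' := by
  rw [mem_stiefel_iff] at hp hp'
  obtain ⟨e, he, hep⟩ := exists_isometry_of_isotropic hω halt hr hk hp.2 hp.1 hp'.2 hp'.1
  obtain ⟨g, hg⟩ := exists_symplecticGroup_smul ω e he
  refine ⟨g, funext fun i => ?_⟩
  rw [Pi.smul_apply, ← (p i).mk_rep, Projectivization.smul_mk, ← (p' i).mk_rep]
  simp only [hg, hep]

theorem ancestors_smul (g : SymplecticGroup ω) (p : Fin (k + 1) → ℙ 𝕜 V)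
    (t : Finset (Fin (k + 1)) → ℙ 𝕜 V) (J : Finset (Fin (k + 1))) :
    ancestors (g • p) (g • t) J = (g • ·) '' ancestors p t J := by
  rw [ancestors, ancestors, Set.image_union, Set.image_image, Set.image_image]
  rfl

variable [MeasurableSpace V] [BorelSpace V]

theorem ae_projMeasure_smul (g : SymplecticGroup ω) (W : Submodule 𝕜 V) {P : ℙ 𝕜 V → Prop}
    (hP : MeasurableSet {x | P x})
    (h : ∀ᵐ x ∂projMeasure (W.map (DistribMulAction.toLinearEquiv 𝕜 V g).toLinearMap), P x) :
    ∀ᵐ x ∂projMeasure W, P (g • x) := by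
  have := map_projMeasure_absolutelyContinuous (DistribMulAction.toLinearEquiv 𝕜 V g) W hP.compl
    (measurable_const_smul g hP.compl) (by simpa using h)
  simp only [Set.mem_compl_iff, Set.mem_ofPred_eq, not_not] at this
  exact this

theorem ae_perpMeasure_smul (g : SymplecticGroup ω) (S : Set (ℙ 𝕜 V)) {P : ℙ 𝕜 V → Prop}
    (hP : MeasurableSet {x | P x}) (h : ∀ᵐ x ∂perpMeasure ω ((g • ·) '' S), P x) :
    ∀ᵐ x ∂perpMeasure ω S, P (g • x) := by
  rw [perpMeasure, lineSpan_image_smul, orthogonalBilin_map_smul] at h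
  exact ae_projMeasure_smul g _ hP h

theorem quasiEquivariant_perpMeasure (ω : V →ₗ[𝕜] V →ₗ[𝕜] 𝕜) (ι : Type*) :
    QuasiEquivariant (SymplecticGroup ω) fun y : ι → ℙ 𝕜 V => perpMeasure ω (Set.range y) := by
  intro g y P hP h
  refine ae_perpMeasure_smul g _ hP ?_
  rwa [← Set.range_comp]

theorem quasiEquivariant_stepFactor (ω : V →ₗ[𝕜] V →ₗ[𝕜] 𝕜) (m : ℕ) (J : Finset (Fin (k + 1))) :
    QuasiEquivariant (SymplecticGroup ω)
      fun z : (Fin (k + 1) → ℙ 𝕜 V) × (Finset (Fin (k + 1)) → ℙ 𝕜 V) =>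
        stepFactor ω z.1 m z.2 J := by
  rintro g ⟨p, t⟩ P hP h
  simp only [stepFactor, Prod.smul_mk] at h ⊢
  split_ifs at h ⊢
  · rw [ancestors_smul] at h
    exact ae_perpMeasure_smul g _ hP h
  · rw [ae_dirac_iff hP] at h
    exact (ae_dirac_iff (measurable_const_smul g hP)).2 h

theorem quasiEquivariant_chainingStep (hω : ω.Nondegenerate)
    (hdim : 2 ^ (k + 1) + (k + 1) ≤ finrank 𝕜 V) (m : ℕ) :
    QuasiEquivariant (SymplecticGroup ω)
      fun z : (Fin (k + 1) → ℙ 𝕜 V) × (Finset (Fin (k + 1)) → ℙ 𝕜 V) =>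
        chainingStep ω z.1 m z.2 := by
  obtain ⟨F, hF⟩ : ∃ F : Finset (Fin (k + 1)) → (Fin (k + 1) → ℙ 𝕜 V) ×
      (Finset (Fin (k + 1)) → ℙ 𝕜 V) → Measure (ℙ 𝕜 V),
      F = fun J z => stepFactor ω z.1 m z.2 J := ⟨_, rfl⟩
  have hprob (J : Finset (Fin (k + 1)))
      (z : (Fin (k + 1) → ℙ 𝕜 V) × (Finset (Fin (k + 1)) → ℙ 𝕜 V)) :
      IsProbabilityMeasure (F J z) := by
    rw [hF]
    exact isProbabilityMeasure_stepFactor hω hdim z.1 m z.2 J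
  have hQE (J : Finset (Fin (k + 1))) : QuasiEquivariant (SymplecticGroup ω) (F J) := by
    rw [hF]
    exact quasiEquivariant_stepFactor ω m J
  have h := QuasiEquivariant.pi hQE
  simp only [hF] at h
  exact h

theorem quasiEquivariant_chainingLawUpTo (hω : ω.Nondegenerate)
    (hdim : 2 ^ (k + 1) + (k + 1) ≤ finrank 𝕜 V) (m : ℕ) :
    QuasiEquivariant (SymplecticGroup ω)
      fun p : Fin (k + 1) → ℙ 𝕜 V => chainingLawUpTo ω p m := by
  induction m with
  | zero =>
    have : IsProbabilityMeasure (projMeasure (⊤ : Submodule 𝕜 V)) :=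
      isProbabilityMeasure_projMeasure_top (by have := Nat.one_le_two_pow (n := k + 1); omega)
    refine QuasiEquivariant.pi (κ := fun (_ : Finset (Fin (k + 1))) (_ : Fin (k + 1) → ℙ 𝕜 V) =>
      projMeasure (⊤ : Submodule 𝕜 V)) fun J g p P hP h => ae_projMeasure_smul g _ hP ?_
    rwa [Submodule.map_top, LinearEquiv.range]
  | succ m ih =>
    intro g p P hP h
    rw [ae_chainingLawUpTo_succ hω hdim _ _ hP] at h
    refine (ae_chainingLawUpTo_succ hω hdim p m (P := fun t => P (g • t))
      (measurable_const_smul g hP)).2 ?_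
    have hmeas : MeasurableSet {t | ∀ᵐ t' ∂chainingStep ω (g • p) (m + 1) t, P t'} :=
      (Measure.measurable_coe hP.compl).comp (measurable_chainingStep_right hω hdim (m + 1) (g • p))
        (measurableSet_singleton 0)
    filter_upwards [ih g p _ hmeas h] with t ht
    exact quasiEquivariant_chainingStep hω hdim (m + 1) g (p, t) P hP ht

/-! ### The measures on the Stiefel varieties -/

theorem projMeasure_univ_le (W : Submodule 𝕜 V) : projMeasure W Set.univ ≤ 1 := by
  have : ProperSpace W := FiniteDimensional.proper_rclike 𝕜 W
  rw [projMeasure_apply W MeasurableSet.univ,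
    ← Measure.addHaarMeasure_self (K₀ := unitBall W)]
  exact measure_mono fun w hw => mem_closedBall_zero_iff.2 hw.1

instance (W : Submodule 𝕜 V) : IsFiniteMeasure (projMeasure W) :=
  ⟨(projMeasure_univ_le W).trans_lt ENNReal.one_lt_top⟩

/-- The perpendicular measure as a kernel. -/
noncomputable def perpKernel (ω : V →ₗ[𝕜] V →ₗ[𝕜] 𝕜) (ι : Type*) [Finite ι] :
    ProbabilityTheory.Kernel (ι → ℙ 𝕜 V) (ℙ 𝕜 V) :=
  ⟨fun y => perpMeasure ω (Set.range y), measurable_perpMeasure ω ι⟩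

instance (ω : V →ₗ[𝕜] V →ₗ[𝕜] 𝕜) (ι : Type*) [Finite ι] :
    ProbabilityTheory.IsFiniteKernel (perpKernel ω ι) :=
  ⟨1, ENNReal.one_lt_top, fun _ => projMeasure_univ_le _⟩

theorem measurable_snoc (k : ℕ) : Measurable fun z : (Fin (k + 1) → ℙ 𝕜 V) × ℙ 𝕜 V =>
    (Fin.snoc (α := fun _ => ℙ 𝕜 V) z.1 z.2 : Fin (k + 2) → ℙ 𝕜 V) := by
  refine measurable_pi_lambda _ fun i => ?_
  induction i using Fin.lastCases with
  | last => simpa using measurable_snd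
  | cast i =>
    simp only [Fin.snoc_castSucc]
    exact (measurable_pi_apply i).comp measurable_fst

/-- As a push-forward of a measure-kernel product, the recursion becomes accessible to Fubini and to
`QuasiInvariant.compProd`. -/
theorem tupleMeasure_succ (ω : V →ₗ[𝕜] V →ₗ[𝕜] 𝕜) (k : ℕ) [SFinite (tupleMeasure ω k)] :
    tupleMeasure ω (k + 1) = ((tupleMeasure ω k).compProd (perpKernel ω (Fin (k + 1)))).map
      fun z => Fin.snoc (α := fun _ => ℙ 𝕜 V) z.1 z.2 := by
  have hs (p : Fin (k + 1) → ℙ 𝕜 V) : Measurable fun x : ℙ 𝕜 V =>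
      (Fin.snoc (α := fun _ => ℙ 𝕜 V) p x : Fin (k + 2) → ℙ 𝕜 V) :=
    (measurable_snoc k).comp measurable_prodMk_left
  have hmeas : Measurable fun p : Fin (k + 1) → ℙ 𝕜 V => (perpMeasure ω (Set.range p)).map
      fun x => (Fin.snoc (α := fun _ => ℙ 𝕜 V) p x : Fin (k + 2) → ℙ 𝕜 V) := by
    refine Measure.measurable_of_measurable_coe _ fun B hB => ?_
    simp only [fun p => Measure.map_apply (μ := perpMeasure ω (Set.range p)) (hs p) hB]
    exact ProbabilityTheory.Kernel.measurable_kernel_prodMk_left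
      (κ := perpKernel ω (Fin (k + 1))) (measurable_snoc k hB)
  ext B hB
  rw [tupleMeasure, Measure.bind_apply hB hmeas.aemeasurable, Measure.map_apply (measurable_snoc k) hB,
    Measure.compProd_apply (measurable_snoc k hB)]
  exact lintegral_congr fun p => Measure.map_apply (hs p) hB

instance sFinite_tupleMeasure (ω : V →ₗ[𝕜] V →ₗ[𝕜] 𝕜) (k : ℕ) : SFinite (tupleMeasure ω k) := by
  induction k with
  | zero =>
    rw [tupleMeasure]
    infer_instance
  | succ k ih =>
    rw [tupleMeasure_succ]
    infer_instance

theorem ae_tupleMeasure_succ (ω : V →ₗ[𝕜] V →ₗ[𝕜] 𝕜) (k : ℕ) {P : (Fin (k + 2) → ℙ 𝕜 V) → Prop}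
    (hP : MeasurableSet {y | P y}) : (∀ᵐ y ∂tupleMeasure ω (k + 1), P y) ↔
      ∀ᵐ p ∂tupleMeasure ω k, ∀ᵐ x ∂perpMeasure ω (Set.range p),
        P (Fin.snoc (α := fun _ => ℙ 𝕜 V) p x) := by
  rw [tupleMeasure_succ, ae_map_iff (measurable_snoc k).aemeasurable hP]
  exact Measure.ae_compProd_iff (measurable_snoc k hP)

theorem quasiInvariant_tupleMeasure (ω : V →ₗ[𝕜] V →ₗ[𝕜] 𝕜) (k : ℕ) :
    QuasiInvariant (SymplecticGroup ω) (tupleMeasure ω k) := by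
  induction k with
  | zero =>
    rw [tupleMeasure]
    refine QuasiInvariant.map (fun g P hP h => ae_projMeasure_smul g _ hP ?_)
      (measurable_pi_lambda _ fun _ => measurable_id) fun _ _ => rfl
    rwa [Submodule.map_top, LinearEquiv.range]
  | succ k ih =>
    rw [tupleMeasure_succ]
    refine QuasiInvariant.map (ih.compProd _ (quasiEquivariant_perpMeasure ω _))
      (measurable_snoc k) fun g z => funext fun i => ?_
    induction i using Fin.lastCases with
    | last => simp
    | cast i => simp

theorem measurableSet_stiefel (ω : V →ₗ[𝕜] V →ₗ[𝕜] 𝕜) (k : ℕ) :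
    MeasurableSet (stiefel ω k) := by
  have : stiefel ω k = {y | ∀ i j, Perp ω (y i) (y j)} ∩
      {y | LinearIndependent 𝕜 fun i => (y i).rep} := Set.ext fun y => mem_stiefel_iff
  rw [this]
  refine MeasurableSet.inter ?_ ?_
  · simp only [Set.ofPred_forall]
    exact MeasurableSet.iInter fun i => MeasurableSet.iInter fun j => measurableSet_perp ω i j
  · have : {y : Fin (k + 1) → ℙ 𝕜 V | LinearIndependent 𝕜 fun i => (y i).rep} =
        ⋂ i, {y : Fin (k + 1) → ℙ 𝕜 V | (y i).submodule ≤ lineSpan (y '' {j | j ≠ i})}ᶜ := by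
      ext y
      simp only [Set.mem_ofPred_eq, Set.mem_iInter, Set.mem_compl_iff,
        linearIndependent_iff_notMem_span, submodule_le_iff, lineSpan_eq_span, Set.image_image]
      refine forall_congr' fun i => ?_
      rw [show Set.univ \ {i} = {j | j ≠ i} from by ext; simp]
    rw [this]
    exact MeasurableSet.iInter fun i => (measurableSet_le_lineSpan i _).compl

theorem ae_tupleMeasure_mem_stiefel (hω : ω.Nondegenerate) (halt : ω.IsAlt)
    (hk : 2 * k + 2 ≤ finrank 𝕜 V) : ∀ᵐ y ∂tupleMeasure ω k, y ∈ stiefel ω k := by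
  induction k with
  | zero =>
    have : Subsingleton (Fin (0 + 1)) := inferInstanceAs (Subsingleton (Fin 1))
    refine Filter.Eventually.of_forall fun y => mem_stiefel_iff.2 ⟨fun i j => ?_, ?_⟩
    · rw [Subsingleton.elim i j]
      exact halt _
    · exact LinearIndependent.of_subsingleton 0 (y 0).rep_nonzero
  | succ k ih =>
    refine (ae_tupleMeasure_succ ω k (P := fun y => y ∈ stiefel ω (k + 1))
      (measurableSet_stiefel ω (k + 1))).2 ?_
    filter_upwards [ih (by omega)] with p hp
    -- An isotropic span of less than half the dimension is strictly smaller than its complement, so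
    -- a random point of the complement lies outside the span.
    have hnot : ¬ (lineSpan (Set.range p)).orthogonalBilin ω ≤ lineSpan (Set.range p) := by
      intro hle
      have h1 := Submodule.finrank_mono hle
      rw [finrank_orthogonalBilin hω, hp.2] at h1
      omega
    filter_upwards [ae_perpMeasure_perp ω (Set.range p), ae_projMeasure_not_le hnot] with x hx hxp
    rw [mem_stiefel_iff] at hp ⊢
    constructor
    · intro i j
      induction i using Fin.lastCases with
      | last =>
        induction j using Fin.lastCases with
        | last => simpa [Perp] using halt _
        | cast j => simpa using (hx _ ⟨j, rfl⟩).symm halt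
      | cast i =>
        induction j using Fin.lastCases with
        | last => simpa using hx _ ⟨i, rfl⟩
        | cast j => simpa using hp.1 i j
    · rw [submodule_le_iff, lineSpan_range] at hxp
      have : (fun i => ((Fin.snoc (α := fun _ => ℙ 𝕜 V) p x : Fin (k + 2) → ℙ 𝕜 V) i).rep) =
          Fin.snoc (α := fun _ => V) (fun i => (p i).rep) x.rep := by
        funext i
        induction i using Fin.lastCases <;> simp
      rw [this]
      exact linearIndependent_finSnoc.2 ⟨hp.2, hxp⟩

theorem isProbabilityMeasure_tupleMeasure (hω : ω.Nondegenerate) (halt : ω.IsAlt)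
    (hk : 2 * k + 2 ≤ finrank 𝕜 V) : IsProbabilityMeasure (tupleMeasure ω k) := by
  induction k with
  | zero =>
    have : IsProbabilityMeasure (projMeasure (⊤ : Submodule 𝕜 V)) :=
      isProbabilityMeasure_projMeasure_top (by omega)
    rw [tupleMeasure]
    exact Measure.isProbabilityMeasure_map (measurable_pi_lambda _ fun _ => measurable_id).aemeasurable
  | succ k ih =>
    have := ih (by omega)
    refine ⟨?_⟩
    rw [tupleMeasure_succ, Measure.map_apply (measurable_snoc k) MeasurableSet.univ,
      Set.preimage_univ, Measure.compProd_apply MeasurableSet.univ]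
    have h : ∀ᵐ p ∂tupleMeasure ω k,
        perpKernel ω (Fin (k + 1)) p (Prod.mk p ⁻¹' (Set.univ : Set (_ × ℙ 𝕜 V))) = 1 := by
      filter_upwards [ae_tupleMeasure_mem_stiefel hω halt (by omega)] with p hp
      have : IsProbabilityMeasure (perpMeasure ω (Set.range p)) :=
        isProbabilityMeasure_perpMeasure hω (by rw [hp.2]; omega)
      exact this.measure_univ
    rw [lintegral_congr_ae h]
    simp

theorem measurable_tuple {n : ℕ} (C : DescChain k n) :
    Measurable fun z : (Fin (k + 1) → ℙ 𝕜 V) × (Finset (Fin (k + 1)) → ℙ 𝕜 V) =>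
      C.tuple z.1 z.2 := by
  refine measurable_pi_lambda _ fun j => ?_
  by_cases hj : (j : ℕ) ≤ n
  · simp only [DescChain.tuple, dif_pos hj]
    exact (measurable_pi_apply _).comp measurable_snd
  · simp only [DescChain.tuple, dif_neg hj]
    exact (measurable_pi_apply _).comp measurable_fst

theorem tuple_smul {n : ℕ} (C : DescChain k n) (g : SymplecticGroup ω)
    (p : Fin (k + 1) → ℙ 𝕜 V) (t : Finset (Fin (k + 1)) → ℙ 𝕜 V) :
    C.tuple (g • p) (g • t) = g • C.tuple p t := by
  funext j
  rw [Pi.smul_apply, DescChain.tuple, DescChain.tuple]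
  split_ifs <;> rfl

/-- The chaining law as a kernel. -/
noncomputable def chainingKernel (hω : ω.Nondegenerate)
    (hdim : 2 ^ (k + 1) + (k + 1) ≤ finrank 𝕜 V) :
    ProbabilityTheory.Kernel (Fin (k + 1) → ℙ 𝕜 V) (Finset (Fin (k + 1)) → ℙ 𝕜 V) :=
  ⟨fun p => chainingLaw ω p, measurable_chainingLawUpTo hω hdim (k + 1)⟩

instance (hω : ω.Nondegenerate) (hdim : 2 ^ (k + 1) + (k + 1) ≤ finrank 𝕜 V) :
    ProbabilityTheory.IsMarkovKernel (chainingKernel hω hdim) :=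
  ⟨fun p => isProbabilityMeasure_chainingLawUpTo hω hdim p (k + 1)⟩

theorem QuasiInvariant.ae_of_ae_tupleMeasure (hω : ω.Nondegenerate) (halt : ω.IsAlt) {r : ℕ}
    (hr : finrank 𝕜 V = 2 * r) (hk : k + 1 ≤ r) {m : Measure (Fin (k + 1) → ℙ 𝕜 V)} [SFinite m]
    (hm : QuasiInvariant (SymplecticGroup ω) m) (hmS : ∀ᵐ y ∂m, y ∈ stiefel ω k)
    {P : (Fin (k + 1) → ℙ 𝕜 V) → Prop} (h : ∀ᵐ y ∂tupleMeasure ω k, P y) : ∀ᵐ y ∂m, P y :=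
  (hm.absolutelyContinuous (quasiInvariant_tupleMeasure ω k)
    (isProbabilityMeasure_tupleMeasure hω halt (by omega)).ne_zero measurable_smul hmS
    (ae_tupleMeasure_mem_stiefel hω halt (by omega))
    fun _ hx _ hy => exists_symplecticGroup_smul_eq hω halt hr hk hx hy).ae_le h

theorem QuasiInvariant.ae_comp_of_ae_tupleMeasure (hω : ω.Nondegenerate) (halt : ω.IsAlt)
    {r : ℕ} (hr : finrank 𝕜 V = 2 * r) (hk : k + 1 ≤ r) {X : Type*} [MeasurableSpace X]
    [MulAction (SymplecticGroup ω) X] {m : Measure X} [SFinite m]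
    (hm : QuasiInvariant (SymplecticGroup ω) m) {f : X → Fin (k + 1) → ℙ 𝕜 V} (hf : Measurable f)
    (hfG : ∀ (g : SymplecticGroup ω) x, f (g • x) = g • f x)
    (hmS : ∀ᵐ x ∂m, f x ∈ stiefel ω k)
    {P : (Fin (k + 1) → ℙ 𝕜 V) → Prop} (h : ∀ᵐ y ∂tupleMeasure ω k, P y) : ∀ᵐ x ∂m, P (f x) :=
  ae_of_ae_map hf.aemeasurable ((hm.map hf hfG).ae_of_ae_tupleMeasure hω halt hr hk
    ((ae_map_iff (p := fun y => y ∈ stiefel ω k) hf.aemeasurable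
      (measurableSet_stiefel ω k)).2 hmS) h)

/-- For μ_k-random p the law of t(p, C) is quasi-invariant and concentrated on X_{k+1}, where the
group is transitive because k + 2 ≤ r. It is therefore absolutely continuous with respect to
μ_{k+1}, which is why h^k respects function classes. -/
theorem ae_chainingLaw_of_ae_tupleMeasure (hω : ω.Nondegenerate) (halt : ω.IsAlt) {r : ℕ}
    (hr : finrank 𝕜 V = 2 * r) (hdim : 2 ^ (k + 1) + (k + 1) ≤ finrank 𝕜 V) (hk : k + 2 ≤ r)
    {n : ℕ} (C : DescChain k n) {P : (Fin (k + 2) → ℙ 𝕜 V) → Prop}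
    (h : ∀ᵐ y ∂tupleMeasure ω (k + 1), P y) :
    ∀ᵐ p ∂tupleMeasure ω k, ∀ᵐ t ∂chainingLaw ω p, P (C.tuple p t) := by
  have hprod : QuasiInvariant (SymplecticGroup ω)
      ((tupleMeasure ω k).compProd (chainingKernel hω hdim)) :=
    (quasiInvariant_tupleMeasure ω k).compProd _
      (quasiEquivariant_chainingLawUpTo hω hdim (k + 1))
  have hmem : ∀ᵐ z ∂(tupleMeasure ω k).compProd (chainingKernel hω hdim),
      C.tuple z.1 z.2 ∈ stiefel ω (k + 1) := by
    refine (Measure.ae_compProd_iff (p := fun z => C.tuple z.1 z.2 ∈ stiefel ω (k + 1))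
      (measurable_tuple C (measurableSet_stiefel ω (k + 1)))).2 ?_
    filter_upwards [ae_tupleMeasure_mem_stiefel (k := k) hω halt (by omega)] with p hp
    exact ae_tuple_mem_stiefel hω halt hdim hp C
  have h1 := hprod.ae_comp_of_ae_tupleMeasure hω halt hr (by omega)
    (f := fun z => C.tuple z.1 z.2) (measurable_tuple C)
    (fun g z => tuple_smul C g z.1 z.2) hmem h
  filter_upwards [Measure.ae_ae_of_ae_compProd h1] with p hp
  exact hp

theorem ae_face_of_ae_tupleMeasure (hω : ω.Nondegenerate) (halt : ω.IsAlt) {r : ℕ}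
    (hr : finrank 𝕜 V = 2 * r) (hk : k + 2 ≤ r) (i : Fin (k + 2))
    {P : (Fin (k + 1) → ℙ 𝕜 V) → Prop} (h : ∀ᵐ y ∂tupleMeasure ω k, P y) :
    ∀ᵐ y ∂tupleMeasure ω (k + 1), P fun j => y (i.succAbove j) := by
  have hm : Measurable fun (y : Fin (k + 2) → ℙ 𝕜 V) j => y (i.succAbove j) :=
    measurable_pi_lambda _ fun j => measurable_pi_apply _
  refine (quasiInvariant_tupleMeasure ω (k + 1)).ae_comp_of_ae_tupleMeasure hω halt hr
    (by omega) hm (fun _ _ => rfl) ?_ h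
  filter_upwards [ae_tupleMeasure_mem_stiefel (k := k + 1) hω halt (by omega)] with y hy
  exact face_mem ω i hy

end SymplecticGroup

end SympStiefel

namespace SympStiefel

/-! ### Bounded functions and function classes -/

section Classes

variable {X : Type*} [MeasurableSpace X]

theorem coeFn_toLinf (μ : Measure X) (f : BddMeas X) : toLinf μ f =ᵐ[μ] f.1 := by
  obtain ⟨hf, c, hc⟩ := f.2
  exact MemLp.coeFn_toLp
    (memLp_top_of_bound hf.aestronglyMeasurable c (Filter.Eventually.of_forall hc))

theorem toLinf_eq_zero_iff {μ : Measure X} {f : BddMeas X} :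
    toLinf μ f = 0 ↔ ∀ᵐ x ∂μ, f.1 x = 0 := by
  rw [Lp.eq_zero_iff_ae_eq_zero]
  exact ⟨(coeFn_toLinf μ f).symm.trans, (coeFn_toLinf μ f).trans⟩

theorem toLinf_surjective (μ : Measure X) : Function.Surjective (toLinf μ) := by
  intro F
  have hbdd : ∀ᵐ x ∂μ, |F x| ≤ ‖F‖ := by
    filter_upwards [ae_le_eLpNormEssSup (f := F) (μ := μ)] with x hx
    rw [← Real.norm_eq_abs, Lp.norm_def, ← toReal_enorm, eLpNorm_exponent_top]
    refine ENNReal.toReal_mono ?_ hx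
    rw [← eLpNorm_exponent_top]
    exact Lp.eLpNorm_ne_top F
  have hm : Measurable F := (Lp.stronglyMeasurable F).measurable
  -- Truncation at ±‖F‖ makes the representative bounded everywhere and changes it only on a null
  -- set.
  refine ⟨⟨fun x => max (-‖F‖) (min ‖F‖ (F x)), measurable_const.max (measurable_const.min hm),
    ‖F‖, fun x => abs_le.2 ⟨le_max_left _ _, max_le ?_ (min_le_left _ _)⟩⟩, ?_⟩
  · linarith [norm_nonneg F]
  · refine Lp.ext ((coeFn_toLinf μ _).trans ?_)
    filter_upwards [hbdd] with x hx
    have := abs_le.1 hx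
    simp only [min_eq_right this.2, max_eq_right this.1]

end Classes

/-- A linear section s of A gives L = B ∘ s, since s (A x) − x is killed by A and hence by B. -/
theorem exists_linearMap_comp_eq {K E F F' : Type*} [DivisionRing K] [AddCommGroup E] [Module K E]
    [AddCommGroup F] [Module K F] [AddCommGroup F'] [Module K F'] {A : E →ₗ[K] F}
    (hA : Function.Surjective A) (B : E →ₗ[K] F') (h : ∀ x, A x = 0 → B x = 0) :
    ∃ L : F →ₗ[K] F', ∀ x, L (A x) = B x := by
  obtain ⟨s, hs⟩ := A.exists_rightInverse_of_surjective (LinearMap.range_eq_top.2 hA)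
  refine ⟨B ∘ₗ s, fun x => ?_⟩
  have h1 : A (s (A x)) = A x := LinearMap.congr_fun hs (A x)
  have h2 := h (s (A x) - x) (by rw [map_sub, h1, sub_self])
  rwa [map_sub, sub_eq_zero] at h2

section Homotopy

variable {𝕜 V : Type*} [RCLike 𝕜] [NormedAddCommGroup V] [InnerProductSpace 𝕜 V]
variable {k : ℕ} {ω : V →ₗ[𝕜] V →ₗ[𝕜] 𝕜}

/-! ### Extension of functions by zero -/

theorem evalTuple_of_mem (f : stiefel ω k → ℝ) {y : Fin (k + 1) → ℙ 𝕜 V} (hy : y ∈ stiefel ω k) :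
    evalTuple ω f y = f ⟨y, hy⟩ :=
  dif_pos hy

theorem evalTuple_add (f g : stiefel ω k → ℝ) (y : Fin (k + 1) → ℙ 𝕜 V) :
    evalTuple ω (f + g) y = evalTuple ω f y + evalTuple ω g y := by
  simp only [evalTuple]
  split_ifs <;> simp

theorem evalTuple_smul (a : ℝ) (f : stiefel ω k → ℝ) (y : Fin (k + 1) → ℙ 𝕜 V) :
    evalTuple ω (a • f) y = a * evalTuple ω f y := by
  simp only [evalTuple]
  split_ifs <;> simp

theorem abs_evalTuple_le {f : stiefel ω k → ℝ} {c : ℝ} (hc : ∀ x, |f x| ≤ c)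
    (y : Fin (k + 1) → ℙ 𝕜 V) : |evalTuple ω f y| ≤ |c| := by
  simp only [evalTuple]
  split_ifs
  · exact (hc _).trans (le_abs_self c)
  · simp

/-- Outside X_{k+1} the left side is zero while faces of y may still lie in X_k. The identity is
therefore limited to X_{k+1}, and the random tuples have to lie there almost surely. -/
theorem evalTuple_dMeas (f : BddMeas (stiefel ω k)) {y : Fin (k + 2) → ℙ 𝕜 V}
    (hy : y ∈ stiefel ω (k + 1)) :
    evalTuple ω (dMeas ω k f).1 y = tupleCoboundary (evalTuple ω f.1) y := by
  have hi (i : Fin (k + 2)) :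
      evalTuple ω f.1 (y ∘ i.succAbove) = f.1 (face ω i ⟨y, hy⟩) :=
    evalTuple_of_mem f.1 (face_mem ω i hy)
  rw [evalTuple_of_mem _ hy]
  simp only [tupleCoboundary, hi]
  rfl

theorem tupleCoboundary_congr {P : Type*} {n : ℕ} {φ ψ : (Fin n → P) → ℝ} {y : Fin (n + 1) → P}
    (h : ∀ i : Fin (n + 1), φ (y ∘ i.succAbove) = ψ (y ∘ i.succAbove)) :
    tupleCoboundary φ y = tupleCoboundary ψ y := by
  simp only [tupleCoboundary, h]

theorem dMeas_dMeas (f : BddMeas (stiefel ω k)) : dMeas ω (k + 1) (dMeas ω k f) = 0 := by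
  ext y
  have hi (i : Fin (k + 3)) : evalTuple ω (dMeas ω k f).1 (y.1 ∘ i.succAbove) =
      tupleCoboundary (evalTuple ω f.1) (y.1 ∘ i.succAbove) :=
    evalTuple_dMeas f (face_mem ω i y.2)
  rw [← evalTuple_of_mem (dMeas ω (k + 1) (dMeas ω k f)).1 y.2, evalTuple_dMeas _ y.2,
    tupleCoboundary_congr hi, tupleCoboundary_tupleCoboundary]
  rfl

theorem dMeas_dNegOne (c : ℝ) : dMeas ω 0 (dNegOne ω c) = 0 := by
  ext y
  have : (dMeas ω 0 (dNegOne ω c)).1 y = ∑ i : Fin 2, (-1) ^ (i : ℕ) * c := rfl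
  rw [this, Fin.sum_univ_two]
  simp

variable [FiniteDimensional 𝕜 V] [MeasurableSpace V] [BorelSpace V]

theorem measurable_evalTuple {f : stiefel ω k → ℝ} (hf : Measurable f) :
    Measurable (evalTuple ω f) := by
  classical
  exact Measurable.dite hf (g := fun _ => 0) measurable_const (measurableSet_stiefel ω k)

theorem ae_stiefelMeasure_iff (hω : ω.Nondegenerate) (halt : ω.IsAlt)
    (hk : 2 * k + 2 ≤ finrank 𝕜 V) {P : (Fin (k + 1) → ℙ 𝕜 V) → Prop} :
    (∀ᵐ x ∂stiefelMeasure ω k, P x.1) ↔ ∀ᵐ y ∂tupleMeasure ω k, P y := by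
  have hm := measurableSet_stiefel ω k
  rw [stiefelMeasure, ← (MeasurableEmbedding.subtype_coe hm).ae_map_iff, map_comap_subtype_coe hm,
    ae_restrict_iff' hm]
  constructor
  · intro h
    filter_upwards [h, ae_tupleMeasure_mem_stiefel hω halt hk] with y hy hyS
    exact hy hyS
  · intro h
    filter_upwards [h] with y hy _
    exact hy

theorem ae_evalTuple_eq_zero_iff (hω : ω.Nondegenerate) (halt : ω.IsAlt)
    (hk : 2 * k + 2 ≤ finrank 𝕜 V) (f : BddMeas (stiefel ω k)) :
    cls ω k f = 0 ↔ ∀ᵐ y ∂tupleMeasure ω k, evalTuple ω f.1 y = 0 := by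
  rw [← ae_stiefelMeasure_iff hω halt hk, toLinf_eq_zero_iff]
  simp only [evalTuple_of_mem f.1 (Subtype.prop _)]

theorem isProbabilityMeasure_stiefelMeasure (hω : ω.Nondegenerate) (halt : ω.IsAlt)
    (hk : 2 * k + 2 ≤ finrank 𝕜 V) : IsProbabilityMeasure (stiefelMeasure ω k) := by
  have := isProbabilityMeasure_tupleMeasure hω halt hk
  refine ⟨?_⟩
  rw [stiefelMeasure, comap_subtype_coe_apply (measurableSet_stiefel ω k), Set.image_univ,
    Subtype.range_coe]
  exact (prob_compl_eq_zero_iff (measurableSet_stiefel ω k)).1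
    (ae_tupleMeasure_mem_stiefel hω halt hk)

/-! ### The homotopy operators -/

theorem measurable_tuple_right {n : ℕ} (C : DescChain k n) (p : Fin (k + 1) → ℙ 𝕜 V) :
    Measurable fun t : Finset (Fin (k + 1)) → ℙ 𝕜 V => C.tuple p t :=
  (measurable_tuple C).comp measurable_prodMk_left

theorem integrable_evalTuple_tuple (hω : ω.Nondegenerate)
    (hdim : 2 ^ (k + 1) + (k + 1) ≤ finrank 𝕜 V) (f : BddMeas (stiefel ω (k + 1))) {n : ℕ}
    (C : DescChain k n) (p : Fin (k + 1) → ℙ 𝕜 V) :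
    Integrable (fun t => evalTuple ω f.1 (C.tuple p t)) (chainingLaw ω p) := by
  have : IsProbabilityMeasure (chainingLaw ω p) :=
    isProbabilityMeasure_chainingLawUpTo hω hdim p (k + 1)
  obtain ⟨hf, c, hc⟩ := f.2
  exact Integrable.of_bound
    ((measurable_evalTuple hf).comp (measurable_tuple_right C p)).aestronglyMeasurable |c|
    (Filter.Eventually.of_forall fun t => abs_evalTuple_le hc _)

theorem abs_partialHomotopy_le (hω : ω.Nondegenerate)
    (hdim : 2 ^ (k + 1) + (k + 1) ≤ finrank 𝕜 V) {f : stiefel ω (k + 1) → ℝ} {c : ℝ}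
    (hc : ∀ x, |f x| ≤ c) {n : ℕ} (C : DescChain k n) (p : stiefel ω k) :
    |partialHomotopy ω C f p| ≤ |c| := by
  have : IsProbabilityMeasure (chainingLaw ω p.1) :=
    isProbabilityMeasure_chainingLawUpTo hω hdim p.1 (k + 1)
  have h := norm_integral_le_of_norm_le_const (μ := chainingLaw ω p.1)
    (f := fun t => evalTuple ω f (C.tuple p.1 t)) (C := |c|)
    (Filter.Eventually.of_forall fun t => abs_evalTuple_le hc _)
  simpa [partialHomotopy] using h

theorem measurable_partialHomotopy (hω : ω.Nondegenerate)
    (hdim : 2 ^ (k + 1) + (k + 1) ≤ finrank 𝕜 V) {f : stiefel ω (k + 1) → ℝ} (hf : Measurable f)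
    {n : ℕ} (C : DescChain k n) : Measurable (partialHomotopy ω C f) := by
  have h : StronglyMeasurable fun p : Fin (k + 1) → ℙ 𝕜 V =>
      ∫ t, evalTuple ω f (C.tuple p t) ∂(chainingKernel hω hdim p) :=
    StronglyMeasurable.integral_kernel_prod_right'
      ((measurable_evalTuple hf).comp (measurable_tuple C)).stronglyMeasurable
  exact h.measurable.comp measurable_subtype_coe

/-- The operator `h^k` on bounded measurable functions. -/
noncomputable def homotopyMeas (hω : ω.Nondegenerate)
    (hdim : 2 ^ (k + 1) + (k + 1) ≤ finrank 𝕜 V) :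
    BddMeas (stiefel ω (k + 1)) →ₗ[ℝ] BddMeas (stiefel ω k) where
  toFun f := ⟨homotopyFormula ω k f.1, by
    obtain ⟨hf, c, hc⟩ := f.2
    refine ⟨Finset.measurable_fun_sum _ fun n _ => Finset.measurable_fun_sum _ fun C _ =>
      (measurable_partialHomotopy hω hdim hf C).const_mul _,
      ∑ n ∈ Finset.range (k + 2), ∑ C : DescChain k n, |C.sgn| * |c|, fun p => ?_⟩
    refine (Finset.abs_sum_le_sum_abs _ _).trans (Finset.sum_le_sum fun n _ =>
      (Finset.abs_sum_le_sum_abs _ _).trans (Finset.sum_le_sum fun C _ => ?_))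
    rw [abs_mul]
    exact mul_le_mul_of_nonneg_left (abs_partialHomotopy_le hω hdim hc C p) (abs_nonneg _)⟩
  map_add' f g := by
    ext p
    have h (n : ℕ) (C : DescChain k n) : partialHomotopy ω C (f.1 + g.1) p =
        partialHomotopy ω C f.1 p + partialHomotopy ω C g.1 p := by
      simp only [partialHomotopy, evalTuple_add]
      exact integral_add (integrable_evalTuple_tuple hω hdim f C p.1)
        (integrable_evalTuple_tuple hω hdim g C p.1)
    simp only [Submodule.coe_add, Pi.add_apply, homotopyFormula, h, mul_add,
      Finset.sum_add_distrib]
  map_smul' a f := by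
    ext p
    have h (n : ℕ) (C : DescChain k n) : partialHomotopy ω C (a • f.1) p =
        a * partialHomotopy ω C f.1 p := by
      simp only [partialHomotopy, evalTuple_smul]
      exact integral_const_mul _ _
    simp only [Submodule.coe_smul, Pi.smul_apply, homotopyFormula, h, smul_eq_mul,
      RingHom.id_apply, Finset.mul_sum, mul_left_comm]

theorem integrable_coneSum (hω : ω.Nondegenerate)
    (hdim : 2 ^ (k + 1) + (k + 1) ≤ finrank 𝕜 V) (f : BddMeas (stiefel ω (k + 1)))
    (p : Fin (k + 1) → ℙ 𝕜 V) :
    Integrable (fun t => coneSum (k + 1) p t (evalTuple ω f.1)) (chainingLaw ω p) := by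
  simp only [← DescChain.sum_sgn_mul_tuple]
  exact integrable_finsetSum _ fun n _ => integrable_finsetSum _ fun C _ =>
    (integrable_evalTuple_tuple hω hdim f C p).const_mul _

theorem homotopyFormula_eq_integral (hω : ω.Nondegenerate)
    (hdim : 2 ^ (k + 1) + (k + 1) ≤ finrank 𝕜 V) (f : BddMeas (stiefel ω (k + 1)))
    (p : stiefel ω k) : homotopyFormula ω k f.1 p =
      ∫ t, coneSum (k + 1) p.1 t (evalTuple ω f.1) ∂(chainingLaw ω p.1) := by
  have hint (n : ℕ) (C : DescChain k n) :
      Integrable (fun t => C.sgn * evalTuple ω f.1 (C.tuple p.1 t)) (chainingLaw ω p.1) :=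
    (integrable_evalTuple_tuple hω hdim f C p.1).const_mul _
  simp only [← DescChain.sum_sgn_mul_tuple]
  rw [integral_finsetSum _ fun n _ => integrable_finsetSum _ fun C _ => hint n C]
  refine Finset.sum_congr rfl fun n _ => ?_
  rw [integral_finsetSum _ fun C _ => hint n C]
  exact Finset.sum_congr rfl fun C _ => (integral_const_mul _ _).symm

theorem integral_coneSum_tupleCoboundary (hω : ω.Nondegenerate) (halt : ω.IsAlt)
    (hdim : 2 ^ (k + 1) + (k + 1) ≤ finrank 𝕜 V) (f : BddMeas (stiefel ω k)) (p : stiefel ω k) :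
    homotopyFormula ω k (dMeas ω k f).1 p =
      ∫ t, coneSum (k + 1) p.1 t (tupleCoboundary (evalTuple ω f.1)) ∂(chainingLaw ω p.1) := by
  rw [homotopyFormula_eq_integral hω hdim]
  refine integral_congr_ae ?_
  have h : ∀ᵐ t ∂chainingLaw ω p.1, ∀ (n : ℕ) (C : DescChain k n),
      C.tuple p.1 t ∈ stiefel ω (k + 1) :=
    ae_all_iff.2 fun n => ae_all_iff.2 fun C => ae_tuple_mem_stiefel hω halt hdim p.2 C
  filter_upwards [h] with t ht
  rw [← DescChain.sum_sgn_mul_tuple, ← DescChain.sum_sgn_mul_tuple]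
  exact Finset.sum_congr rfl fun n _ => Finset.sum_congr rfl fun C _ =>
    congrArg _ (evalTuple_dMeas f (ht n C))

/-- The identity `coneSum_tupleCoboundary` integrated over t. It serves all degrees, which differ
only in the meaning of the face integrals. -/
theorem homotopyFormula_dMeas_add (hω : ω.Nondegenerate) (halt : ω.IsAlt)
    (hdim : 2 ^ (k + 1) + (k + 1) ≤ finrank 𝕜 V) (f : BddMeas (stiefel ω k)) (p : stiefel ω k)
    (hint : ∀ j : Fin (k + 1), Integrable (fun t => coneSum k (p.1 ∘ j.succAbove)
      (fun J => t (J.image j.succAbove)) (evalTuple ω f.1)) (chainingLaw ω p.1)) :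
    homotopyFormula ω k (dMeas ω k f).1 p + ∑ j : Fin (k + 1), (-1) ^ (j : ℕ) *
      ∫ t, coneSum k (p.1 ∘ j.succAbove) (fun J => t (J.image j.succAbove)) (evalTuple ω f.1)
        ∂(chainingLaw ω p.1) = f.1 p := by
  have : IsProbabilityMeasure (chainingLaw ω p.1) :=
    isProbabilityMeasure_chainingLawUpTo hω hdim p.1 (k + 1)
  have h (t : Finset (Fin (k + 1)) → ℙ 𝕜 V) :
      coneSum (k + 1) p.1 t (tupleCoboundary (evalTuple ω f.1)) = f.1 p -
        ∑ j : Fin (k + 1), (-1) ^ (j : ℕ) *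
          coneSum k (p.1 ∘ j.succAbove) (fun J => t (J.image j.succAbove)) (evalTuple ω f.1) := by
    rw [eq_sub_iff_add_eq, coneSum_tupleCoboundary, evalTuple_of_mem f.1 p.2]
  rw [integral_coneSum_tupleCoboundary hω halt hdim]
  simp only [h]
  rw [integral_sub (integrable_const _)
    (integrable_finsetSum _ fun j _ => (hint j).const_mul _), integral_const,
    integral_finsetSum _ fun j _ => (hint j).const_mul _]
  simp only [integral_const_mul]
  simp

theorem homotopyMeas_dMeas_add (hω : ω.Nondegenerate) (halt : ω.IsAlt)
    (hdim : 2 ^ (k + 1) + (k + 1) ≤ finrank 𝕜 V)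
    (hdim' : 2 ^ (k + 1 + 1) + (k + 1 + 1) ≤ finrank 𝕜 V) (f : BddMeas (stiefel ω (k + 1))) :
    homotopyMeas hω hdim' (dMeas ω (k + 1) f) + dMeas ω k (homotopyMeas hω hdim f) = f := by
  ext p
  have hmap (j : Fin (k + 2)) := map_chainingLaw hω hdim' p.1 j
  have hint (j : Fin (k + 2)) : Integrable (fun t => coneSum (k + 1) (p.1 ∘ j.succAbove)
      (fun J => t (J.image j.succAbove)) (evalTuple ω f.1)) (chainingLaw ω p.1) := by
    have := integrable_coneSum hω hdim f (p.1 ∘ j.succAbove)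
    rw [← hmap j] at this
    exact this.comp_measurable (measurable_restrictFamily j)
  rw [← homotopyFormula_dMeas_add hω halt hdim' f p hint]
  have hsum : (homotopyMeas hω hdim' (dMeas ω (k + 1) f) + dMeas ω k (homotopyMeas hω hdim f)).1 p =
      homotopyFormula ω (k + 1) (dMeas ω (k + 1) f).1 p + ∑ j : Fin (k + 2), (-1) ^ (j : ℕ) *
        homotopyFormula ω k f.1 (face ω j p) := rfl
  rw [hsum]
  refine congrArg (_ + ·) (Finset.sum_congr rfl fun j _ => congrArg (_ * ·) ?_)
  refine (homotopyFormula_eq_integral hω hdim f (face ω j p)).trans ?_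
  have := integrable_coneSum hω hdim f (p.1 ∘ j.succAbove)
  -- The integrand only sees the subsets avoiding `j`, and their joint law is the chaining law of
  -- the face.
  have h1 := integral_map (μ := chainingLaw ω p.1) (measurable_restrictFamily j).aemeasurable
    (f := fun t => coneSum (k + 1) (p.1 ∘ j.succAbove) t (evalTuple ω f.1))
    (by rw [hmap j]; exact this.aestronglyMeasurable)
  rw [hmap j] at h1
  exact h1

/-! ### Degree zero -/

/-- The sampling steps only touch nonempty subsets, so t_∅ keeps its initial law. -/
theorem map_eval_empty_chainingLawUpTo (hω : ω.Nondegenerate)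
    (hdim : 2 ^ (k + 1) + (k + 1) ≤ finrank 𝕜 V) (p : Fin (k + 1) → ℙ 𝕜 V) (m : ℕ) :
    (chainingLawUpTo ω p m).map (fun t => t ∅) = projMeasure (⊤ : Submodule 𝕜 V) := by
  induction m with
  | zero =>
    have : IsProbabilityMeasure (projMeasure (⊤ : Submodule 𝕜 V)) :=
      isProbabilityMeasure_projMeasure_top ((Nat.succ_pos _).trans_le (le_of_add_le_right hdim))
    exact (measurePreserving_eval (fun _ : Finset (Fin (k + 1)) =>
      projMeasure (⊤ : Submodule 𝕜 V)) ∅).map_eq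
  | succ m ih =>
    rw [← ih]
    ext B hB
    have hm : Measurable fun t : Finset (Fin (k + 1)) → ℙ 𝕜 V => t ∅ := measurable_pi_apply _
    rw [Measure.map_apply hm hB, Measure.map_apply hm hB, chainingLawUpTo, Measure.bind_apply (hm hB)
      (measurable_chainingStep_right hω hdim (m + 1) p).aemeasurable,
      ← lintegral_indicator_one (hm hB)]
    refine lintegral_congr fun t => ?_
    have := isProbabilityMeasure_chainingStep hω hdim p (m + 1) t
    have h := ae_chainingStep_eq hω hdim p (m + 1) t
    by_cases ht : t ∅ ∈ B
    · rw [Set.indicator_of_mem (by exact ht), Pi.one_apply, ← prob_compl_eq_zero_iff (hm hB)]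
      filter_upwards [h] with t' ht'
      show t' ∅ ∈ B
      rwa [ht' ∅ (by simp)]
    · rw [Set.indicator_of_notMem (by exact ht), measure_eq_zero_iff_ae_notMem]
      filter_upwards [h] with t' ht'
      show t' ∅ ∉ B
      rwa [ht' ∅ (by simp)]

theorem homotopyNegOne_eq_integral (hω : ω.Nondegenerate) (halt : ω.IsAlt)
    (hV : 2 ≤ finrank 𝕜 V) (f : BddMeas (stiefel ω 0)) :
    homotopyNegOne ω f.1 = ∫ x, evalTuple ω f.1 (fun _ => x) ∂projMeasure (⊤ : Submodule 𝕜 V) := by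
  have hm : Measurable fun (x : ℙ 𝕜 V) (_ : Fin (0 + 1)) => x :=
    measurable_pi_lambda _ fun _ => measurable_id
  have h1 : homotopyNegOne ω f.1 = ∫ x : stiefel ω 0, evalTuple ω f.1 x.1 ∂stiefelMeasure ω 0 :=
    integral_congr_ae (Filter.Eventually.of_forall fun x => (evalTuple_of_mem f.1 x.2).symm)
  rw [h1, stiefelMeasure, integral_subtype_comap (measurableSet_stiefel ω 0) (evalTuple ω f.1),
    Measure.restrict_eq_self_of_ae_mem (ae_tupleMeasure_mem_stiefel hω halt hV), tupleMeasure,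
    integral_map hm.aemeasurable (measurable_evalTuple f.2.1).aestronglyMeasurable]

theorem homotopyMeas_dMeas_zero_add (hω : ω.Nondegenerate) (halt : ω.IsAlt)
    (hdim : 2 ^ (0 + 1) + (0 + 1) ≤ finrank 𝕜 V) (f : BddMeas (stiefel ω 0)) :
    homotopyMeas hω hdim (dMeas ω 0 f) + dNegOne ω (homotopyNegOne ω f.1) = f := by
  ext p
  have hprob : IsProbabilityMeasure (chainingLaw ω p.1) :=
    isProbabilityMeasure_chainingLawUpTo hω hdim p.1 (0 + 1)
  have hm : Measurable fun (x : ℙ 𝕜 V) (_ : Fin (0 + 1)) => x :=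
    measurable_pi_lambda _ fun _ => measurable_id
  have he : Measurable fun t : Finset (Fin (0 + 1)) → ℙ 𝕜 V => t ∅ := measurable_pi_apply _
  have hF : Measurable fun x : ℙ 𝕜 V => evalTuple ω f.1 fun _ => x :=
    (measurable_evalTuple f.2.1).comp hm
  obtain ⟨hf, c, hc⟩ := f.2
  have hint (j : Fin (0 + 1)) : Integrable (fun t => coneSum 0 (p.1 ∘ j.succAbove)
      (fun J => t (J.image j.succAbove)) (evalTuple ω f.1)) (chainingLaw ω p.1) :=
    Integrable.of_bound (hF.comp he).aestronglyMeasurable |c|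
      (Filter.Eventually.of_forall fun t => abs_evalTuple_le hc _)
  rw [← homotopyFormula_dMeas_add hω halt hdim f p hint, Fin.sum_univ_one]
  have hsum : (homotopyMeas hω hdim (dMeas ω 0 f) + dNegOne ω (homotopyNegOne ω f.1)).1 p =
      homotopyFormula ω 0 (dMeas ω 0 f).1 p + homotopyNegOne ω f.1 := rfl
  rw [hsum]
  refine congrArg (_ + ·) ?_
  have h2 := map_eval_empty_chainingLawUpTo hω hdim p.1 (0 + 1)
  rw [homotopyNegOne_eq_integral hω halt (by omega), ← h2,
    integral_map he.aemeasurable hF.aestronglyMeasurable]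
  simp only [Fin.val_zero, pow_zero, one_mul]
  rfl

/-! ### Passage to function classes -/

theorem cls_homotopyMeas_eq_zero (hω : ω.Nondegenerate) (halt : ω.IsAlt) {r : ℕ}
    (hr : finrank 𝕜 V = 2 * r) (hdim : 2 ^ (k + 1) + (k + 1) ≤ finrank 𝕜 V) (hk : k + 2 ≤ r)
    {f : BddMeas (stiefel ω (k + 1))} (hf : cls ω (k + 1) f = 0) :
    cls ω k (homotopyMeas hω hdim f) = 0 := by
  rw [ae_evalTuple_eq_zero_iff hω halt (by omega)] at hf
  have h : ∀ᵐ p ∂tupleMeasure ω k, ∀ (n : ℕ) (C : DescChain k n), ∀ᵐ t ∂chainingLaw ω p,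
      evalTuple ω f.1 (C.tuple p t) = 0 :=
    ae_all_iff.2 fun n => ae_all_iff.2 fun C =>
      ae_chainingLaw_of_ae_tupleMeasure hω halt hr hdim hk C
        (P := fun y => evalTuple ω f.1 y = 0) hf
  replace h := (ae_stiefelMeasure_iff hω halt (by omega) (P := fun p => ∀ (n : ℕ)
    (C : DescChain k n), ∀ᵐ t ∂chainingLaw ω p, evalTuple ω f.1 (C.tuple p t) = 0)).2 h
  rw [toLinf_eq_zero_iff]
  filter_upwards [h] with p hp
  have hp' : (homotopyMeas hω hdim f).1 p = homotopyFormula ω k f.1 p := rfl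
  rw [hp', homotopyFormula]
  refine Finset.sum_eq_zero fun n _ => Finset.sum_eq_zero fun C _ => ?_
  rw [partialHomotopy, integral_eq_zero_of_ae (hp n C), mul_zero]

theorem cls_dMeas_eq_zero (hω : ω.Nondegenerate) (halt : ω.IsAlt) {r : ℕ}
    (hr : finrank 𝕜 V = 2 * r) (hk : k + 2 ≤ r)
    {f : BddMeas (stiefel ω k)} (hf : cls ω k f = 0) : cls ω (k + 1) (dMeas ω k f) = 0 := by
  rw [ae_evalTuple_eq_zero_iff hω halt (by omega)] at hf
  have h : ∀ᵐ y ∂tupleMeasure ω (k + 1), ∀ i : Fin (k + 2),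
      evalTuple ω f.1 (fun j => y (i.succAbove j)) = 0 :=
    ae_all_iff.2 fun i => ae_face_of_ae_tupleMeasure hω halt hr hk i hf
  rw [← ae_stiefelMeasure_iff hω halt (by omega)] at h
  rw [toLinf_eq_zero_iff]
  filter_upwards [h] with y hy
  have hy' : (dMeas ω k f).1 y = ∑ i : Fin (k + 2), (-1) ^ (i : ℕ) * f.1 (face ω i y) := rfl
  rw [hy']
  refine Finset.sum_eq_zero fun i _ => ?_
  have := hy i
  rw [evalTuple_of_mem f.1 (face_mem ω i y.2)] at this
  exact mul_eq_zero_of_right _ this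

/-- The operator `h^{-1}` on bounded measurable functions. -/
noncomputable def homotopyMeasNegOne (hω : ω.Nondegenerate) (halt : ω.IsAlt)
    (hV : 2 ≤ finrank 𝕜 V) : BddMeas (stiefel ω 0) →ₗ[ℝ] ℝ where
  toFun f := homotopyNegOne ω f.1
  map_add' f g := by
    have := isProbabilityMeasure_stiefelMeasure (k := 0) hω halt hV
    have hint (f : BddMeas (stiefel ω 0)) : Integrable f.1 (stiefelMeasure ω 0) := by
      obtain ⟨hf, c, hc⟩ := f.2
      exact Integrable.of_bound hf.aestronglyMeasurable c (Filter.Eventually.of_forall hc)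
    exact integral_add (hint f) (hint g)
  map_smul' a f := integral_const_mul a f.1

theorem homotopyMeasNegOne_dNegOne (hω : ω.Nondegenerate) (halt : ω.IsAlt)
    (hV : 2 ≤ finrank 𝕜 V) (c : ℝ) : homotopyMeasNegOne hω halt hV (dNegOne ω c) = c := by
  have := isProbabilityMeasure_stiefelMeasure (k := 0) hω halt hV
  have h : homotopyMeasNegOne hω halt hV (dNegOne ω c) = ∫ _, c ∂stiefelMeasure ω 0 := rfl
  rw [h, integral_const]
  simp

end Homotopy

/-- Doubling absorbs the ceiling into q + 1. The first bound feeds the dimension counts; the second,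
from q < 2^q and the positivity of the ceiling, is the room needed for Witt's theorem on X_{q+1}. -/
theorem two_pow_add_le_of_ceil {q r : ℕ} (hq : 2 ^ q + ⌈((q : ℚ) + 1) / 2⌉₊ ≤ r) :
    2 ^ (q + 1) + (q + 1) ≤ 2 * r ∧ q + 2 ≤ r := by
  have h1 := Nat.le_ceil (((q : ℚ) + 1) / 2)
  have h2 : q + 1 ≤ 2 * ⌈((q : ℚ) + 1) / 2⌉₊ := by
    have : ((q + 1 : ℕ) : ℚ) ≤ ((2 * ⌈((q : ℚ) + 1) / 2⌉₊ : ℕ) : ℚ) := by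
      push_cast
      linarith
    exact_mod_cast this
  have h3 : q < 2 ^ q := Nat.lt_two_pow_self
  rw [pow_succ]
  omega

end SympStiefel

/-! ### Assembly of the contracting homotopy and exactness. -/

theorem theorem4p1 {𝕜 : Type*} [RCLike 𝕜] {V : Type*} [NormedAddCommGroup V]
    [InnerProductSpace 𝕜 V] [FiniteDimensional 𝕜 V] [MeasurableSpace V] [BorelSpace V]
    (ω : V →ₗ[𝕜] V →ₗ[𝕜] 𝕜) (hω_alt : ω.IsAlt) (hω_nondeg : ω.Nondegenerate)
    (r q : ℕ) (hr : finrank 𝕜 V = 2 * r) (hq : 2 ^ q + ⌈((q : ℚ) + 1) / 2⌉₊ ≤ r) :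
    -- the random variables `t(p, C)` are well defined and take values in `X_{k+1}`
    (∀ k ≤ q, ∀ p ∈ stiefel ω k, IsProbabilityMeasure (chainingLaw ω p) ∧
      ∀ (n : ℕ) (C : DescChain k n),
        ∀ᵐ t ∂(chainingLaw ω p), C.tuple p t ∈ stiefel ω (k + 1)) ∧
    -- the formulas define linear operators on bounded measurable functions ...
    ∃ (hNeg : BddMeas (stiefel ω 0) →ₗ[ℝ] ℝ)
      (h : (k : ℕ) → BddMeas (stiefel ω (k + 1)) →ₗ[ℝ] BddMeas (stiefel ω k)),
      (∀ f, hNeg f = homotopyNegOne ω f.1) ∧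
      (∀ k ≤ q, ∀ f p, (h k f).1 p = homotopyFormula ω k f.1 p) ∧
      -- ... which are a contracting homotopy in degrees `-1, 0, …, q`
      (∀ c : ℝ, hNeg (dNegOne ω c) = c) ∧
      (∀ f, h 0 (dMeas ω 0 f) + dNegOne ω (hNeg f) = f) ∧
      (∀ k, k + 1 ≤ q → ∀ f, h (k + 1) (dMeas ω (k + 1) f) + dMeas ω k (h k f) = f) ∧
      -- the complex of bounded measurable functions is exact up to degree `q`
      Function.Injective (dNegOne ω) ∧
      Function.Exact (dNegOne ω) (dMeas ω 0) ∧
      (∀ k, k + 1 ≤ q → Function.Exact (dMeas ω k) (dMeas ω (k + 1))) ∧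
      -- the operators `h^k`, `-1 ≤ k ≤ q`, descend to function classes
      (∃ (hNegL : Linf ω 0 →ₗ[ℝ] ℝ) (hL : (k : ℕ) → Linf ω (k + 1) →ₗ[ℝ] Linf ω k),
        (∀ f, hNegL (cls ω 0 f) = hNeg f) ∧
        (∀ k ≤ q, ∀ f, hL k (cls ω (k + 1) f) = cls ω k (h k f))) ∧
      -- so do the coboundary operators, and the resulting complex is exact up to degree `q`
      (∃ dL : (k : ℕ) → Linf ω k →ₗ[ℝ] Linf ω (k + 1),
        (∀ k ≤ q, ∀ f, dL k (cls ω k f) = cls ω (k + 1) (dMeas ω k f)) ∧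
        Function.Injective (cls ω 0 ∘ₗ dNegOne ω) ∧
        Function.Exact (cls ω 0 ∘ₗ dNegOne ω) (dL 0) ∧
        (∀ k, k + 1 ≤ q → Function.Exact (dL k) (dL (k + 1)))) := by
  obtain ⟨hq1, hq2⟩ := two_pow_add_le_of_ceil hq
  have hV : 2 ≤ finrank 𝕜 V := by omega
  have hdim (k : ℕ) (hk : k ≤ q) : 2 ^ (k + 1) + (k + 1) ≤ finrank 𝕜 V := by
    have : 2 ^ (k + 1) ≤ 2 ^ (q + 1) := Nat.pow_le_pow_right (by norm_num) (by omega)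
    omega
  obtain ⟨hNeg, hhNeg⟩ : ∃ g, g = homotopyMeasNegOne hω_nondeg hω_alt hV := ⟨_, rfl⟩
  have hNeg_apply (f : BddMeas (stiefel ω 0)) : hNeg f = homotopyNegOne ω f.1 := by
    rw [hhNeg]
    rfl
  have hNeg_dNegOne (c : ℝ) : hNeg (dNegOne ω c) = c := by
    rw [hhNeg]
    exact homotopyMeasNegOne_dNegOne hω_nondeg hω_alt hV c
  -- The operators are totalized by zero for `k > q`, where nothing is claimed about them.
  have hex (k : ℕ) : ∃ h : BddMeas (stiefel ω (k + 1)) →ₗ[ℝ] BddMeas (stiefel ω k),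
      ∀ hk : k ≤ q, h = homotopyMeas hω_nondeg (hdim k hk) := by
    by_cases hk : k ≤ q
    · exact ⟨homotopyMeas hω_nondeg (hdim k hk), fun _ => rfl⟩
    · exact ⟨0, fun h => absurd h hk⟩
  choose h hh using hex
  have hzero (f : BddMeas (stiefel ω 0)) : h 0 (dMeas ω 0 f) + dNegOne ω (hNeg f) = f := by
    rw [hh 0 (Nat.zero_le q), hNeg_apply]
    exact homotopyMeas_dMeas_zero_add hω_nondeg hω_alt _ f
  have hsucc (k : ℕ) (hk : k + 1 ≤ q) (f : BddMeas (stiefel ω (k + 1))) :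
      h (k + 1) (dMeas ω (k + 1) f) + dMeas ω k (h k f) = f := by
    rw [hh (k + 1) hk, hh k (by omega)]
    exact homotopyMeas_dMeas_add hω_nondeg hω_alt _ _ f
  obtain ⟨hNegL, hhNegL⟩ := exists_linearMap_comp_eq (toLinf_surjective (stiefelMeasure ω 0)) hNeg
    fun f hf => by
      rw [hNeg_apply]
      exact integral_eq_zero_of_ae (toLinf_eq_zero_iff.1 hf)
  have hexL (k : ℕ) : ∃ L : Linf ω (k + 1) →ₗ[ℝ] Linf ω k,
      k ≤ q → ∀ f, L (cls ω (k + 1) f) = cls ω k (h k f) := by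
    by_cases hk : k ≤ q
    · obtain ⟨L, hL⟩ := exists_linearMap_comp_eq (toLinf_surjective (stiefelMeasure ω (k + 1)))
        (cls ω k ∘ₗ h k) fun f hf => by
          rw [LinearMap.comp_apply, hh k hk]
          exact cls_homotopyMeas_eq_zero hω_nondeg hω_alt hr _ (by omega) hf
      exact ⟨L, fun _ => hL⟩
    · exact ⟨0, fun h => absurd h hk⟩
  choose hL hhL using hexL
  have hexd (k : ℕ) : ∃ L : Linf ω k →ₗ[ℝ] Linf ω (k + 1),
      k ≤ q → ∀ f, L (cls ω k f) = cls ω (k + 1) (dMeas ω k f) := by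
    by_cases hk : k ≤ q
    · obtain ⟨L, hL⟩ := exists_linearMap_comp_eq (toLinf_surjective (stiefelMeasure ω k))
        (cls ω (k + 1) ∘ₗ dMeas ω k) fun f hf => by
          rw [LinearMap.comp_apply]
          exact cls_dMeas_eq_zero hω_nondeg hω_alt hr (by omega) hf
      exact ⟨L, fun _ => hL⟩
    · exact ⟨0, fun h => absurd h hk⟩
  choose dL hdL using hexd
  refine ⟨fun k hk p hp => ⟨isProbabilityMeasure_chainingLawUpTo hω_nondeg (hdim k hk) p (k + 1),
    fun n C => ae_tuple_mem_stiefel hω_nondeg hω_alt (hdim k hk) hp C⟩, hNeg, h, hNeg_apply,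
    fun k hk f p => by rw [hh k hk]; rfl, hNeg_dNegOne, hzero, hsucc,
    Function.LeftInverse.injective (g := hNeg) hNeg_dNegOne, fun f => ⟨fun hf => ?_, ?_⟩,
    fun k hk f => ⟨fun hf => ?_, ?_⟩, ⟨hNegL, hL, hhNegL, hhL⟩, dL, hdL,
    Function.LeftInverse.injective (g := hNegL) fun c => (hhNegL _).trans (hNeg_dNegOne c),
    fun F => ⟨fun hF => ?_, ?_⟩, fun k hk F => ⟨fun hF => ?_, ?_⟩⟩
  -- Exactness is formal: by the homotopy identity a cocycle is the coboundary of its image under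
  -- the homotopy. For classes the identity is applied to bounded representatives.
  · refine ⟨hNeg f, ?_⟩
    have := hzero f
    rw [hf, map_zero] at this
    exact (zero_add _).symm.trans this
  · rintro ⟨c, rfl⟩
    exact dMeas_dNegOne c
  · refine ⟨h k f, ?_⟩
    have := hsucc k hk f
    rwa [hf, map_zero, zero_add] at this
  · rintro ⟨g, rfl⟩
    exact dMeas_dMeas g
  · obtain ⟨f, rfl⟩ := toLinf_surjective (stiefelMeasure ω 0) F
    refine ⟨hNeg f, ?_⟩
    rw [hdL 0 (Nat.zero_le q)] at hF
    have := congrArg (cls ω 0) (hzero f)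
    rw [map_add, ← hhL 0 (Nat.zero_le q), hF, map_zero, zero_add] at this
    exact this
  · rintro ⟨c, rfl⟩
    rw [LinearMap.comp_apply, hdL 0 (Nat.zero_le q), dMeas_dNegOne, map_zero]
  · obtain ⟨f, rfl⟩ := toLinf_surjective (stiefelMeasure ω (k + 1)) F
    refine ⟨cls ω k (h k f), ?_⟩
    rw [hdL (k + 1) hk] at hF
    have := congrArg (cls ω (k + 1)) (hsucc k hk f)
    rw [map_add, ← hhL (k + 1) hk, hF, map_zero, zero_add] at this
    rw [hdL k (by omega), this]
  · rintro ⟨G, rfl⟩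
    obtain ⟨g, rfl⟩ := toLinf_surjective (stiefelMeasure ω k) G
    rw [hdL k (by omega), hdL (k + 1) hk, dMeas_dMeas, map_zero]
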